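/- Let $dS_3$ be the unit hyperboloid $\{-X_0^2+X_1^2+X_2^2+X_3^2=1\}$ in Minkowski space with coordinates $X_0=\sinh\tau$, $X_k=\cosh\tau\, f_{(k)}$, where $f_{(1)}=\cos\theta$, $f_{(2)}=\sin\theta\cos\phi$, $f_{(3)}=\sin\theta\sin\phi$, with its induced metric $h=-d\tau^2+\cosh^2\tau\,\eta$, $\eta=d\theta^2+\sin^2\theta\,d\phi^2$, Levi-Civita derivative $\mathcal D$, $\square=\mathcal D^a\mathcal D_a$, and volume form $\epsilon_{\tau\theta\phi}=\cosh^2\tau\sin\theta$. Put $\zeta_{(0)}=\sinh\tau$, $\zeta_{(k)}=\cosh\tau f_{(k)}$ for $k=1,2,3$, and $\zeta^a_{(l)}=\mathcal D^a\zeta_{(l)}$ for $l=0,\dots,3$ (translations). Let $\xi_{\mathrm{rot}(k)}$ be the rotation Killing fields $X_{k+1}\partial_{k+2}-X_{k+2}\partial_{k+1}$ (spatial indices modulo 3) and $\xi_{\mathrm{boost}(k)}=X_k\partial_0+X_0\partial_k$ the boost Killing fields. A cut $S$ is a smooth spacelike Cauchy surface, that is a spacelike graph $\tau=s(\theta,\phi)$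 of a smooth function $s$ on the unit two-sphere, $n^a$ is its future unit normal and $d^2S$ its induced area element. Call $T_{ab}$ a solution if it is a smooth symmetric tensor field on all of $dS_3$ with $T^a{}_a=0$, $\mathcal D^bT_{ab}=0$, $(\square-2)T_{ab}=0$. For $k=1,2,3$ define symmetric tensors, with $i,j$ indices on the two-sphere and $\epsilon_i{}^j$ formed with $\eta$ and its area form ($\epsilon_{\theta\phi}=\sin\theta$), by \[V_{(k)\tau\tau}=2\,\mathrm{sech}^5\tau\,\zeta_{(k)},\quad V_{(k)\tau i}=\mathrm{sech}^3\tau\tanh\tau\,\partial_i\zeta_{(k)},\quad V_{(k)ij}=\eta_{ij}\,\mathrm{sech}^3\tau\,\zeta_{(k)},\] \[W_{(k)\tau\tau}=0,\quad W_{(k)\tau i}=\mathrm{sech}^3\tau\,\epsilon_i{}^j\partial_j\zeta_{(k)},\quad W_{(k)ij}=0.\] Then all $V_{(k)}$, $W_{(k)}$ are solutions, and they are dual to each other: \[\epsilon_a{}^{cd}\mathcal D_cV_{(k)db}=-W_{(k)ab},\qquad \epsilon_a{}^{cd}\mathcal D_cW_{(k)db}=V_{(k)ab}.\] On every cut $S$,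 \[\int_SV_{(k)ab}\zeta^a_{(l)}n^b\,d^2S=\int_SW_{(k)ab}\zeta^a_{(l)}n^b\,d^2S=0\quad(l=0,\dots,3),\] \[\int_SV_{(k)ab}\xi^a_{\mathrm{rot}(l)}n^b\,d^2S=\int_SW_{(k)ab}\xi^a_{\mathrm{boost}(l)}n^b\,d^2S=0\quad(l=1,2,3),\] \[\int_SV_{(k)ab}\xi^a_{\mathrm{boost}(l)}n^b\,d^2S=\int_SW_{(k)ab}\xi^a_{\mathrm{rot}(l)}n^b\,d^2S=\tfrac{8\pi}{3}\delta_{kl}\quad(l=1,2,3).\] Moreover, for every solution $T_{ab}$ there are real numbers $v_{(i)},w_{(i)}$ and a solution $J_{ab}$ with \[T_{ab}=\sum_{i=1}^3\bigl(v_{(i)}V_{(i)ab}+w_{(i)}W_{(i)ab}\bigr)+J_{ab}\] such that on every cut $S$ \[\int_SJ_{ab}\xi^a_{\mathrm{rot}(l)}n^b\,d^2S=\int_SJ_{ab}\xi^a_{\mathrm{boost}(l)}n^b\,d^2S=\int_SJ_{ab}\zeta^a_{(m)}n^b\,d^2S=0\quad(l=1,2,3,\ m=0,\dots,3).\] The decomposition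 is unique: any decomposition of $T$ of this form whose remainder is a solution with all these charges zero on at least one cut has the same $v_{(i)}$, $w_{(i)}$ and $J_{ab}$. -/

import Mathlib

open scoped ContDiff

namespace DeSitter

noncomputable section

/-! ### The hyperboloid in Minkowski space

Minkowski space is `Fin 4 → ℝ` with index `0` for time.  An index `a : Fin 4` on a tensor of the
hyperboloid is an ambient one; tensors of the hyperboloid are represented by their ambient
components, extended by zero on the normal direction `X`.  For such tensors, contracting with the
Minkowski metric is the same as contracting with the metric induced on the hyperboloid. -/

/-- The diagonal entries of the Minkowski metric `diag(-1,1,1,1)` (and of its inverse). -/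
def sgn : Fin 4 → ℝ := ![-1, 1, 1, 1]

/-- The Minkowski product of two vectors. -/
def mink (x y : Fin 4 → ℝ) : ℝ := ∑ a, sgn a * x a * y a

/-- Three-dimensional de Sitter space: the unit hyperboloid `-X₀² + X₁² + X₂² + X₃² = 1`. -/
def dS3 : Set (Fin 4 → ℝ) := {X | mink X X = 1}

/-- The point with hyperbolic coordinates `(τ, θ, φ)`, in which the induced metric is
`-dτ² + cosh² τ (dθ² + sin² θ dφ²)`. -/
def point (τ θ φ : ℝ) : dS3 :=
  ⟨![Real.sinh τ, Real.cosh τ * Real.cos θ, Real.cosh τ * (Real.sin θ * Real.cos φ),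
      Real.cosh τ * (Real.sin θ * Real.sin φ)], by
    have h1 := Real.cosh_sq τ
    have h2 := Real.sin_sq_add_cos_sq θ
    have h3 := Real.sin_sq_add_cos_sq φ
    simp only [dS3, mink, sgn, Set.mem_ofPred_eq, Fin.sum_univ_four, Matrix.cons_val]
    linear_combination (Real.cosh τ ^ 2 * Real.sin θ ^ 2) * h3 + Real.cosh τ ^ 2 * h2 + h1⟩

/-- The radial projection `Y ↦ Y / √⟨Y,Y⟩` of the open set `⟨Y,Y⟩ > 0` onto the hyperboloid
(an irrelevant constant elsewhere). -/
def radialProj (Y : Fin 4 → ℝ) : dS3 :=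
  open Classical in
  if h : 0 < mink Y Y then
    ⟨(√(mink Y Y))⁻¹ • Y, by
      have h2 : √(mink Y Y) ^ 2 = mink Y Y := Real.sq_sqrt h.le
      have h3 : √(mink Y Y) ≠ 0 := (Real.sqrt_pos.2 h).ne'
      have h4 : mink ((√(mink Y Y))⁻¹ • Y) ((√(mink Y Y))⁻¹ • Y)
          = ((√(mink Y Y)) ^ 2)⁻¹ * mink Y Y := by
        simp only [mink, Pi.smul_apply, smul_eq_mul, Finset.mul_sum, ← inv_pow]
        exact Finset.sum_congr rfl fun a _ => by ring
      rw [dS3, Set.mem_ofPred_eq, h4, h2, inv_mul_cancel₀ h.ne']⟩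
  else point 0 0 0

/-- Smoothness of a function on the hyperboloid: its extension, constant along rays, is smooth on
the open set `⟨Y,Y⟩ > 0`. -/
def Smooth (F : dS3 → ℝ) : Prop :=
  ContDiffOn ℝ ∞ (fun Y => F (radialProj Y)) {Y | 0 < mink Y Y}

/-- The ambient components `∂_a F` of the differential of a function on the hyperboloid:
the partial derivatives of the extension of `F` which is constant along rays.  In particular the
derivative in the normal direction `X` is zero. -/
def dif (F : dS3 → ℝ) (X : dS3) (a : Fin 4) : ℝ :=
  fderiv ℝ (fun Y => F (radialProj Y)) (X : Fin 4 → ℝ) (Pi.single a 1)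

/-- The orthogonal projection `δ^c_a - X^c X_a` onto the tangent space at `X`. -/
def proj (X : dS3) (c a : Fin 4) : ℝ := (if c = a then 1 else 0) - X.1 c * (sgn a * X.1 a)

/-- The metric `h_{ab}` of the hyperboloid, induced from Minkowski space. -/
def metric (X : dS3) (a b : Fin 4) : ℝ :=
  (if a = b then sgn a else 0) - (sgn a * X.1 a) * (sgn b * X.1 b)

/-- The volume form `ε_{abc}`, oriented by `ε_{τθφ} = + cosh² τ sin θ`. -/
def vol (X : dS3) (a b c : Fin 4) : ℝ :=
  Matrix.det (Matrix.of ![Pi.single a 1, X.1, Pi.single b 1, Pi.single c 1])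

/-! ### Covariant tensor fields of rank two and their derivatives -/

/-- Ambient components `T_{ab}` of a covariant tensor field of rank two. -/
abbrev Field2 : Type := dS3 → Fin 4 → Fin 4 → ℝ

/-- `T` is a regular (that is, smooth) covariant tensor field of rank two on the hyperboloid. -/
structure IsTensor (T : Field2) : Prop where
  tangent_left : ∀ X b, ∑ a, X.1 a * T X a b = 0
  tangent_right : ∀ X a, ∑ b, X.1 b * T X a b = 0
  smooth : ∀ a b, Smooth (fun X => T X a b)

/-- The Levi-Civita covariant derivative `D_c T_{ab}` of a tensor of rank two: the tangential
projection of the flat derivative. -/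
def cov2 (T : Field2) (X : dS3) (c a b : Fin 4) : ℝ :=
  ∑ a', ∑ b', proj X a' a * proj X b' b * dif (fun Y => T Y a' b') X c

/-- The Levi-Civita covariant derivative `D_d U_{cab}` of a tensor of rank three. -/
def cov3 (U : dS3 → Fin 4 → Fin 4 → Fin 4 → ℝ) (X : dS3) (d c a b : Fin 4) : ℝ :=
  ∑ c', ∑ a', ∑ b', proj X c' c * proj X a' a * proj X b' b * dif (fun Y => U Y c' a' b') X d

/-- The wave operator `□ T_{ab} = D^c D_c T_{ab}`. -/
def box (T : Field2) : Field2 := fun X a b => ∑ c, sgn c * cov3 (cov2 T) X c c a b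

/-- The curl `(curl T)_{ab} = ε_a^{cd} D_c T_{db}`. -/
def curl (T : Field2) : Field2 := fun X a b =>
  ∑ c, ∑ d, vol X a c d * sgn c * sgn d * cov2 T X c d b

/-- `T` is a regular symmetric, traceless, divergence-free tensor with `(□ - 2) T = 0`. -/
structure IsSolution (T : Field2) : Prop where
  tensor : IsTensor T
  symm : ∀ X a b, T X a b = T X b a
  traceless : ∀ X, ∑ a, sgn a * T X a a = 0
  div_free : ∀ X a, ∑ b, sgn b * cov2 T X b a b = 0
  wave : ∀ X a b, box T X a b - 2 * T X a b = 0

/-! ### The functions `τ`, `f_(k)`, `ζ_(l)` and the tensors `V_(k)`, `W_(k)` -/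

/-- The time function `τ`. -/
def tau (X : dS3) : ℝ := Real.arsinh (X.1 0)

/-- The three `l = 1` harmonics `cos θ`, `sin θ cos φ`, `sin θ sin φ`; together they are the
direction in the unit sphere of the point `X`. -/
def harm (X : dS3) (k : Fin 3) : ℝ := X.1 k.succ / Real.cosh (tau X)

/-- The functions `ζ_(0) = sinh τ` and `ζ_(k) = cosh τ f_(k)`, `k = 1, 2, 3`: these are the
restrictions of the Minkowski coordinates. -/
def zeta (l : Fin 4) (X : dS3) : ℝ := X.1 l

/-- The coordinate vector `∂_τ`; it is minus the gradient of `τ`. -/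
def ptau (X : dS3) (a : Fin 4) : ℝ := - (sgn a * dif tau X a)

/-- The part `∂_i F dx^i` of `dF` along the sphere coordinates, `dF - (∂_τ F) dτ`. -/
def difSphere (F : dS3 → ℝ) (X : dS3) (a : Fin 4) : ℝ :=
  dif F X a - (∑ c, ptau X c * dif F X c) * dif tau X a

/-- The round metric `η_{ij} dx^i dx^j` of the unit two-sphere, from
`h = -dτ² + cosh² τ η`. -/
def round (X : dS3) (a b : Fin 4) : ℝ :=
  (metric X a b + dif tau X a * dif tau X b) / Real.cosh (tau X) ^ 2

/-- The one-form `ε_i^j α_j` for a one-form `α` along the sphere, where `ε` is the area form of the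
round unit sphere (`ε_{θφ} = sin θ`) and the index is raised with `η`.  Since
`ε_{ij} = cosh⁻² τ ε_{τij}` and `η^{ij} = cosh² τ h^{ij}` the powers of `cosh τ` cancel. -/
def dualSphere (α : dS3 → Fin 4 → ℝ) (X : dS3) (a : Fin 4) : ℝ :=
  ∑ c, ∑ b, ptau X c * vol X c a b * (sgn b * α X b)

/-- The tensors `V_(k)`: `V_{ττ} = 2 sech⁵ τ ζ`, `V_{τi} = sech³ τ tanh τ ∂_i ζ`,
`V_{ij} = η_{ij} sech³ τ ζ` with `ζ = ζ_(k)`. -/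
def V (k : Fin 3) : Field2 := fun X a b =>
  2 * (Real.cosh (tau X))⁻¹ ^ 5 * zeta k.succ X * (dif tau X a * dif tau X b)
  + (Real.cosh (tau X))⁻¹ ^ 3 * Real.tanh (tau X) *
      (dif tau X a * difSphere (zeta k.succ) X b + difSphere (zeta k.succ) X a * dif tau X b)
  + (Real.cosh (tau X))⁻¹ ^ 3 * zeta k.succ X * round X a b

/-- The tensors `W_(k)`: `W_{ττ} = 0`, `W_{τi} = sech³ τ ε_i^j ∂_j ζ`, `W_{ij} = 0` with
`ζ = ζ_(k)`. -/
def W (k : Fin 3) : Field2 := fun X a b =>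
  (Real.cosh (tau X))⁻¹ ^ 3 *
      (dif tau X a * dualSphere (difSphere (zeta k.succ)) X b
        + dualSphere (difSphere (zeta k.succ)) X a * dif tau X b)

/-! ### Killing vectors, cuts and charges -/

/-- The rotation Killing vectors: `rot 0 = X₂ ∂₃ - X₃ ∂₂ = ∂_φ` and cyclic permutations. -/
def rot (k : Fin 3) (X : dS3) : Fin 4 → ℝ :=
  Pi.single (k + 2).succ (X.1 (k + 1).succ) - Pi.single (k + 1).succ (X.1 (k + 2).succ)

/-- The boost Killing vectors `X_k ∂₀ + X₀ ∂_k`, that is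
`f_(k) ∂_τ + cosh τ sinh τ h^{ab} ∂_b f_(k)`. -/
def boost (k : Fin 3) (X : dS3) : Fin 4 → ℝ :=
  Pi.single 0 (X.1 k.succ) + Pi.single k.succ (X.1 0)

/-- The translation vectors `ζ_(l)^a = D^a ζ_(l)`. -/
def transl (l : Fin 4) (X : dS3) : Fin 4 → ℝ := fun a => sgn a * dif (zeta l) X a

/-- A cut (smooth spacelike Cauchy surface) of the hyperboloid: a graph `τ = s(ω)` over the unit
sphere, `s` being (the restriction of) a smooth function, with timelike conormal `dτ - ds`. -/
structure Cut where
  height : (Fin 3 → ℝ) → ℝ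
  smooth : ContDiff ℝ ∞ height
  spacelike : ∀ X : dS3, tau X = height (harm X) →
    ∑ a, sgn a * dif (fun Y => tau Y - height (harm Y)) X a ^ 2 < 0

namespace Cut

/-- The conormal `d(τ - s)` of the cut. -/
def conormal (S : Cut) (X : dS3) (a : Fin 4) : ℝ := dif (fun Y => tau Y - S.height (harm Y)) X a

/-- The future unit normal `n^a` of the cut (`n = ∂_τ` if `s` is constant). -/
def normal (S : Cut) (X : dS3) (a : Fin 4) : ℝ :=
  - (sgn a * S.conormal X a) / √(-∑ c, sgn c * S.conormal X c ^ 2)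

/-- The parametrization of the cut by the angles. -/
def param (S : Cut) (θ φ : ℝ) : dS3 :=
  point (S.height ![Real.cos θ, Real.sin θ * Real.cos φ, Real.sin θ * Real.sin φ]) θ φ

/-- The tangent vector `∂_θ` of the cut. -/
def tangentTheta (S : Cut) (θ φ : ℝ) : Fin 4 → ℝ :=
  deriv (fun t => (S.param t φ : Fin 4 → ℝ)) θ

/-- The tangent vector `∂_φ` of the cut. -/
def tangentPhi (S : Cut) (θ φ : ℝ) : Fin 4 → ℝ :=
  deriv (fun t => (S.param θ t : Fin 4 → ℝ)) φ

/-- The density of the induced area element, `d²S = S.area θ φ dθ dφ`. -/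
def area (S : Cut) (θ φ : ℝ) : ℝ :=
  √(mink (S.tangentTheta θ φ) (S.tangentTheta θ φ) * mink (S.tangentPhi θ φ) (S.tangentPhi θ φ)
    - mink (S.tangentTheta θ φ) (S.tangentPhi θ φ) ^ 2)

/-- The charge `∫_S T_{ab} ξ^a n^b d²S`. -/
def charge (S : Cut) (T : Field2) (ξ : dS3 → Fin 4 → ℝ) : ℝ :=
  ∫ θ in (0 : ℝ)..Real.pi, ∫ φ in (0 : ℝ)..(2 * Real.pi),
    (∑ a, ∑ b, T (S.param θ φ) a b * ξ (S.param θ φ) a * S.normal (S.param θ φ) b) * S.area θ φ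

/-- All rotation, boost and translation charges of `J` on the cut `S` vanish. -/
def NoCharges (S : Cut) (J : Field2) : Prop :=
  (∀ k, S.charge J (rot k) = 0) ∧ (∀ k, S.charge J (boost k) = 0) ∧
    (∀ l, S.charge J (transl l) = 0)

end Cut

/-- `T = ∑ᵢ (vᵢ V_(i) + wᵢ W_(i)) + J`. -/
def Decomposes (T : Field2) (v w : Fin 3 → ℝ) (J : Field2) : Prop :=
  ∀ X a b, T X a b = ∑ i, (v i * V i X a b + w i * W i X a b) + J X a b

end

end DeSitter

open DeSitter

/-!
# Charges of symmetric, transverse, traceless tensors on `dS₃`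

A function on the hyperboloid is extended to the cone `⟨Y,Y⟩ > 0` of Minkowski space as a constant
along rays (`ext`).  In terms of the extended ambient components, a tensor field is a solution iff
it is symmetric, tangential, traceless, divergence-free and annihilated by the *flat* wave operator
(`isSolution_iff`): the curvature terms in `□ - 2` are those produced by the tangential projections.
This turns the field equations for `V_(k)` and `W_(k)` into polynomial identities, because their
ambient components extend to `P(Y) r⁻ⁿ` with `P` a homogeneous polynomial of degree `n` and `r` the
spatial radius, which is `cosh τ` on the hyperboloid (`V_eq`, `W_eq`, `isFlatSolution_of_frac`).
The duality `curl W = V` is a polynomial identity too (`curl_W`), and `curl V = -W` follows from it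
since the curl of the curl is `-1` on solutions (`IsFlatSolution.curl_curl`).

With its second ambient index fixed, a solution is a divergence-free one-form with harmonic
components (`IsHarmonicForm`), and all facts about charges are facts about such forms and about
conserved currents.  The charge of `ξ` on a cut is up to sign the flux of the current `T_a^b ξ^a`,
the integral of the two-form `det(v, X, ·, ·)` (`Cut.charge_eq`).
* If `ξ` is a Killing field, the current is divergence-free, so its flux form is closed, and Stokes'
  theorem on the region swept out by the graphs `τ = t s(ω)`, `0 ≤ t ≤ 1`, shows that the charge is
  the one on the cut `τ = 0` (`IsConserved.flux_eq`, `IsFlatSolution.charge_killing`).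
* The current of the translation `ζ_(l)` is the column `T_{al}`.  The flux form of a harmonic
  one-form is up to sign the exterior derivative of its curl, so every translation charge of every
  solution vanishes (`IsHarmonicForm.exterior_curlForm_tangent`, `IsFlatSolution.charge_transl`).

On `τ = 0` the normal components of `V_(k)` and `W_(k)` are `2 f_(k)` along `∂_τ` and the rotation
`e_k × f`, so their charges reduce to the second moments of the unit sphere.  The matrix of boost
and rotation charges of the `V_(k)`, `W_(k)` being `8π/3` times the identity, the charges of a
solution fix the coefficients of its decomposition, which gives both existence and uniqueness
(`restCharge_of_decomposes`).
-/

namespace DeSitter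

noncomputable section

/-! ### Determinants and the Minkowski product on `ℝ⁴` -/

/-- The standard volume form of `ℝ⁴`: `vol X a b c` is `det4 e_a X e_b e_c`. -/
def det4 (u v w x : Fin 4 → ℝ) : ℝ := Matrix.det (Matrix.of ![u, v, w, x])

/-- The coordinate vector `e_a` of `ℝ⁴`. -/
abbrev basisVec (a : Fin 4) : Fin 4 → ℝ := Pi.single a 1

lemma det4_eq (u v w x : Fin 4 → ℝ) :
    det4 u v w x =
      u 0 * (v 1 * (w 2 * x 3 - w 3 * x 2) - v 2 * (w 1 * x 3 - w 3 * x 1)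
        + v 3 * (w 1 * x 2 - w 2 * x 1))
      - u 1 * (v 0 * (w 2 * x 3 - w 3 * x 2) - v 2 * (w 0 * x 3 - w 3 * x 0)
        + v 3 * (w 0 * x 2 - w 2 * x 0))
      + u 2 * (v 0 * (w 1 * x 3 - w 3 * x 1) - v 1 * (w 0 * x 3 - w 3 * x 0)
        + v 3 * (w 0 * x 1 - w 1 * x 0))
      - u 3 * (v 0 * (w 1 * x 2 - w 2 * x 1) - v 1 * (w 0 * x 2 - w 2 * x 0)
        + v 2 * (w 0 * x 1 - w 1 * x 0)) := by
  simp [det4, Matrix.det_succ_row_zero, Fin.sum_univ_succ, Fin.succAbove]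
  ring

lemma det4_swap12 (u v w x : Fin 4 → ℝ) : det4 u v w x = - det4 v u w x := by
  simp only [det4_eq]; ring

lemma det4_swap23 (u v w x : Fin 4 → ℝ) : det4 u v w x = - det4 u w v x := by
  simp only [det4_eq]; ring

lemma det4_swap34 (u v w x : Fin 4 → ℝ) : det4 u v w x = - det4 u v x w := by
  simp only [det4_eq]; ring

lemma det4_smul_left (c : ℝ) (u v w x : Fin 4 → ℝ) :
    det4 (c • u) v w x = c * det4 u v w x := by
  simp only [det4_eq, Pi.smul_apply, smul_eq_mul]; ring

lemma det4_add_left (u u' v w x : Fin 4 → ℝ) :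
    det4 (u + u') v w x = det4 u v w x + det4 u' v w x := by
  simp only [det4_eq, Pi.add_apply]; ring

lemma sum_smul_basisVec (u : Fin 4 → ℝ) : ∑ a, u a • basisVec a = u := by
  ext i; fin_cases i <;> simp [Fin.sum_univ_four]

lemma det4_sum_left (u v w x : Fin 4 → ℝ) :
    det4 u v w x = ∑ a, u a * det4 (basisVec a) v w x := by
  conv_lhs => rw [← sum_smul_basisVec u]
  simp only [Fin.sum_univ_four, det4_add_left, det4_smul_left]

/-- Cramer's rule in `ℝ⁴`: antisymmetrizing a linear form over five vectors gives zero. -/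
lemma det4_cramer {F : Type*} [FunLike F (Fin 4 → ℝ) ℝ] [LinearMapClass F ℝ (Fin 4 → ℝ) ℝ]
    (l : F) (u₀ u₁ u₂ u₃ u₄ : Fin 4 → ℝ) :
    l u₀ * det4 u₁ u₂ u₃ u₄ - l u₁ * det4 u₀ u₂ u₃ u₄ + l u₂ * det4 u₀ u₁ u₃ u₄
      - l u₃ * det4 u₀ u₁ u₂ u₄ + l u₄ * det4 u₀ u₁ u₂ u₃ = 0 := by
  have h : det4 u₁ u₂ u₃ u₄ • u₀ - det4 u₀ u₂ u₃ u₄ • u₁ + det4 u₀ u₁ u₃ u₄ • u₂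
      - det4 u₀ u₁ u₂ u₄ • u₃ + det4 u₀ u₁ u₂ u₃ • u₄ = 0 := by
    ext i
    simp only [det4_eq, Pi.add_apply, Pi.sub_apply, Pi.smul_apply, smul_eq_mul, Pi.zero_apply]
    fin_cases i <;> simp only [Fin.zero_eta, Fin.mk_one, Fin.reduceFinMk] <;> ring
  have h' := congrArg l h
  simp only [map_add, map_sub, map_smul, smul_eq_mul, map_zero] at h'
  linarith

/-- The trace of an endomorphism as an infinitesimal change of volume. -/
lemma det4_trace (L : (Fin 4 → ℝ) →L[ℝ] (Fin 4 → ℝ)) (a b c d : Fin 4 → ℝ) :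
    det4 (L a) b c d + det4 a (L b) c d + det4 a b (L c) d + det4 a b c (L d)
      = (∑ i, L (basisVec i) i) * det4 a b c d := by
  have key : ∀ i, L (basisVec i) i * det4 a b c d - L a i * det4 (basisVec i) b c d
      + L b i * det4 (basisVec i) a c d - L c i * det4 (basisVec i) a b d
      + L d i * det4 (basisVec i) a b c = 0 := fun i =>
    det4_cramer ((ContinuousLinearMap.proj (R := ℝ) (φ := fun _ : Fin 4 => ℝ) i).comp L)
      (basisVec i) a b c d
  rw [det4_swap12 a (L b), det4_swap23 a b, det4_swap12 a (L c), det4_swap34 a b,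
    det4_swap23 a b, det4_swap12 a (L d), det4_sum_left (L a), det4_sum_left (L b),
    det4_sum_left (L c), det4_sum_left (L d)]
  simp only [Fin.sum_univ_four]
  linarith [key 0, key 1, key 2, key 3]

lemma mink_eq (x y : Fin 4 → ℝ) :
    mink x y = - (x 0 * y 0) + x 1 * y 1 + x 2 * y 2 + x 3 * y 3 := by
  simp [mink, sgn, Fin.sum_univ_four]

lemma sgn_mul_sgn (a : Fin 4) : sgn a * sgn a = 1 := by
  fin_cases a <;> simp [sgn]

/-- The Minkowski product as a linear form. -/
def minkL (x : Fin 4 → ℝ) : (Fin 4 → ℝ) →ₗ[ℝ] ℝ where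
  toFun := mink x
  map_add' u v := by simp only [mink_eq, Pi.add_apply]; ring
  map_smul' c v := by
    simp only [mink_eq, Pi.smul_apply, smul_eq_mul, RingHom.id_apply]; ring

@[simp] lemma minkL_apply (x y : Fin 4 → ℝ) : minkL x y = mink x y := rfl

lemma mink_basisVec (x : Fin 4 → ℝ) (a : Fin 4) : mink x (basisVec a) = sgn a * x a := by
  fin_cases a <;> simp [mink_eq, sgn]

/-- Four vectors orthogonal to a common unit vector are linearly dependent. -/
lemma det4_eq_zero_of_orthogonal {X a b c d : Fin 4 → ℝ} (hX : mink X X = 1)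
    (ha : mink X a = 0) (hb : mink X b = 0) (hc : mink X c = 0) (hd : mink X d = 0) :
    det4 a b c d = 0 := by
  have := det4_cramer (minkL X) X a b c d
  simpa [hX, ha, hb, hc, hd] using this

/-- The Minkowski square of the vector product of three vectors is minus their Gram determinant. -/
lemma sum_sgn_det4_sq {X u v : Fin 4 → ℝ} (hX : mink X X = 1) (hu : mink X u = 0)
    (hv : mink X v = 0) :
    ∑ a, sgn a * det4 (basisVec a) X u v ^ 2 = -(mink u u * mink v v - mink u v ^ 2) := by
  have h : ∑ a, sgn a * det4 (basisVec a) X u v ^ 2 =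
      -(mink X X * (mink u u * mink v v - mink u v ^ 2)
        - mink X u * (mink X u * mink v v - mink u v * mink X v)
        + mink X v * (mink X u * mink u v - mink u u * mink X v)) := by
    simp only [Fin.sum_univ_four, det4_eq, mink_eq, sgn, basisVec]
    simp
    ring
  rw [h, hX, hu, hv]; ring

/-! ### Radial extension of functions on the hyperboloid -/

/-- The open cone of spacelike vectors, on which the radial extensions live. -/
def cone : Set (Fin 4 → ℝ) := {Y | 0 < mink Y Y}

/-- The Minkowski length `√⟨Y,Y⟩`. -/
def nrm (Y : Fin 4 → ℝ) : ℝ := √(mink Y Y)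

/-- The extension of a function on the hyperboloid that is constant along rays. -/
def ext (F : dS3 → ℝ) (Y : Fin 4 → ℝ) : ℝ := F (radialProj Y)

/-- The partial derivative `∂_a` on `ℝ⁴`. -/
def pd (a : Fin 4) (f : (Fin 4 → ℝ) → ℝ) (Y : Fin 4 → ℝ) : ℝ := fderiv ℝ f Y (basisVec a)

lemma dif_eq_pd (F : dS3 → ℝ) (X : dS3) (a : Fin 4) : dif F X a = pd a (ext F) X := rfl

lemma contDiff_mink : ContDiff ℝ ∞ (fun Y : Fin 4 → ℝ => mink Y Y) := by
  simp only [mink_eq]; fun_prop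

lemma isOpen_cone : IsOpen cone :=
  isOpen_lt continuous_const contDiff_mink.continuous

lemma cone_mem_nhds {Y : Fin 4 → ℝ} (hY : Y ∈ cone) : cone ∈ nhds Y := isOpen_cone.mem_nhds hY

lemma mink_self (X : dS3) : mink X.1 X.1 = 1 := X.2

lemma mem_cone (X : dS3) : X.1 ∈ cone := by
  change 0 < mink X.1 X.1
  rw [mink_self]; exact one_pos

lemma nrm_pos {Y : Fin 4 → ℝ} (hY : Y ∈ cone) : 0 < nrm Y := Real.sqrt_pos.2 hY

@[simp] lemma nrm_coe (X : dS3) : nrm X.1 = 1 := by rw [nrm, mink_self, Real.sqrt_one]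

lemma nrm_sq {Y : Fin 4 → ℝ} (hY : Y ∈ cone) : nrm Y ^ 2 = mink Y Y := Real.sq_sqrt (le_of_lt hY)

lemma mink_smul_smul (c : ℝ) (Y : Fin 4 → ℝ) : mink (c • Y) (c • Y) = c ^ 2 * mink Y Y := by
  simp only [mink_eq, Pi.smul_apply, smul_eq_mul]; ring

lemma smul_mem_cone {c : ℝ} (hc : 0 < c) {Y : Fin 4 → ℝ} (hY : Y ∈ cone) : c • Y ∈ cone := by
  change 0 < mink (c • Y) (c • Y)
  rw [mink_smul_smul]
  exact mul_pos (pow_pos hc 2) hY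

lemma nrm_smul {c : ℝ} (hc : 0 < c) (Y : Fin 4 → ℝ) : nrm (c • Y) = c * nrm Y := by
  rw [nrm, mink_smul_smul, Real.sqrt_mul (sq_nonneg c), Real.sqrt_sq hc.le, nrm]

lemma radialProj_val {Y : Fin 4 → ℝ} (hY : Y ∈ cone) : (radialProj Y).1 = (nrm Y)⁻¹ • Y := by
  have h : 0 < mink Y Y := hY
  simp only [radialProj, dif_pos h, nrm]

lemma radialProj_apply {Y : Fin 4 → ℝ} (hY : Y ∈ cone) (a : Fin 4) :
    (radialProj Y).1 a = (nrm Y)⁻¹ * Y a := by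
  rw [radialProj_val hY]; rfl

@[simp] lemma radialProj_coe (X : dS3) : radialProj X.1 = X := by
  apply Subtype.ext
  rw [radialProj_val (mem_cone X), nrm_coe, inv_one, one_smul]

lemma radialProj_smul {c : ℝ} (hc : 0 < c) {Y : Fin 4 → ℝ} (hY : Y ∈ cone) :
    radialProj (c • Y) = radialProj Y := by
  apply Subtype.ext
  rw [radialProj_val hY, radialProj_val (smul_mem_cone hc hY), nrm_smul hc, smul_smul]
  congr 1
  have := nrm_pos hY
  field_simp

@[simp] lemma ext_coe (F : dS3 → ℝ) (X : dS3) : ext F X.1 = F X := by rw [ext, radialProj_coe]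

lemma ext_smul (F : dS3 → ℝ) {c : ℝ} (hc : 0 < c) {Y : Fin 4 → ℝ} (hY : Y ∈ cone) :
    ext F (c • Y) = ext F Y := by
  rw [ext, radialProj_smul hc hY, ext]

lemma Smooth.contDiffAt {F : dS3 → ℝ} (hF : Smooth F) {Y : Fin 4 → ℝ} (hY : Y ∈ cone) :
    ContDiffAt ℝ ∞ (ext F) Y :=
  ContDiffOn.contDiffAt hF (cone_mem_nhds hY)

lemma smooth_iff {F : dS3 → ℝ} : Smooth F ↔ ∀ Y ∈ cone, ContDiffAt ℝ ∞ (ext F) Y :=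
  ⟨fun h _ hY => h.contDiffAt hY, fun h Y hY => (h Y hY).contDiffWithinAt⟩

lemma Smooth.differentiableAt {F : dS3 → ℝ} (hF : Smooth F) {Y : Fin 4 → ℝ} (hY : Y ∈ cone) :
    DifferentiableAt ℝ (ext F) Y :=
  (hF.contDiffAt hY).differentiableAt (by simp)

lemma contDiffAt_pd {f : (Fin 4 → ℝ) → ℝ} {Y : Fin 4 → ℝ} (hf : ContDiffAt ℝ ∞ f Y) (a : Fin 4) :
    ContDiffAt ℝ ∞ (pd a f) Y :=
  (hf.fderiv_right (m := ∞) (by simp)).clm_apply contDiffAt_const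

lemma Smooth.differentiableAt_pd {F : dS3 → ℝ} (hF : Smooth F) {Y : Fin 4 → ℝ} (hY : Y ∈ cone)
    (a : Fin 4) : DifferentiableAt ℝ (pd a (ext F)) Y :=
  (contDiffAt_pd (hF.contDiffAt hY) a).differentiableAt (by simp)

lemma pd_congr {f g : (Fin 4 → ℝ) → ℝ} {Y : Fin 4 → ℝ} (hY : Y ∈ cone)
    (h : ∀ Z ∈ cone, f Z = g Z) (a : Fin 4) : pd a f Y = pd a g Y := by
  have : f =ᶠ[nhds Y] g := Filter.eventually_of_mem (cone_mem_nhds hY) h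
  rw [pd, pd, this.fderiv_eq]

lemma contDiffAt_congr {f g : (Fin 4 → ℝ) → ℝ} {Y : Fin 4 → ℝ} (hY : Y ∈ cone)
    (h : ∀ Z ∈ cone, f Z = g Z) (hg : ContDiffAt ℝ ∞ g Y) : ContDiffAt ℝ ∞ f Y :=
  hg.congr_of_eventuallyEq (Filter.eventually_of_mem (cone_mem_nhds hY) h)

lemma pd_add {f g : (Fin 4 → ℝ) → ℝ} {Y : Fin 4 → ℝ} (hf : DifferentiableAt ℝ f Y)
    (hg : DifferentiableAt ℝ g Y) (a : Fin 4) :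
    pd a (fun Z => f Z + g Z) Y = pd a f Y + pd a g Y := by
  simp [pd, fderiv_fun_add hf hg]

lemma pd_mul {f g : (Fin 4 → ℝ) → ℝ} {Y : Fin 4 → ℝ} (hf : DifferentiableAt ℝ f Y)
    (hg : DifferentiableAt ℝ g Y) (a : Fin 4) :
    pd a (fun Z => f Z * g Z) Y = pd a f Y * g Y + f Y * pd a g Y := by
  simp [pd, fderiv_fun_mul hf hg]; ring

lemma pd_const_mul {g : (Fin 4 → ℝ) → ℝ} {Y : Fin 4 → ℝ} (c : ℝ)
    (hg : DifferentiableAt ℝ g Y) (a : Fin 4) :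
    pd a (fun Z => c * g Z) Y = c * pd a g Y := by
  simp [pd, fderiv_const_mul hg]

lemma pd_sum {ι : Type*} (s : Finset ι) {f : ι → (Fin 4 → ℝ) → ℝ} {Y : Fin 4 → ℝ}
    (hf : ∀ i ∈ s, DifferentiableAt ℝ (f i) Y) (a : Fin 4) :
    pd a (fun Z => ∑ i ∈ s, f i Z) Y = ∑ i ∈ s, pd a (f i) Y := by
  simp [pd, fderiv_fun_sum hf]

lemma pd_coord (a b : Fin 4) (Y : Fin 4 → ℝ) :
    pd a (fun Z => Z b) Y = if a = b then 1 else 0 := by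
  rw [pd, (hasFDerivAt_apply b Y).fderiv]
  simp [Pi.single_apply, eq_comm]

lemma pd_const (a : Fin 4) (c : ℝ) (Y : Fin 4 → ℝ) : pd a (fun _ => c) Y = 0 := by
  simp [pd]

lemma fderiv_eq_sum_pd (f : (Fin 4 → ℝ) → ℝ) (Y v : Fin 4 → ℝ) :
    fderiv ℝ f Y v = ∑ a, v a * pd a f Y := by
  conv_lhs => rw [← sum_smul_basisVec v]
  simp [pd]

lemma pd_comm {f : (Fin 4 → ℝ) → ℝ} {Y : Fin 4 → ℝ} (hf : ContDiffAt ℝ ∞ f Y) (a b : Fin 4) :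
    pd a (pd b f) Y = pd b (pd a f) Y := by
  have hs := hf.isSymmSndFDerivAt (by simpa using WithTop.coe_le_coe.2 (le_top : (2 : ℕ∞) ≤ ⊤))
  have hd : DifferentiableAt ℝ (fderiv ℝ f) Y :=
    (hf.fderiv_right (m := 1) (by norm_cast)).differentiableAt (by simp)
  have key : ∀ u v : Fin 4 → ℝ,
      fderiv ℝ (fun Z => fderiv ℝ f Z u) Y v = fderiv ℝ (fderiv ℝ f) Y v u := by
    intro u v
    rw [fderiv_clm_apply hd (differentiableAt_const u)]
    simp
  change fderiv ℝ (fun Z => fderiv ℝ f Z (basisVec b)) Y (basisVec a)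
    = fderiv ℝ (fun Z => fderiv ℝ f Z (basisVec a)) Y (basisVec b)
  rw [key, key]
  exact hs _ _

/-- Euler's relation: the radial extension is constant along rays. -/
lemma fderiv_ext_self {F : dS3 → ℝ} (hF : Smooth F) {Y : Fin 4 → ℝ} (hY : Y ∈ cone) :
    fderiv ℝ (ext F) Y Y = 0 := by
  have h1 : HasDerivAt (fun c : ℝ => c • Y) Y 1 := by
    simpa using (hasDerivAt_id (1 : ℝ)).smul_const Y
  have h2 : HasFDerivAt (ext F) (fderiv ℝ (ext F) Y) ((1 : ℝ) • Y) := by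
    simpa using (hF.differentiableAt hY).hasFDerivAt
  have h3 := h2.comp_hasDerivAt (1 : ℝ) h1
  have h4 : (ext F ∘ fun c : ℝ => c • Y) =ᶠ[nhds 1] fun _ => ext F Y := by
    filter_upwards [Ioi_mem_nhds (zero_lt_one' ℝ)] with c hc
    exact ext_smul F hc hY
  exact h3.unique ((hasDerivAt_const (1 : ℝ) (ext F Y)).congr_of_eventuallyEq h4)

lemma euler_ext {F : dS3 → ℝ} (hF : Smooth F) {Y : Fin 4 → ℝ} (hY : Y ∈ cone) :
    ∑ a, Y a * pd a (ext F) Y = 0 := by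
  rw [← fderiv_eq_sum_pd, fderiv_ext_self hF hY]

/-- First derivatives of a radial extension are homogeneous of degree `-1`. -/
lemma pd_ext_smul {F : dS3 → ℝ} (hF : Smooth F) {c : ℝ} (hc : 0 < c) {Y : Fin 4 → ℝ}
    (hY : Y ∈ cone) (a : Fin 4) : pd a (ext F) (c • Y) = c⁻¹ * pd a (ext F) Y := by
  have h1 : HasFDerivAt (fun Z : Fin 4 → ℝ => c • Z)
      (c • ContinuousLinearMap.id ℝ (Fin 4 → ℝ)) Y := (hasFDerivAt_id Y).const_smul c
  have h2 := ((hF.differentiableAt (smul_mem_cone hc hY)).hasFDerivAt).comp Y h1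
  have h3 : (ext F ∘ fun Z => c • Z) =ᶠ[nhds Y] ext F :=
    Filter.eventually_of_mem (cone_mem_nhds hY) fun Z hZ => ext_smul F hc hZ
  have h4 := (h2.congr_of_eventuallyEq h3.symm).fderiv
  rw [pd, pd, h4]
  simp [hc.ne']

/-- The radial extension of `dif F`: since the derivative of a radial extension is homogeneous of
degree `-1`, the norm appears as a compensating factor. -/
lemma dif_radialProj {F : dS3 → ℝ} (hF : Smooth F) {Y : Fin 4 → ℝ} (hY : Y ∈ cone)
    (a : Fin 4) : dif F (radialProj Y) a = nrm Y * pd a (ext F) Y := by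
  rw [dif_eq_pd, radialProj_val hY, pd_ext_smul hF (inv_pos.2 (nrm_pos hY)) hY, inv_inv]

lemma contDiffAt_nrm {Y : Fin 4 → ℝ} (hY : Y ∈ cone) : ContDiffAt ℝ ∞ nrm Y :=
  contDiff_mink.contDiffAt.sqrt (ne_of_gt hY)

lemma contDiffAt_nrm_inv {Y : Fin 4 → ℝ} (hY : Y ∈ cone) :
    ContDiffAt ℝ ∞ (fun Z => (nrm Z)⁻¹) Y :=
  (contDiffAt_nrm hY).inv (nrm_pos hY).ne'

lemma pd_mink_self (a : Fin 4) (Y : Fin 4 → ℝ) :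
    pd a (fun Z => mink Z Z) Y = 2 * (sgn a * Y a) := by
  have h : ∀ b : Fin 4, DifferentiableAt ℝ (fun Z : Fin 4 → ℝ => Z b) Y := fun b => by fun_prop
  have h2 : (fun Z : Fin 4 → ℝ => mink Z Z) = fun Z => ∑ b, sgn b * (Z b * Z b) := by
    funext Z; simp [mink, mul_assoc]
  rw [h2, pd_sum _ (fun b _ => by fun_prop)]
  simp only [pd_const_mul _ ((h _).fun_mul (h _)), pd_mul (h _) (h _), pd_coord]
  fin_cases a <;> simp [Fin.sum_univ_four] <;> ring

lemma pd_nrm {Y : Fin 4 → ℝ} (hY : Y ∈ cone) (a : Fin 4) :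
    pd a nrm Y = sgn a * Y a * (nrm Y)⁻¹ := by
  have hd : DifferentiableAt ℝ nrm Y := (contDiffAt_nrm hY).differentiableAt (by simp)
  have h1 := pd_mul hd hd a
  have h2 : pd a (fun Z => nrm Z * nrm Z) Y = pd a (fun Z => mink Z Z) Y :=
    pd_congr hY (fun Z hZ => by rw [← nrm_sq hZ, pow_two]) a
  rw [h2, pd_mink_self] at h1
  have := nrm_pos hY
  field_simp
  linarith

lemma pd_nrm_inv {Y : Fin 4 → ℝ} (hY : Y ∈ cone) (a : Fin 4) :
    pd a (fun Z => (nrm Z)⁻¹) Y = - (sgn a * Y a * (nrm Y)⁻¹ ^ 3) := by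
  have hd : DifferentiableAt ℝ nrm Y := (contDiffAt_nrm hY).differentiableAt (by simp)
  have hd' : DifferentiableAt ℝ (fun Z => (nrm Z)⁻¹) Y :=
    (contDiffAt_nrm_inv hY).differentiableAt (by simp)
  have h1 := pd_mul hd hd' a
  have h2 : pd a (fun Z => nrm Z * (nrm Z)⁻¹) Y = pd a (fun _ => 1) Y :=
    pd_congr hY (fun Z hZ => mul_inv_cancel₀ (nrm_pos hZ).ne') a
  rw [h2, pd_const, pd_nrm hY] at h1
  have := nrm_pos hY
  field_simp at h1 ⊢
  linarith

lemma ext_coord {Y : Fin 4 → ℝ} (hY : Y ∈ cone) (a : Fin 4) :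
    ext (fun X => X.1 a) Y = (nrm Y)⁻¹ * Y a := radialProj_apply hY a

lemma smooth_coord (a : Fin 4) : Smooth (fun X => X.1 a) :=
  smooth_iff.2 fun _ hY => contDiffAt_congr hY (fun _ hZ => ext_coord hZ a)
    ((contDiffAt_nrm_inv hY).mul (contDiff_apply ℝ ℝ a).contDiffAt)

lemma Smooth.add {F G : dS3 → ℝ} (hF : Smooth F) (hG : Smooth G) : Smooth fun X => F X + G X :=
  ContDiffOn.add hF hG

lemma Smooth.mul {F G : dS3 → ℝ} (hF : Smooth F) (hG : Smooth G) : Smooth fun X => F X * G X :=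
  ContDiffOn.mul hF hG

lemma smooth_const (c : ℝ) : Smooth fun _ => c := contDiffOn_const

lemma Smooth.sum {ι : Type*} {s : Finset ι} {F : ι → dS3 → ℝ} (h : ∀ i ∈ s, Smooth (F i)) :
    Smooth fun X => ∑ i ∈ s, F i X :=
  ContDiffOn.sum h

lemma smooth_dif {F : dS3 → ℝ} (hF : Smooth F) (a : Fin 4) : Smooth fun X => dif F X a :=
  smooth_iff.2 fun _ hY => contDiffAt_congr hY (fun _ hZ => dif_radialProj hF hZ a)
    ((contDiffAt_nrm hY).mul (contDiffAt_pd (hF.contDiffAt hY) a))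

lemma dif_add {F G : dS3 → ℝ} (hF : Smooth F) (hG : Smooth G) (X : dS3) (a : Fin 4) :
    dif (fun Y => F Y + G Y) X a = dif F X a + dif G X a :=
  pd_add (hF.differentiableAt (mem_cone X)) (hG.differentiableAt (mem_cone X)) a

lemma dif_mul {F G : dS3 → ℝ} (hF : Smooth F) (hG : Smooth G) (X : dS3) (a : Fin 4) :
    dif (fun Y => F Y * G Y) X a = dif F X a * G X + F X * dif G X a := by
  have := pd_mul (hF.differentiableAt (mem_cone X)) (hG.differentiableAt (mem_cone X)) a
  rw [ext_coe, ext_coe] at this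
  exact this

lemma dif_const (c : ℝ) (X : dS3) (a : Fin 4) : dif (fun _ => c) X a = 0 := pd_const a c X

lemma dif_sum {ι : Type*} (s : Finset ι) {F : ι → dS3 → ℝ} (h : ∀ i ∈ s, Smooth (F i)) (X : dS3)
    (a : Fin 4) : dif (fun Y => ∑ i ∈ s, F i Y) X a = ∑ i ∈ s, dif (F i) X a :=
  pd_sum s (fun i hi => (h i hi).differentiableAt (mem_cone X)) a

lemma dif_coord (X : dS3) (a b : Fin 4) :
    dif (fun Y => Y.1 b) X a = (if a = b then 1 else 0) - sgn a * X.1 a * X.1 b := by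
  have hX := mem_cone X
  have h : DifferentiableAt ℝ (fun Z : Fin 4 → ℝ => Z b) X.1 := by fun_prop
  rw [dif_eq_pd, pd_congr hX (fun Z hZ => ext_coord hZ b),
    pd_mul ((contDiffAt_nrm_inv hX).differentiableAt (by simp)) h, pd_nrm_inv hX, pd_coord]
  simp
  ring

/-- The differential has no normal component. -/
lemma euler_dif {F : dS3 → ℝ} (hF : Smooth F) (X : dS3) : ∑ a, X.1 a * dif F X a = 0 :=
  euler_ext hF (mem_cone X)

/-! ### Covariant derivatives in terms of radial extensions -/

lemma proj_sum (X : dS3) (m : Fin 4 → ℝ) (a : Fin 4) :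
    ∑ a', proj X a' a * m a' = m a - sgn a * X.1 a * ∑ a', X.1 a' * m a' := by
  simp only [proj, sub_mul, Finset.sum_sub_distrib, ite_mul, one_mul, zero_mul,
    Finset.sum_ite_eq', Finset.mem_univ, if_true, Finset.mul_sum]
  congr 1
  exact Finset.sum_congr rfl fun i _ => by ring

lemma sum_sgn_sq (X : dS3) : ∑ a, X.1 a * (sgn a * X.1 a) = 1 := by
  rw [← mink_self X, mink]
  exact Finset.sum_congr rfl fun i _ => by ring

lemma sum_coord_mul_proj (X : dS3) (c : Fin 4) : ∑ a, X.1 a * proj X c a = 0 := by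
  have h : ∀ a, X.1 a * proj X c a
      = (if c = a then X.1 a else 0) - X.1 c * (X.1 a * (sgn a * X.1 a)) := fun a => by
    simp only [proj, mul_sub, mul_ite, mul_one, mul_zero]; ring
  simp only [h, Finset.sum_sub_distrib, ← Finset.mul_sum, sum_sgn_sq]
  simp

/-- Differentiating a tangency condition `X^a G_a = 0`. -/
lemma sum_coord_mul_dif {G : Fin 4 → dS3 → ℝ} (hG : ∀ a, Smooth (G a))
    (h0 : ∀ X, ∑ a, X.1 a * G a X = 0) (X : dS3) (c : Fin 4) :
    ∑ a, X.1 a * dif (G a) X c = - G c X := by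
  have h1 : dif (fun Y => ∑ a, Y.1 a * G a Y) X c = 0 := by
    rw [show (fun Y => ∑ a, Y.1 a * G a Y) = fun _ : dS3 => (0 : ℝ) from funext h0, dif_const]
  rw [dif_sum _ fun a _ => (smooth_coord a).mul (hG a)] at h1
  simp only [dif_mul (smooth_coord _) (hG _), dif_coord, Finset.sum_add_distrib] at h1
  have h2 : ∑ a, ((if c = a then 1 else 0) - sgn c * X.1 c * X.1 a) * G a X = G c X := by
    have : ∀ a, ((if c = a then 1 else 0) - sgn c * X.1 c * X.1 a) * G a X
      = (if c = a then G a X else 0) - sgn c * X.1 c * (X.1 a * G a X) := fun a => by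
      split_ifs <;> ring
    simp only [this, Finset.sum_sub_distrib, ← Finset.mul_sum, h0]
    simp
  linarith

lemma IsTensor.sum_left {T : Field2} (hT : IsTensor T) (X : dS3) (c b : Fin 4) :
    ∑ a, X.1 a * dif (fun Y => T Y a b) X c = - T X c b :=
  sum_coord_mul_dif (G := fun a Y => T Y a b) (fun a => hT.smooth a b)
    (fun X => hT.tangent_left X b) X c

lemma IsTensor.sum_right {T : Field2} (hT : IsTensor T) (X : dS3) (c a : Fin 4) :
    ∑ b, X.1 b * dif (fun Y => T Y a b) X c = - T X a c :=
  sum_coord_mul_dif (G := fun b Y => T Y a b) (fun b => hT.smooth a b)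
    (fun X => hT.tangent_right X a) X c

/-- The covariant derivative is the flat derivative plus the terms which make it tangential. -/
lemma IsTensor.cov2_eq {T : Field2} (hT : IsTensor T) (X : dS3) (c a b : Fin 4) :
    cov2 T X c a b = dif (fun Y => T Y a b) X c + sgn a * X.1 a * T X c b
      + sgn b * X.1 b * T X a c := by
  have h1 : ∀ a', ∑ b', proj X a' a * proj X b' b * dif (fun Y => T Y a' b') X c
      = proj X a' a * (dif (fun Y => T Y a' b) X c + sgn b * X.1 b * T X a' c) := fun a' => by
    simp only [mul_assoc, ← Finset.mul_sum]
    rw [proj_sum, hT.sum_right]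
    ring
  rw [cov2, Finset.sum_congr rfl fun a' _ => h1 a', proj_sum]
  simp only [mul_add, Finset.sum_add_distrib, hT.sum_left]
  have h2 : ∑ a', X.1 a' * (sgn b * X.1 b * T X a' c) = 0 := by
    rw [Finset.sum_congr rfl fun a' _ => show X.1 a' * (sgn b * X.1 b * T X a' c)
      = sgn b * X.1 b * (X.1 a' * T X a' c) by ring, ← Finset.mul_sum, hT.tangent_left, mul_zero]
  rw [h2]
  ring

lemma IsTensor.smooth_cov2 {T : Field2} (hT : IsTensor T) (c a b : Fin 4) :
    Smooth fun X => cov2 T X c a b := by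
  simp only [hT.cov2_eq]
  have hs := fun a : Fin 4 => (smooth_const (sgn a)).mul (smooth_coord a)
  exact ((smooth_dif (hT.smooth a b) c).add ((hs a).mul (hT.smooth c b))).add
    ((hs b).mul (hT.smooth a c))

lemma cov2_tangent_mid {T : Field2} (X : dS3) (c b : Fin 4) :
    ∑ a, X.1 a * cov2 T X c a b = 0 := by
  simp only [cov2, Finset.mul_sum]
  rw [Finset.sum_comm]
  refine Finset.sum_eq_zero fun a' _ => ?_
  rw [Finset.sum_comm]
  refine Finset.sum_eq_zero fun b' _ => ?_
  rw [← zero_mul (proj X b' b * dif (fun Y => T Y a' b') X c), ← sum_coord_mul_proj X a',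
    Finset.sum_mul]
  exact Finset.sum_congr rfl fun i _ => by ring

lemma cov2_tangent_right {T : Field2} (X : dS3) (c a : Fin 4) :
    ∑ b, X.1 b * cov2 T X c a b = 0 := by
  simp only [cov2, Finset.mul_sum]
  rw [Finset.sum_comm]
  refine Finset.sum_eq_zero fun a' _ => ?_
  rw [Finset.sum_comm]
  refine Finset.sum_eq_zero fun b' _ => ?_
  rw [← zero_mul (proj X a' a * dif (fun Y => T Y a' b') X c), ← sum_coord_mul_proj X b',
    Finset.sum_mul]
  exact Finset.sum_congr rfl fun i _ => by ring

lemma IsTensor.cov2_tangent_left {T : Field2} (hT : IsTensor T) (X : dS3) (a b : Fin 4) :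
    ∑ c, X.1 c * cov2 T X c a b = 0 := by
  simp only [cov2, Finset.mul_sum]
  rw [Finset.sum_comm]
  refine Finset.sum_eq_zero fun a' _ => ?_
  rw [Finset.sum_comm]
  refine Finset.sum_eq_zero fun b' _ => ?_
  rw [← mul_zero (proj X a' a * proj X b' b), ← euler_dif (hT.smooth a' b') X, Finset.mul_sum]
  exact Finset.sum_congr rfl fun i _ => by ring

/-- The covariant derivative of a tensor of rank three, as in `IsTensor.cov2_eq`. -/
lemma cov3_eq {U : dS3 → Fin 4 → Fin 4 → Fin 4 → ℝ} (hs : ∀ c a b, Smooth fun X => U X c a b)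
    (h₁ : ∀ X a b, ∑ c, X.1 c * U X c a b = 0) (h₂ : ∀ X c b, ∑ a, X.1 a * U X c a b = 0)
    (h₃ : ∀ X c a, ∑ b, X.1 b * U X c a b = 0) (X : dS3) (d c a b : Fin 4) :
    cov3 U X d c a b = dif (fun Y => U Y c a b) X d + sgn c * X.1 c * U X d a b
      + sgn a * X.1 a * U X c d b + sgn b * X.1 b * U X c a d := by
  have e₁ : ∀ a b, ∑ c, X.1 c * dif (fun Y => U Y c a b) X d = - U X d a b := fun a b =>
    sum_coord_mul_dif (G := fun c Y => U Y c a b) (fun c => hs c a b) (fun X => h₁ X a b) X d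
  have e₂ : ∀ c b, ∑ a, X.1 a * dif (fun Y => U Y c a b) X d = - U X c d b := fun c b =>
    sum_coord_mul_dif (G := fun a Y => U Y c a b) (fun a => hs c a b) (fun X => h₂ X c b) X d
  have e₃ : ∀ c a, ∑ b, X.1 b * dif (fun Y => U Y c a b) X d = - U X c a d := fun c a =>
    sum_coord_mul_dif (G := fun b Y => U Y c a b) (fun b => hs c a b) (fun X => h₃ X c a) X d
  have pull : ∀ (k : ℝ) (m : Fin 4 → ℝ), (∑ i, X.1 i * m i = 0) →
      ∑ i, X.1 i * (k * m i) = 0 := fun k m hm => by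
    rw [← mul_zero k, ← hm, Finset.mul_sum]
    exact Finset.sum_congr rfl fun i _ => by ring
  have s₁ : ∀ c' a', ∑ b', proj X c' c * proj X a' a * proj X b' b
        * dif (fun Y => U Y c' a' b') X d
      = proj X c' c * (proj X a' a * (dif (fun Y => U Y c' a' b) X d
          + sgn b * X.1 b * U X c' a' d)) := fun c' a' => by
    simp only [mul_assoc, ← Finset.mul_sum]
    rw [proj_sum, e₃]
    ring
  have s₂ : ∀ c', ∑ a', proj X c' c * (proj X a' a * (dif (fun Y => U Y c' a' b) X d
          + sgn b * X.1 b * U X c' a' d))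
      = proj X c' c * (dif (fun Y => U Y c' a b) X d + sgn b * X.1 b * U X c' a d
          + sgn a * X.1 a * U X c' d b) := fun c' => by
    rw [← Finset.mul_sum, proj_sum]
    simp only [mul_add, Finset.sum_add_distrib]
    rw [e₂, pull _ _ (h₂ X c' d)]
    ring
  simp only [cov3, s₁, s₂]
  rw [proj_sum]
  simp only [mul_add, Finset.sum_add_distrib]
  rw [e₁, pull _ _ (h₁ X a d), pull _ _ (h₁ X d b)]
  ring

/-- On traceless tensors the divergence on the hyperboloid is that of the radial extension. -/
lemma IsTensor.div_eq {T : Field2} (hT : IsTensor T) (htr : ∀ X, ∑ a, sgn a * T X a a = 0)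
    (X : dS3) (a : Fin 4) :
    ∑ b, sgn b * cov2 T X b a b = ∑ b, sgn b * dif (fun Y => T Y a b) X b := by
  have h : ∀ b, sgn b * cov2 T X b a b = sgn b * dif (fun Y => T Y a b) X b
      + sgn a * X.1 a * (sgn b * T X b b) + X.1 b * T X a b := fun b => by
    rw [hT.cov2_eq]
    linear_combination X.1 b * T X a b * sgn_mul_sgn b
  simp only [h, Finset.sum_add_distrib, ← Finset.mul_sum, htr, hT.tangent_right]
  ring

/-- On symmetric tensors the terms by which the covariant and the flat derivative differ drop out of
the curl: one is contracted with `ε_a^{cd} X_d = 0`, the other with a symmetric tensor. -/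
lemma IsTensor.curl_eq {T : Field2} (hT : IsTensor T) (hsymm : ∀ X a b, T X a b = T X b a)
    (X : dS3) (a b : Fin 4) :
    curl T X a b
      = ∑ c, ∑ d, vol X a c d * sgn c * sgn d * dif (fun Y => T Y d b) X c := by
  have h : ∀ c d, vol X a c d * sgn c * sgn d * cov2 T X c d b
      = vol X a c d * sgn c * sgn d * dif (fun Y => T Y d b) X c
        + vol X a c d * X.1 d * (sgn c * T X c b)
        + vol X a c d * (sgn c * sgn d * (sgn b * X.1 b) * T X d c) := fun c d => by
    rw [hT.cov2_eq]
    linear_combination vol X a c d * sgn c * X.1 d * T X c b * sgn_mul_sgn d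
  have z₁ : ∀ c, ∑ d, vol X a c d * X.1 d * (sgn c * T X c b) = 0 := fun c => by
    rw [← Finset.sum_mul]
    have : ∑ d, vol X a c d * X.1 d = - det4 X.1 (basisVec a) X.1 (basisVec c) := by
      rw [det4_sum_left X.1, ← Finset.sum_neg_distrib]
      refine Finset.sum_congr rfl fun d _ => ?_
      change det4 (basisVec a) X.1 (basisVec c) (basisVec d) * _ = _
      simp only [det4_eq]; ring
    rw [this, det4_eq]; ring
  have z₂ : ∑ c, ∑ d, vol X a c d * (sgn c * sgn d * (sgn b * X.1 b) * T X d c) = 0 := by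
    have anti : ∀ c d, vol X a c d = - vol X a d c := fun c d => det4_swap34 _ _ _ _
    have h' : ∑ c, ∑ d, vol X a c d * (sgn c * sgn d * (sgn b * X.1 b) * T X d c)
        = - ∑ c, ∑ d, vol X a c d * (sgn c * sgn d * (sgn b * X.1 b) * T X d c) := by
      conv_lhs => rw [Finset.sum_comm]
      simp only [← Finset.sum_neg_distrib]
      refine Finset.sum_congr rfl fun c _ => Finset.sum_congr rfl fun d _ => ?_
      rw [anti d c, hsymm X c d]; ring
    linarith
  simp only [curl, h, Finset.sum_add_distrib, z₁, z₂]
  simp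

/-- The flat wave operator of `ℝ⁴` applied to the radial extension of a function. -/
def flatBox (F : dS3 → ℝ) (X : dS3) : ℝ := ∑ c, sgn c * pd c (pd c (ext F)) X.1

/-- On symmetric, traceless and divergence-free tensors, `□ - 2` acts on the ambient components as
the flat wave operator on the radial extensions. -/
lemma IsTensor.box_eq {T : Field2} (hT : IsTensor T) (hsymm : ∀ X a b, T X a b = T X b a)
    (htr : ∀ X, ∑ a, sgn a * T X a a = 0)
    (hdiv : ∀ X a, ∑ b, sgn b * cov2 T X b a b = 0) (X : dS3) (a b : Fin 4) :
    box T X a b = flatBox (fun Y => T Y a b) X + 2 * T X a b := by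
  have hX := mem_cone X
  have covsymm : ∀ c a b, cov2 T X c a b = cov2 T X c b a := fun c a b => by
    rw [hT.cov2_eq, hT.cov2_eq, hsymm X c b, hsymm X a c,
      show (fun Y => T Y a b) = fun Y => T Y b a from funext fun Y => hsymm Y a b]
    ring
  -- the derivatives of the three terms in `cov2_eq`
  have hd : ∀ c, dif (fun Y => cov2 T Y c a b) X c
      = sgn c * X.1 c * pd c (ext fun Y => T Y a b) X.1 + pd c (pd c (ext fun Y => T Y a b)) X.1
        + (sgn a * ((if c = a then 1 else 0) - sgn c * X.1 c * X.1 a) * T X c b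
            + sgn a * X.1 a * dif (fun Y => T Y c b) X c)
        + (sgn b * ((if c = b then 1 else 0) - sgn c * X.1 c * X.1 b) * T X a c
            + sgn b * X.1 b * dif (fun Y => T Y a c) X c) := fun c => by
    have sl : ∀ a : Fin 4, Smooth fun Y => sgn a * Y.1 a := fun a =>
      (smooth_const (sgn a)).mul (smooth_coord a)
    have dl : ∀ a c : Fin 4, dif (fun Y => sgn a * Y.1 a) X c
        = sgn a * ((if c = a then 1 else 0) - sgn c * X.1 c * X.1 a) := fun a c => by
      rw [dif_mul (smooth_const _) (smooth_coord _), dif_const, dif_coord]; ring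
    have d0 : dif (fun Y => dif (fun Y => T Y a b) Y c) X c
        = sgn c * X.1 c * pd c (ext fun Y => T Y a b) X.1
          + pd c (pd c (ext fun Y => T Y a b)) X.1 := by
      have h : ∀ Z ∈ cone, ext (fun Y => dif (fun Y => T Y a b) Y c) Z
          = nrm Z * pd c (ext fun Y => T Y a b) Z := fun Z hZ =>
        dif_radialProj (hT.smooth a b) hZ c
      rw [dif_eq_pd, pd_congr hX h,
        pd_mul ((contDiffAt_nrm hX).differentiableAt (by simp))
          ((hT.smooth a b).differentiableAt_pd hX c), pd_nrm hX, nrm_coe]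
      ring
    simp only [hT.cov2_eq]
    rw [dif_add ((smooth_dif (hT.smooth a b) c).add ((sl a).mul (hT.smooth c b)))
        ((sl b).mul (hT.smooth a c)),
      dif_add (smooth_dif (hT.smooth a b) c) ((sl a).mul (hT.smooth c b)),
      dif_mul (sl a) (hT.smooth c b), dif_mul (sl b) (hT.smooth a c), d0, dl, dl]
  -- grouped so that, summed over `c`, every term other than the flat wave operator and the two
  -- copies of `T X a b` is a contraction with `X` or a divergence
  have hc : ∀ c, sgn c * cov3 (cov2 T) X c c a b
      = X.1 c * pd c (ext fun Y => T Y a b) X.1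
        + sgn c * pd c (pd c (ext fun Y => T Y a b)) X.1
        + ((if c = a then T X c b else 0) - sgn a * X.1 a * (X.1 c * T X c b)
            + sgn a * X.1 a * (sgn c * dif (fun Y => T Y b c) X c))
        + ((if c = b then T X a c else 0) - sgn b * X.1 b * (X.1 c * T X a c)
            + sgn b * X.1 b * (sgn c * dif (fun Y => T Y a c) X c))
        + X.1 c * cov2 T X c a b + sgn a * X.1 a * (sgn c * cov2 T X c b c)
        + sgn b * X.1 b * (sgn c * cov2 T X c a c) := fun c => by
    rw [cov3_eq hT.smooth_cov2 hT.cov2_tangent_left cov2_tangent_mid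
      cov2_tangent_right, hd c, covsymm c b c,
      show (fun Y => T Y b c) = fun Y => T Y c b from funext fun Y => hsymm Y b c]
    have s := sgn_mul_sgn c
    have i₁ : sgn c * (sgn a * (if c = a then 1 else 0) * T X c b)
        = if c = a then T X c b else 0 := by
      split_ifs with h
      · subst h; linear_combination T X c b * s
      · ring
    have i₂ : sgn c * (sgn b * (if c = b then 1 else 0) * T X a c)
        = if c = b then T X a c else 0 := by
      split_ifs with h
      · subst h; linear_combination T X a c * s
      · ring
    linear_combination i₁ + i₂ + (X.1 c * pd c (ext fun Y => T Y a b) X.1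
      - sgn a * X.1 a * (X.1 c * T X c b) - sgn b * X.1 b * (X.1 c * T X a c)
      + X.1 c * cov2 T X c a b) * s
  have hdiv' : ∀ a, ∑ b, sgn b * dif (fun Y => T Y a b) X b = 0 := fun a => by
    rw [← hT.div_eq htr, hdiv]
  simp only [box, hc, Finset.sum_add_distrib, Finset.sum_sub_distrib, ← Finset.mul_sum, hdiv, hdiv',
    hT.cov2_tangent_left, hT.tangent_left, hT.tangent_right, euler_ext (hT.smooth a b) hX]
  simp only [Finset.sum_ite_eq', Finset.mem_univ, if_true, flatBox]
  ring

/-- The equations of `IsSolution` in terms of the radial extension of the ambient components: a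
symmetric and traceless tensor which is divergence-free and harmonic in flat space. -/
structure IsFlatSolution (T : Field2) : Prop where
  tensor : IsTensor T
  symm : ∀ X a b, T X a b = T X b a
  traceless : ∀ X, ∑ a, sgn a * T X a a = 0
  div_free : ∀ X a, ∑ b, sgn b * dif (fun Y => T Y a b) X b = 0
  wave : ∀ X a b, flatBox (fun Y => T Y a b) X = 0

lemma isSolution_iff {T : Field2} : IsSolution T ↔ IsFlatSolution T := by
  constructor
  · intro h
    refine ⟨h.tensor, h.symm, h.traceless, fun X a => ?_, fun X a b => ?_⟩
    · rw [← h.tensor.div_eq h.traceless, h.div_free]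
    · have := h.wave X a b
      rw [h.tensor.box_eq h.symm h.traceless h.div_free] at this
      linarith
  · intro h
    have hdiv : ∀ X a, ∑ b, sgn b * cov2 T X b a b = 0 := fun X a => by
      rw [h.tensor.div_eq h.traceless, h.div_free]
    refine ⟨h.tensor, h.symm, h.traceless, hdiv, fun X a b => ?_⟩
    rw [h.tensor.box_eq h.symm h.traceless hdiv, h.wave]
    ring

lemma pd_pd_add {f g : (Fin 4 → ℝ) → ℝ} {Y : Fin 4 → ℝ} (hf : ContDiffAt ℝ ∞ f Y)
    (hg : ContDiffAt ℝ ∞ g Y) (a : Fin 4) :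
    pd a (pd a (fun Z => f Z + g Z)) Y = pd a (pd a f) Y + pd a (pd a g) Y := by
  have h : pd a (fun Z => f Z + g Z) =ᶠ[nhds Y] fun Z => pd a f Z + pd a g Z := by
    filter_upwards [(hf.of_le (m := 1) (by norm_cast)).eventually (by simp),
      (hg.of_le (m := 1) (by norm_cast)).eventually (by simp)] with Z h1 h2
    exact pd_add (h1.differentiableAt (by simp)) (h2.differentiableAt (by simp)) a
  rw [pd, h.fderiv_eq, ← pd, pd_add ((contDiffAt_pd hf a).differentiableAt (by simp))
    ((contDiffAt_pd hg a).differentiableAt (by simp))]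

lemma pd_pd_const_mul {g : (Fin 4 → ℝ) → ℝ} {Y : Fin 4 → ℝ} (c : ℝ)
    (hg : ContDiffAt ℝ ∞ g Y) (a : Fin 4) :
    pd a (pd a (fun Z => c * g Z)) Y = c * pd a (pd a g) Y := by
  have h : pd a (fun Z => c * g Z) =ᶠ[nhds Y] fun Z => c * pd a g Z := by
    filter_upwards [(hg.of_le (m := 1) (by norm_cast)).eventually (by simp)] with Z h2
    exact pd_const_mul c (h2.differentiableAt (by simp)) a
  rw [pd, h.fderiv_eq, ← pd, pd_const_mul c ((contDiffAt_pd hg a).differentiableAt (by simp))]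

lemma IsFlatSolution.add {T U : Field2} (hT : IsFlatSolution T) (hU : IsFlatSolution U) :
    IsFlatSolution (fun X a b => T X a b + U X a b) where
  tensor := by
    refine ⟨fun X b => ?_, fun X a => ?_, fun a b => (hT.tensor.smooth a b).add
      (hU.tensor.smooth a b)⟩
    · simp [mul_add, Finset.sum_add_distrib, hT.tensor.tangent_left, hU.tensor.tangent_left]
    · simp [mul_add, Finset.sum_add_distrib, hT.tensor.tangent_right, hU.tensor.tangent_right]
  symm X a b := by rw [hT.symm, hU.symm]
  traceless X := by simp [mul_add, Finset.sum_add_distrib, hT.traceless, hU.traceless]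
  div_free X a := by
    simp [dif_add (hT.tensor.smooth _ _) (hU.tensor.smooth _ _), mul_add, Finset.sum_add_distrib,
      hT.div_free, hU.div_free]
  wave X a b := by
    have h : ∀ c, pd c (pd c (ext fun Y => T Y a b + U Y a b)) X.1
        = pd c (pd c (ext fun Y => T Y a b)) X.1 + pd c (pd c (ext fun Y => U Y a b)) X.1 :=
      fun c => pd_pd_add ((hT.tensor.smooth a b).contDiffAt (mem_cone X))
        ((hU.tensor.smooth a b).contDiffAt (mem_cone X)) c
    have h1 := hT.wave X a b
    have h2 := hU.wave X a b
    simp only [flatBox] at h1 h2 ⊢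
    simp only [h, mul_add, Finset.sum_add_distrib, h1, h2, add_zero]

lemma IsFlatSolution.const_mul {T : Field2} (hT : IsFlatSolution T) (k : ℝ) :
    IsFlatSolution (fun X a b => k * T X a b) where
  tensor := by
    refine ⟨fun X b => ?_, fun X a => ?_, fun a b => (smooth_const k).mul (hT.tensor.smooth a b)⟩
    · simp [mul_left_comm _ k, ← Finset.mul_sum, hT.tensor.tangent_left]
    · simp [mul_left_comm _ k, ← Finset.mul_sum, hT.tensor.tangent_right]
  symm X a b := by rw [hT.symm]
  traceless X := by simp [mul_left_comm _ k, ← Finset.mul_sum, hT.traceless]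
  div_free X a := by
    simp [dif_mul (smooth_const k) (hT.tensor.smooth _ _), dif_const, mul_left_comm _ k,
      ← Finset.mul_sum, hT.div_free]
  wave X a b := by
    have h : ∀ c, pd c (pd c (ext fun Y => k * T Y a b)) X.1
        = k * pd c (pd c (ext fun Y => T Y a b)) X.1 :=
      fun c => pd_pd_const_mul k ((hT.tensor.smooth a b).contDiffAt (mem_cone X)) c
    have h1 := hT.wave X a b
    simp only [flatBox] at h1 ⊢
    simp only [h, mul_left_comm _ k, ← Finset.mul_sum, h1, mul_zero]

lemma isFlatSolution_zero : IsFlatSolution (fun _ _ _ => 0) where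
  tensor := ⟨fun X b => by simp, fun X a => by simp, fun a b => smooth_const 0⟩
  symm X a b := rfl
  traceless X := by simp
  div_free X a := by simp [dif_const]
  wave X a b := by
    have : ∀ c, pd c (ext fun _ : dS3 => (0 : ℝ)) = fun _ => 0 := fun c =>
      funext fun Y => pd_const c 0 Y
    simp [flatBox, this, pd_const]

lemma IsFlatSolution.sum {ι : Type*} (s : Finset ι) {T : ι → Field2}
    (h : ∀ i, IsFlatSolution (T i)) : IsFlatSolution (fun X a b => ∑ i ∈ s, T i X a b) := by
  classical
  induction s using Finset.induction_on with
  | empty => simpa using isFlatSolution_zero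
  | insert i s hi ih =>
    simp only [Finset.sum_insert hi]
    exact (h i).add ih

/-! ### Rational functions of the coordinates and the spatial radius -/

/-- The square `Y₁² + Y₂² + Y₃²` of the spatial radius, as a polynomial. -/
def radSqPoly : MvPolynomial (Fin 4) ℝ :=
  .X 1 * .X 1 + .X 2 * .X 2 + .X 3 * .X 3

/-- The square of the spatial radius. -/
def radSq (Y : Fin 4 → ℝ) : ℝ := Y 1 * Y 1 + Y 2 * Y 2 + Y 3 * Y 3

/-- The function `P(Y) r⁻ⁿ`, where `r` is the spatial radius `√radSq`; on the hyperboloid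
`r = cosh τ`. -/
def frac (P : MvPolynomial (Fin 4) ℝ) (n : ℕ) (Y : Fin 4 → ℝ) : ℝ :=
  MvPolynomial.eval Y P * (√(radSq Y))⁻¹ ^ n

/-- The numerator of `∂_c (P r⁻ⁿ)` over the denominator `rⁿ⁺²`. -/
def dnum (n : ℕ) (c : Fin 4) (P : MvPolynomial (Fin 4) ℝ) : MvPolynomial (Fin 4) ℝ :=
  radSqPoly * MvPolynomial.pderiv c P
    - MvPolynomial.C (if c = 0 then 0 else (n : ℝ)) * .X c * P

lemma eval_radSqPoly (Y : Fin 4 → ℝ) : MvPolynomial.eval Y radSqPoly = radSq Y := by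
  simp [radSqPoly, radSq]

lemma radSq_pos {Y : Fin 4 → ℝ} (hY : Y ∈ cone) : 0 < radSq Y := by
  have h : 0 < mink Y Y := hY
  rw [mink_eq] at h
  have := mul_self_nonneg (Y 0)
  rw [radSq]; linarith

lemma hasFDerivAt_eval (P : MvPolynomial (Fin 4) ℝ) (Y : Fin 4 → ℝ) :
    HasFDerivAt (fun Z => MvPolynomial.eval Z P)
      (∑ c, MvPolynomial.eval Y (MvPolynomial.pderiv c P) •
        ContinuousLinearMap.proj (R := ℝ) (φ := fun _ : Fin 4 => ℝ) c) Y := by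
  induction P using MvPolynomial.induction_on with
  | C a => simpa using hasFDerivAt_const a Y
  | add p q hp hq =>
    simp only [map_add, add_smul, Finset.sum_add_distrib]
    exact hp.fun_add hq
  | mul_X p i hp =>
    simp only [map_mul, MvPolynomial.eval_X]
    refine (hp.fun_mul (hasFDerivAt_apply i Y)).congr_fderiv ?_
    ext v
    simp [MvPolynomial.pderiv_X, Pi.single_apply, Fin.sum_univ_four]
    fin_cases i <;> simp <;> ring

lemma contDiff_eval (P : MvPolynomial (Fin 4) ℝ) :
    ContDiff ℝ ∞ (fun Z => MvPolynomial.eval Z P) := by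
  induction P using MvPolynomial.induction_on with
  | C a => simpa using contDiff_const
  | add p q hp hq => simpa using hp.add hq
  | mul_X p i hp => simpa using hp.mul (contDiff_apply ℝ ℝ i)

lemma pd_eval (P : MvPolynomial (Fin 4) ℝ) (c : Fin 4) (Y : Fin 4 → ℝ) :
    pd c (fun Z => MvPolynomial.eval Z P) Y = MvPolynomial.eval Y (MvPolynomial.pderiv c P) := by
  rw [pd, (hasFDerivAt_eval P Y).fderiv]
  simp [Pi.single_apply]

lemma contDiff_radSq : ContDiff ℝ ∞ radSq := by
  unfold radSq; fun_prop

lemma contDiffAt_rad_inv {Y : Fin 4 → ℝ} (hY : Y ∈ cone) :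
    ContDiffAt ℝ ∞ (fun Z => (√(radSq Z))⁻¹) Y :=
  (contDiff_radSq.contDiffAt.sqrt (radSq_pos hY).ne').inv (Real.sqrt_pos.2 (radSq_pos hY)).ne'

lemma contDiffAt_frac (P : MvPolynomial (Fin 4) ℝ) (n : ℕ) {Y : Fin 4 → ℝ} (hY : Y ∈ cone) :
    ContDiffAt ℝ ∞ (frac P n) Y :=
  (contDiff_eval P).contDiffAt.mul ((contDiffAt_rad_inv hY).pow n)

lemma rad_inv_sq {Y : Fin 4 → ℝ} (hY : Y ∈ cone) : (√(radSq Y))⁻¹ ^ 2 * radSq Y = 1 := by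
  rw [inv_pow, Real.sq_sqrt (radSq_pos hY).le, inv_mul_cancel₀ (radSq_pos hY).ne']

lemma pd_rad_inv_pow (n : ℕ) (c : Fin 4) {Y : Fin 4 → ℝ} (hY : Y ∈ cone) :
    pd c (fun Z => (√(radSq Z))⁻¹ ^ n) Y
      = - (if c = 0 then 0 else (n : ℝ)) * Y c * (√(radSq Y))⁻¹ ^ (n + 2) := by
  have hr : HasFDerivAt radSq (fderiv ℝ radSq Y) Y :=
    (contDiff_radSq.differentiable (by simp) Y).hasFDerivAt
  have hp : pd c radSq Y = if c = 0 then 0 else 2 * Y c := by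
    have : radSq = fun Z => MvPolynomial.eval Z radSqPoly := funext fun Z => (eval_radSqPoly Z).symm
    rw [this, pd_eval]
    fin_cases c <;> simp [radSqPoly, MvPolynomial.pderiv_X] <;> ring
  have hpos := Real.sqrt_pos.2 (radSq_pos hY)
  have h0 : HasDerivAt (fun s : ℝ => (√s)⁻¹ ^ n) _ (radSq Y) :=
    ((Real.hasDerivAt_sqrt (radSq_pos hY).ne').inv hpos.ne').pow n
  have h1 : pd c (fun Z => (√(radSq Z))⁻¹ ^ n) Y = _ :=
    congrArg (fun L => L (basisVec c)) (h0.comp_hasFDerivAt Y hr).fderiv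
  rw [h1]
  change _ * pd c radSq Y = _
  rw [hp]
  cases n with
  | zero => simp
  | succ m =>
    simp only [Pi.inv_apply, Nat.add_sub_cancel]
    split_ifs
    · ring
    · field_simp
      rw [one_div_pow, one_div_pow]
      field_simp
      ring

lemma pd_frac (P : MvPolynomial (Fin 4) ℝ) (n : ℕ) (c : Fin 4) {Y : Fin 4 → ℝ} (hY : Y ∈ cone) :
    pd c (frac P n) Y = frac (dnum n c P) (n + 2) Y := by
  have h := pd_mul ((contDiff_eval P).differentiable (by simp) Y)
    (((contDiffAt_rad_inv hY).pow n).differentiableAt (by simp)) c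
  have h2 : pd c (frac P n) Y = _ := h
  rw [h2, pd_eval, pd_rad_inv_pow n c hY, frac, dnum]
  simp only [map_sub, map_mul, eval_radSqPoly, MvPolynomial.eval_C, MvPolynomial.eval_X]
  linear_combination -(MvPolynomial.eval Y (MvPolynomial.pderiv c P)) * (√(radSq Y))⁻¹ ^ n
    * rad_inv_sq hY

/-- A function whose radial extension is `P r⁻ⁿ` is harmonic if the numerator of the flat wave
operator applied to `P r⁻ⁿ`, here over `rⁿ⁺²`, vanishes. -/
lemma flatBox_frac {F : dS3 → ℝ} {P : MvPolynomial (Fin 4) ℝ} {n : ℕ}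
    (hF : ∀ Y ∈ cone, ext F Y = frac P n Y)
    (hP : ∀ Y, radSq Y * ∑ c, sgn c *
        MvPolynomial.eval Y (MvPolynomial.pderiv c (MvPolynomial.pderiv c P))
      - 2 * n * (∑ i : Fin 3, Y i.succ * MvPolynomial.eval Y (MvPolynomial.pderiv i.succ P))
      + n * (n - 1) * MvPolynomial.eval Y P = 0) (X : dS3) : flatBox F X = 0 := by
  have h : ∀ c, pd c (pd c (ext F)) X.1 = frac (dnum (n + 2) c (dnum n c P)) (n + 2 + 2) X.1 :=
    fun c => by
    rw [pd_congr (mem_cone X) (fun Z hZ => (pd_congr hZ hF c).trans (pd_frac P n c hZ)),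
      pd_frac _ _ _ (mem_cone X)]
  have h2 : ∑ c, sgn c * MvPolynomial.eval X.1 (dnum (n + 2) c (dnum n c P)) = 0 := by
    rw [← mul_zero (radSq X.1), ← hP X.1]
    simp [dnum, Fin.sum_univ_succ, sgn, radSqPoly, radSq, MvPolynomial.pderiv_X]
    ring
  simp only [flatBox, h, frac, ← mul_assoc, ← Finset.sum_mul, h2, zero_mul]

/-! ### Values of derivatives of polynomials -/

/-- The value of the first partial derivative of a polynomial. -/
def evalD (c : Fin 4) (Y : Fin 4 → ℝ) (P : MvPolynomial (Fin 4) ℝ) : ℝ :=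
  MvPolynomial.eval Y (MvPolynomial.pderiv c P)

/-- The value of the second partial derivative of a polynomial in one direction. -/
def evalDD (c : Fin 4) (Y : Fin 4 → ℝ) (P : MvPolynomial (Fin 4) ℝ) : ℝ :=
  MvPolynomial.eval Y (MvPolynomial.pderiv c (MvPolynomial.pderiv c P))

lemma evalD_add (c : Fin 4) (Y : Fin 4 → ℝ) (P Q : MvPolynomial (Fin 4) ℝ) :
    evalD c Y (P + Q) = evalD c Y P + evalD c Y Q := by simp [evalD]

lemma evalD_sub (c : Fin 4) (Y : Fin 4 → ℝ) (P Q : MvPolynomial (Fin 4) ℝ) :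
    evalD c Y (P - Q) = evalD c Y P - evalD c Y Q := by simp [evalD]

lemma evalD_mul (c : Fin 4) (Y : Fin 4 → ℝ) (P Q : MvPolynomial (Fin 4) ℝ) :
    evalD c Y (P * Q) = P.eval Y * evalD c Y Q + Q.eval Y * evalD c Y P := by simp [evalD]

lemma evalD_C (c : Fin 4) (Y : Fin 4 → ℝ) (a : ℝ) : evalD c Y (.C a) = 0 := by simp [evalD]

lemma evalD_X (c : Fin 4) (Y : Fin 4 → ℝ) (j : Fin 4) :
    evalD c Y (.X j) = if j = c then 1 else 0 := by
  simp [evalD, MvPolynomial.pderiv_X, Pi.single_apply, apply_ite, eq_comm]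

lemma evalDD_add (c : Fin 4) (Y : Fin 4 → ℝ) (P Q : MvPolynomial (Fin 4) ℝ) :
    evalDD c Y (P + Q) = evalDD c Y P + evalDD c Y Q := by simp [evalDD]

lemma evalDD_sub (c : Fin 4) (Y : Fin 4 → ℝ) (P Q : MvPolynomial (Fin 4) ℝ) :
    evalDD c Y (P - Q) = evalDD c Y P - evalDD c Y Q := by simp [evalDD]

lemma evalDD_mul (c : Fin 4) (Y : Fin 4 → ℝ) (P Q : MvPolynomial (Fin 4) ℝ) :
    evalDD c Y (P * Q) = P.eval Y * evalDD c Y Q + 2 * evalD c Y P * evalD c Y Q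
      + Q.eval Y * evalDD c Y P := by
  simp [evalDD, evalD]; ring

lemma evalDD_C (c : Fin 4) (Y : Fin 4 → ℝ) (a : ℝ) : evalDD c Y (.C a) = 0 := by simp [evalDD]

lemma evalDD_X (c : Fin 4) (Y : Fin 4 → ℝ) (j : Fin 4) : evalDD c Y (.X j) = 0 := by
  simp [evalDD, MvPolynomial.pderiv_X, Pi.single_apply, apply_ite]

lemma evalD_radSqPoly (c : Fin 4) (Y : Fin 4 → ℝ) :
    evalD c Y radSqPoly = if c = 0 then 0 else 2 * Y c := by
  fin_cases c <;> simp [radSqPoly, evalD_add, evalD_mul, evalD_X] <;> ring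

lemma evalDD_radSqPoly (c : Fin 4) (Y : Fin 4 → ℝ) :
    evalDD c Y radSqPoly = if c = 0 then 0 else 2 := by
  fin_cases c <;> simp [radSqPoly, evalDD_add, evalDD_mul, evalD_X, evalDD_X]

/-! ### The tensors `V` and `W` in ambient coordinates -/

/-- The polynomial `⟨Y,Y⟩`. -/
def minkPoly : MvPolynomial (Fin 4) ℝ := radSqPoly - .X 0 * .X 0

/-- The components `⟨Y,Y⟩ δ_a^b - Y^b Y_a` of the differential of the coordinate `Y^b` on the
hyperboloid, made homogeneous. -/
def difPoly (b a : Fin 4) : MvPolynomial (Fin 4) ℝ :=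
  minkPoly * .C (if a = b then 1 else 0) - .X b * (.C (sgn a) * .X a)

/-- The components of the metric of the hyperboloid, made homogeneous. -/
def metricPoly (a b : Fin 4) : MvPolynomial (Fin 4) ℝ :=
  minkPoly * .C (if a = b then sgn a else 0) - .C (sgn a) * .X a * (.C (sgn b) * .X b)

/-- The matrix of the linear map `Y ↦ e_k × Y` (the vector product in the spatial coordinates). -/
def crossCoeff : Fin 3 → Fin 4 → Fin 4 → ℝ :=
  ![![0, 0, ![0, 0, 0, -1], ![0, 0, 1, 0]], ![0, ![0, 0, 0, 1], 0, ![0, -1, 0, 0]],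
    ![0, ![0, 0, -1, 0], ![0, 1, 0, 0], 0]]

/-- The rotation one-form `e_k × Y` along the sphere. -/
def crossPoly (k : Fin 3) (a : Fin 4) : MvPolynomial (Fin 4) ℝ :=
  .C (crossCoeff k a 1) * .X 1 + .C (crossCoeff k a 2) * .X 2 + .C (crossCoeff k a 3) * .X 3

/-- The numerator of the components of `V_(k)`, over `r⁷`.  On the hyperboloid `cosh τ dτ = dX⁰` and
`∂_i ζ dx^i = dX^k - cosh⁻² τ X⁰ X^k dX⁰`, so that `cosh⁷ τ V_(k)`, in terms of
`dX⁰`, `dX^k` and the metric `h`, has the coefficient `X^k (3 - 2 sinh² τ) = X^k (5 - 2 cosh² τ)` at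
`dX⁰ dX⁰`.  Powers of `⟨Y,Y⟩` make the degree equal to `7`. -/
def polyV (k : Fin 3) (a b : Fin 4) : MvPolynomial (Fin 4) ℝ :=
  .X k.succ * (.C 5 * minkPoly - .C 2 * radSqPoly) * (difPoly 0 a * difPoly 0 b)
    + .X 0 * radSqPoly * (difPoly 0 a * difPoly k.succ b + difPoly k.succ a * difPoly 0 b)
    + .X k.succ * (minkPoly * radSqPoly) * metricPoly a b

/-- The numerator of the components of `W_(k)`, over `r⁵`, made homogeneous of degree `5`. -/
def polyW (k : Fin 3) (a b : Fin 4) : MvPolynomial (Fin 4) ℝ :=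
  minkPoly * (difPoly 0 a * crossPoly k b + crossPoly k a * difPoly 0 b)

lemma polyV_symm (k : Fin 3) (a b : Fin 4) : polyV k a b = polyV k b a := by
  have h : metricPoly a b = metricPoly b a := by
    by_cases h : a = b
    · rw [h]
    · simp only [metricPoly, h, Ne.symm h, if_false]; ring
  rw [polyV, polyV, h]; ring

lemma polyW_symm (k : Fin 3) (a b : Fin 4) : polyW k a b = polyW k b a := by
  rw [polyW, polyW]; ring

lemma eval_minkPoly (Y : Fin 4 → ℝ) : minkPoly.eval Y = radSq Y - Y 0 * Y 0 := by
  simp [minkPoly, eval_radSqPoly]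

lemma evalD_minkPoly (c : Fin 4) (Y : Fin 4 → ℝ) : evalD c Y minkPoly = 2 * sgn c * Y c := by
  fin_cases c <;> simp [minkPoly, evalD_radSqPoly, evalD_sub, evalD_mul, evalD_X, sgn]; ring

lemma evalDD_minkPoly (c : Fin 4) (Y : Fin 4 → ℝ) : evalDD c Y minkPoly = 2 * sgn c := by
  fin_cases c <;>
    simp [minkPoly, evalDD_radSqPoly, evalDD_sub, evalDD_mul, evalD_X, evalDD_X, sgn]

lemma eval_difPoly (b a : Fin 4) (Y : Fin 4 → ℝ) : (difPoly b a).eval Y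
    = minkPoly.eval Y * (if a = b then 1 else 0) - Y b * (sgn a * Y a) := by
  simp only [difPoly, map_sub, map_mul, MvPolynomial.eval_C, MvPolynomial.eval_X]

lemma eval_crossPoly (k : Fin 3) (a : Fin 4) (Y : Fin 4 → ℝ) : (crossPoly k a).eval Y
    = crossCoeff k a 1 * Y 1 + crossCoeff k a 2 * Y 2 + crossCoeff k a 3 * Y 3 := by
  simp [crossPoly]

lemma evalD_difPoly (b a c : Fin 4) (Y : Fin 4 → ℝ) : evalD c Y (difPoly b a)
    = 2 * sgn c * Y c * (if a = b then 1 else 0) - (if b = c then 1 else 0) * sgn a * Y a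
      - (if a = c then 1 else 0) * sgn a * Y b := by
  simp only [difPoly, evalD_sub, evalD_mul, evalD_minkPoly, evalD_C, evalD_X, map_mul,
    MvPolynomial.eval_X, MvPolynomial.eval_C]
  ring

lemma evalDD_difPoly (b a c : Fin 4) (Y : Fin 4 → ℝ) : evalDD c Y (difPoly b a)
    = 2 * sgn c * (if a = b then 1 else 0)
      - 2 * sgn a * (if b = c then 1 else 0) * (if a = c then 1 else 0) := by
  simp only [difPoly, evalDD_sub, evalD_mul, evalDD_mul, evalDD_minkPoly, evalDD_C, evalDD_X,
    evalD_X, evalD_C, evalD_minkPoly, map_mul, MvPolynomial.eval_X, MvPolynomial.eval_C]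
  ring

lemma evalD_crossPoly (k : Fin 3) (a c : Fin 4) (Y : Fin 4 → ℝ) : evalD c Y (crossPoly k a)
    = if c = 0 then 0 else crossCoeff k a c := by
  simp only [crossPoly, evalD_add, evalD_mul, evalD_C, evalD_X, MvPolynomial.eval_X,
    MvPolynomial.eval_C]
  fin_cases c <;> simp

lemma evalDD_crossPoly (k : Fin 3) (a c : Fin 4) (Y : Fin 4 → ℝ) :
    evalDD c Y (crossPoly k a) = 0 := by
  simp [crossPoly, evalDD_add, evalDD_mul, evalDD_C, evalDD_X, evalD_C]

set_option maxHeartbeats 4000000 in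
lemma polyV_wave (k : Fin 3) (a b : Fin 4) (Y : Fin 4 → ℝ) :
    radSq Y * ∑ c, sgn c * evalDD c Y (polyV k a b)
      - 2 * (7 : ℕ) * (∑ i : Fin 3, Y i.succ * evalD i.succ Y (polyV k a b))
      + (7 : ℕ) * ((7 : ℕ) - 1) * (polyV k a b).eval Y = 0 := by
  wlog h : a ≤ b
  · rw [polyV_symm]; exact this k b a Y (le_of_not_ge h)
  simp only [polyV, metricPoly, evalDD_add, evalDD_sub, evalDD_mul, evalDD_X, evalDD_C,
    evalD_add, evalD_sub, evalD_mul, evalD_C, evalD_X, evalD_radSqPoly, evalDD_radSqPoly,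
    evalD_minkPoly, evalDD_minkPoly, map_add, map_sub, map_mul, evalD_difPoly, evalDD_difPoly,
    MvPolynomial.eval_C, MvPolynomial.eval_X, eval_radSqPoly, eval_minkPoly, eval_difPoly,
    mul_zero, zero_mul, add_zero, zero_add]
  simp only [Fin.sum_univ_four, Fin.sum_univ_three]
  fin_cases k <;> fin_cases a <;> fin_cases b <;> first
    | exact absurd h (by decide)
    | (simp [sgn, radSq]; ring)

set_option maxHeartbeats 4000000 in
lemma polyW_wave (k : Fin 3) (a b : Fin 4) (Y : Fin 4 → ℝ) :
    radSq Y * ∑ c, sgn c * evalDD c Y (polyW k a b)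
      - 2 * (5 : ℕ) * (∑ i : Fin 3, Y i.succ * evalD i.succ Y (polyW k a b))
      + (5 : ℕ) * ((5 : ℕ) - 1) * (polyW k a b).eval Y = 0 := by
  wlog h : a ≤ b
  · rw [polyW_symm]; exact this k b a Y (le_of_not_ge h)
  simp only [polyW, evalDD_add, evalDD_mul, evalD_add, evalD_mul, evalD_minkPoly,
    evalDD_minkPoly, map_add, map_mul, evalD_difPoly, evalDD_difPoly, evalD_crossPoly,
    evalDD_crossPoly, eval_crossPoly, eval_minkPoly, eval_difPoly, mul_zero, add_zero, zero_add]
  simp only [Fin.sum_univ_four, Fin.sum_univ_three]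
  fin_cases k <;> fin_cases a <;> fin_cases b <;> first
    | exact absurd h (by decide)
    | (simp [sgn, radSq, crossCoeff]; try ring)

lemma cosh_tau_sq (X : dS3) : Real.cosh (tau X) ^ 2 = 1 + X.1 0 ^ 2 := by
  rw [tau, Real.cosh_sq, Real.sinh_arsinh]; ring

lemma radSq_coe (X : dS3) : radSq X.1 = Real.cosh (tau X) ^ 2 := by
  have h := mink_self X
  rw [mink_eq] at h
  rw [cosh_tau_sq, radSq]; linarith

lemma sqrt_radSq_coe (X : dS3) : √(radSq X.1) = Real.cosh (tau X) := by
  rw [radSq_coe, Real.sqrt_sq (Real.cosh_pos _).le]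

lemma eval_minkPoly_eq (Y : Fin 4 → ℝ) : minkPoly.eval Y = mink Y Y := by
  rw [eval_minkPoly, radSq, mink_eq]; ring

lemma eval_minkPoly_coe (X : dS3) : minkPoly.eval X.1 = 1 := by
  rw [eval_minkPoly_eq, mink_self]

lemma dif_coord_eq (X : dS3) (a b : Fin 4) :
    dif (fun Y => Y.1 b) X a = (difPoly b a).eval X.1 := by
  rw [dif_coord, eval_difPoly, eval_minkPoly_coe]; ring

lemma smooth_tau : Smooth tau :=
  smooth_iff.2 fun _ hY => ((smooth_coord 0).contDiffAt hY).arsinh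

lemma dif_tau (X : dS3) (a : Fin 4) :
    dif tau X a = (Real.cosh (tau X))⁻¹ * (difPoly 0 a).eval X.1 := by
  have h := (((smooth_coord 0).differentiableAt (mem_cone X)).hasFDerivAt.arsinh).fderiv
  have h2 : dif tau X a = (√(1 + ext (fun X => X.1 0) X.1 ^ 2))⁻¹ * dif (fun X => X.1 0) X a :=
    congrArg (fun L => L (basisVec a)) h
  rw [h2, dif_coord_eq, ext_coe, tau, Real.cosh_arsinh]

lemma ptau_contract (X : dS3) (k : Fin 3) :
    ∑ c, ptau X c * dif (zeta k.succ) X c = (Real.cosh (tau X))⁻¹ * (X.1 0 * X.1 k.succ) := by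
  have h : ∀ c, ptau X c * dif (zeta k.succ) X c = (Real.cosh (tau X))⁻¹ *
      (- (sgn c * (difPoly 0 c).eval X.1 * (difPoly k.succ c).eval X.1)) := fun c => by
    rw [ptau, dif_tau, show zeta k.succ = fun Y : dS3 => Y.1 k.succ from rfl, dif_coord_eq]
    ring
  simp only [h, ← Finset.mul_sum]
  congr 1
  have hm := mink_self X
  rw [mink_eq] at hm
  simp only [eval_difPoly, eval_minkPoly_coe]
  fin_cases k <;> simp [Fin.sum_univ_four, sgn]
  · linear_combination (-X.1 0 * X.1 1) * hm
  · linear_combination (-X.1 0 * X.1 2) * hm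
  · linear_combination (-X.1 0 * X.1 3) * hm

lemma difSphere_zeta (X : dS3) (k : Fin 3) (a : Fin 4) :
    difSphere (zeta k.succ) X a = (difPoly k.succ a).eval X.1
      - (Real.cosh (tau X))⁻¹ ^ 2 * (X.1 0 * X.1 k.succ) * (difPoly 0 a).eval X.1 := by
  rw [difSphere, ptau_contract, dif_tau, show zeta k.succ = fun Y : dS3 => Y.1 k.succ from rfl,
    dif_coord_eq]
  ring

lemma V_eq (k : Fin 3) (X : dS3) (a b : Fin 4) : V k X a b = frac (polyV k a b) 7 X.1 := by
  have hC := cosh_tau_sq X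
  have hpos := Real.cosh_pos (tau X)
  have hmet : metric X a b = (metricPoly a b).eval X.1 := by
    simp only [metricPoly, map_sub, map_mul, eval_minkPoly_coe, MvPolynomial.eval_C,
      MvPolynomial.eval_X, one_mul, metric]
  have htanh : Real.tanh (tau X) = X.1 0 * (Real.cosh (tau X))⁻¹ := by
    rw [Real.tanh_eq_sinh_div_cosh, tau, Real.sinh_arsinh]; rfl
  simp only [V, round, htanh, difSphere_zeta, dif_tau, hmet, frac, sqrt_radSq_coe]
  simp only [polyV, map_add, map_sub, map_mul, MvPolynomial.eval_C, MvPolynomial.eval_X,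
    eval_minkPoly_coe, eval_radSqPoly, radSq_coe, zeta]
  generalize Real.cosh (tau X) = C at *
  generalize (difPoly 0 a).eval X.1 = p at *
  generalize (difPoly 0 b).eval X.1 = p' at *
  field_simp
  linear_combination (2 * X.1 k.succ * p * p') * hC

lemma sum_det4_contract (u v X w : Fin 4 → ℝ) :
    ∑ c, ∑ b, u c * det4 (basisVec c) X w (basisVec b) * v b = det4 u X w v := by
  rw [det4_sum_left u]
  refine Finset.sum_congr rfl fun c _ => ?_
  rw [det4_swap34, det4_swap23, det4_swap12, neg_neg, det4_sum_left v, ← Finset.sum_neg_distrib,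
    Finset.mul_sum]
  refine Finset.sum_congr rfl fun b _ => ?_
  rw [det4_swap34, det4_swap23, det4_swap12]
  ring

lemma dualSphere_zeta (X : dS3) (k : Fin 3) (a : Fin 4) :
    dualSphere (difSphere (zeta k.succ)) X a
      = (Real.cosh (tau X))⁻¹ * (crossPoly k a).eval X.1 := by
  have h : dualSphere (difSphere (zeta k.succ)) X a
      = det4 (ptau X) X.1 (basisVec a) (fun b => sgn b * difSphere (zeta k.succ) X b) :=
    sum_det4_contract _ _ _ _
  rw [h, det4_eq]
  simp only [ptau, dif_tau, difSphere_zeta, eval_difPoly, eval_minkPoly_coe, eval_crossPoly]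
  fin_cases k <;> fin_cases a <;> simp [sgn, crossCoeff] <;> ring

lemma W_eq (k : Fin 3) (X : dS3) (a b : Fin 4) : W k X a b = frac (polyW k a b) 5 X.1 := by
  simp only [W, dualSphere_zeta, dif_tau, frac, sqrt_radSq_coe, polyW, map_add, map_mul,
    eval_minkPoly_coe]
  ring

/-! ### `V` and `W` are solutions -/

lemma radSq_smul (c : ℝ) (Y : Fin 4 → ℝ) : radSq (c • Y) = c ^ 2 * radSq Y := by
  simp only [radSq, Pi.smul_apply, smul_eq_mul]; ring

lemma frac_smul {P : MvPolynomial (Fin 4) ℝ} {n : ℕ}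
    (hP : ∀ (c : ℝ) (Y : Fin 4 → ℝ), P.eval (c • Y) = c ^ n * P.eval Y)
    {c : ℝ} (hc : 0 < c) (Y : Fin 4 → ℝ) : frac P n (c • Y) = frac P n Y := by
  rw [frac, hP, radSq_smul, Real.sqrt_mul (sq_nonneg c), Real.sqrt_sq hc.le, mul_inv, mul_pow,
    inv_pow, frac]
  have : c ^ n ≠ 0 := pow_ne_zero n hc.ne'
  field_simp

/-- A function on the hyperboloid which is `P r⁻ⁿ` with `P` homogeneous of degree `n` has `P r⁻ⁿ` as
its radial extension. -/
lemma ext_eq_frac {F : dS3 → ℝ} {P : MvPolynomial (Fin 4) ℝ} {n : ℕ}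
    (hF : ∀ X : dS3, F X = frac P n X.1)
    (hP : ∀ (c : ℝ) (Y : Fin 4 → ℝ), P.eval (c • Y) = c ^ n * P.eval Y)
    {Y : Fin 4 → ℝ} (hY : Y ∈ cone) : ext F Y = frac P n Y := by
  rw [ext, hF, radialProj_val hY, frac_smul hP (inv_pos.2 (nrm_pos hY))]

lemma polyV_smul (k : Fin 3) (a b : Fin 4) (c : ℝ) (Y : Fin 4 → ℝ) :
    (polyV k a b).eval (c • Y) = c ^ 7 * (polyV k a b).eval Y := by
  simp only [polyV, metricPoly, map_add, map_sub, map_mul, MvPolynomial.eval_C,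
    MvPolynomial.eval_X, eval_difPoly, eval_minkPoly, eval_radSqPoly, radSq_smul, Pi.smul_apply,
    smul_eq_mul]
  ring

lemma polyW_smul (k : Fin 3) (a b : Fin 4) (c : ℝ) (Y : Fin 4 → ℝ) :
    (polyW k a b).eval (c • Y) = c ^ 5 * (polyW k a b).eval Y := by
  simp only [polyW, map_add, map_mul, eval_difPoly, eval_crossPoly, eval_minkPoly, radSq_smul,
    Pi.smul_apply, smul_eq_mul]
  ring

lemma ext_V (k : Fin 3) (a b : Fin 4) {Y : Fin 4 → ℝ} (hY : Y ∈ cone) :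
    ext (fun X => V k X a b) Y = frac (polyV k a b) 7 Y :=
  ext_eq_frac (fun X => V_eq k X a b) (polyV_smul k a b) hY

lemma ext_W (k : Fin 3) (a b : Fin 4) {Y : Fin 4 → ℝ} (hY : Y ∈ cone) :
    ext (fun X => W k X a b) Y = frac (polyW k a b) 5 Y :=
  ext_eq_frac (fun X => W_eq k X a b) (polyW_smul k a b) hY

lemma smooth_of_ext_eq_frac {F : dS3 → ℝ} {P : MvPolynomial (Fin 4) ℝ} {n : ℕ}
    (hF : ∀ Y ∈ cone, ext F Y = frac P n Y) : Smooth F :=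
  smooth_iff.2 fun _ hY => contDiffAt_congr hY hF (contDiffAt_frac P n hY)

lemma dif_eq_frac {F : dS3 → ℝ} {P : MvPolynomial (Fin 4) ℝ} {n : ℕ}
    (hF : ∀ Y ∈ cone, ext F Y = frac P n Y) (X : dS3) (c : Fin 4) :
    dif F X c = (radSq X.1 * evalD c X.1 P - (if c = 0 then 0 else (n : ℝ)) * X.1 c * P.eval X.1)
      * (√(radSq X.1))⁻¹ ^ (n + 2) := by
  rw [dif_eq_pd, pd_congr (mem_cone X) hF, pd_frac _ _ _ (mem_cone X), frac, dnum]
  simp only [map_sub, map_mul, eval_radSqPoly, MvPolynomial.eval_C, MvPolynomial.eval_X, evalD]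

lemma polyV_tangent (k : Fin 3) (b : Fin 4) (Y : Fin 4 → ℝ) :
    ∑ a, Y a * (polyV k a b).eval Y = 0 := by
  simp only [polyV, metricPoly, map_add, map_sub, map_mul, MvPolynomial.eval_C,
    MvPolynomial.eval_X, eval_difPoly, eval_minkPoly, eval_radSqPoly, Fin.sum_univ_four]
  fin_cases k <;> fin_cases b <;> (simp [sgn, radSq]; ring)

lemma polyW_tangent (k : Fin 3) (b : Fin 4) (Y : Fin 4 → ℝ) :
    ∑ a, Y a * (polyW k a b).eval Y = 0 := by
  simp only [polyW, map_add, map_mul, eval_difPoly, eval_minkPoly, eval_crossPoly,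
    Fin.sum_univ_four]
  fin_cases k <;> fin_cases b <;> (simp [sgn, radSq, crossCoeff]; ring)

lemma polyV_trace (k : Fin 3) (Y : Fin 4 → ℝ) : ∑ a, sgn a * (polyV k a a).eval Y = 0 := by
  simp only [polyV, metricPoly, map_add, map_sub, map_mul, MvPolynomial.eval_C,
    MvPolynomial.eval_X, eval_difPoly, eval_minkPoly, eval_radSqPoly, Fin.sum_univ_four]
  fin_cases k <;> (simp [sgn, radSq]; ring)

lemma polyW_trace (k : Fin 3) (Y : Fin 4 → ℝ) : ∑ a, sgn a * (polyW k a a).eval Y = 0 := by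
  simp only [polyW, map_add, map_mul, eval_difPoly, eval_minkPoly, eval_crossPoly,
    Fin.sum_univ_four]
  fin_cases k <;> (simp [sgn, radSq, crossCoeff]; ring)

lemma polyV_div (k : Fin 3) (a : Fin 4) (Y : Fin 4 → ℝ) :
    ∑ b, sgn b * (radSq Y * evalD b Y (polyV k a b)
      - (if b = 0 then 0 else ((7 : ℕ) : ℝ)) * Y b * (polyV k a b).eval Y) = 0 := by
  simp only [polyV, metricPoly, evalD_add, evalD_sub, evalD_mul, evalD_C, evalD_X,
    evalD_radSqPoly, evalD_minkPoly, map_add, map_sub, map_mul, evalD_difPoly,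
    MvPolynomial.eval_C, MvPolynomial.eval_X, eval_radSqPoly, eval_minkPoly, eval_difPoly,
    mul_zero, add_zero]
  simp only [Fin.sum_univ_four]
  fin_cases k <;> fin_cases a <;> (simp [sgn, radSq]; ring)

lemma polyW_div (k : Fin 3) (a : Fin 4) (Y : Fin 4 → ℝ) :
    ∑ b, sgn b * (radSq Y * evalD b Y (polyW k a b)
      - (if b = 0 then 0 else ((5 : ℕ) : ℝ)) * Y b * (polyW k a b).eval Y) = 0 := by
  simp only [polyW, evalD_add, evalD_mul, evalD_minkPoly, map_add, map_mul, evalD_difPoly,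
    evalD_crossPoly, eval_crossPoly, eval_minkPoly, eval_difPoly]
  simp only [Fin.sum_univ_four]
  fin_cases k <;> fin_cases a <;> (simp [sgn, radSq, crossCoeff]; ring)

/-- A tensor field whose ambient components are `P_{ab} r⁻ⁿ` is a solution if the polynomials
`P_{ab}` satisfy the corresponding identities. -/
lemma isFlatSolution_of_frac {T : Field2} {P : Fin 4 → Fin 4 → MvPolynomial (Fin 4) ℝ} {n : ℕ}
    (hT : ∀ a b, ∀ Y ∈ cone, ext (fun X => T X a b) Y = frac (P a b) n Y)
    (hsymm : ∀ a b, P a b = P b a) (htan : ∀ b Y, ∑ a, Y a * (P a b).eval Y = 0)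
    (htr : ∀ Y, ∑ a, sgn a * (P a a).eval Y = 0)
    (hdiv : ∀ a Y, ∑ b, sgn b * (radSq Y * evalD b Y (P a b)
      - (if b = 0 then 0 else (n : ℝ)) * Y b * (P a b).eval Y) = 0)
    (hwave : ∀ a b Y, radSq Y * ∑ c, sgn c * evalDD c Y (P a b)
      - 2 * n * (∑ i : Fin 3, Y i.succ * evalD i.succ Y (P a b))
      + n * (n - 1) * (P a b).eval Y = 0) :
    IsFlatSolution T := by
  have hX : ∀ X a b, T X a b = frac (P a b) n X.1 := fun X a b => by
    rw [← hT a b X.1 (mem_cone X), ext_coe]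
  refine ⟨⟨fun X b => ?_, fun X a => ?_, fun a b => smooth_of_ext_eq_frac (hT a b)⟩,
    fun X a b => by rw [hX, hX, hsymm], fun X => ?_, fun X a => ?_,
    fun X a b => flatBox_frac (hT a b) (hwave a b) X⟩
  · simp only [hX, frac, ← mul_assoc, ← Finset.sum_mul, htan, zero_mul]
  · simp only [hX, hsymm a, frac, ← mul_assoc, ← Finset.sum_mul, htan, zero_mul]
  · simp only [hX, frac, ← mul_assoc, ← Finset.sum_mul, htr, zero_mul]
  · have h : ∀ b, sgn b * dif (fun Y => T Y a b) X b = _ := fun b =>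
      (congrArg (sgn b * ·) (dif_eq_frac (hT a b) X b)).trans (mul_assoc _ _ _).symm
    rw [Finset.sum_congr rfl fun b _ => h b, ← Finset.sum_mul, hdiv, zero_mul]

lemma isFlatSolution_V (k : Fin 3) : IsFlatSolution (V k) :=
  isFlatSolution_of_frac (fun a b _ hY => ext_V k a b hY) (polyV_symm k) (polyV_tangent k)
    (polyV_trace k) (polyV_div k) (polyV_wave k)

lemma isFlatSolution_W (k : Fin 3) : IsFlatSolution (W k) :=
  isFlatSolution_of_frac (fun a b _ hY => ext_W k a b hY) (polyW_symm k) (polyW_tangent k)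
    (polyW_trace k) (polyW_div k) (polyW_wave k)

/-! ### Duality of `V` and `W` -/

/-- The contraction of `vol` with a matrix, component by component; only the antisymmetric part of
the matrix contributes. -/
lemma vol_contract (X : dS3) (m : Fin 4 → Fin 4 → ℝ) (a : Fin 4) :
    ∑ c, ∑ d, vol X a c d * sgn c * sgn d * m c d =
      ![X.1 1 * (m 2 3 - m 3 2) - X.1 2 * (m 1 3 - m 3 1) + X.1 3 * (m 1 2 - m 2 1),
        -(X.1 0 * (m 2 3 - m 3 2)) - X.1 2 * (m 0 3 - m 3 0) + X.1 3 * (m 0 2 - m 2 0),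
        X.1 0 * (m 1 3 - m 3 1) + X.1 1 * (m 0 3 - m 3 0) - X.1 3 * (m 0 1 - m 1 0),
        -(X.1 0 * (m 1 2 - m 2 1)) - X.1 1 * (m 0 2 - m 2 0) + X.1 2 * (m 0 1 - m 1 0)] a := by
  have h : ∀ a c d, vol X a c d = det4 (basisVec a) X.1 (basisVec c) (basisVec d) :=
    fun _ _ _ => rfl
  simp only [h, det4_eq, Fin.sum_univ_four]
  fin_cases a <;> (simp [sgn]; ring)

lemma curl_eq_vec {T : Field2} {P : Fin 4 → Fin 4 → MvPolynomial (Fin 4) ℝ} {n : ℕ}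
    (hsol : IsFlatSolution T) (hT : ∀ a b, ∀ Y ∈ cone, ext (fun X => T X a b) Y = frac (P a b) n Y)
    (X : dS3) (a b : Fin 4) (m : Fin 4 → Fin 4 → ℝ)
    (hm : m = fun c d => radSq X.1 * evalD c X.1 (P d b)
      - (if c = 0 then 0 else (n : ℝ)) * X.1 c * (P d b).eval X.1) :
    curl T X a b =
      ![X.1 1 * (m 2 3 - m 3 2) - X.1 2 * (m 1 3 - m 3 1) + X.1 3 * (m 1 2 - m 2 1),
        -(X.1 0 * (m 2 3 - m 3 2)) - X.1 2 * (m 0 3 - m 3 0) + X.1 3 * (m 0 2 - m 2 0),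
        X.1 0 * (m 1 3 - m 3 1) + X.1 1 * (m 0 3 - m 3 0) - X.1 3 * (m 0 1 - m 1 0),
        -(X.1 0 * (m 1 2 - m 2 1)) - X.1 1 * (m 0 2 - m 2 0) + X.1 2 * (m 0 1 - m 1 0)] a
      * (√(radSq X.1))⁻¹ ^ (n + 2) := by
  rw [hsol.tensor.curl_eq hsol.symm, ← vol_contract, Finset.sum_mul]
  refine Finset.sum_congr rfl fun c _ => ?_
  rw [Finset.sum_mul]
  refine Finset.sum_congr rfl fun d _ => ?_
  rw [dif_eq_frac (hT d b), hm]
  ring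

set_option maxHeartbeats 4000000 in
lemma curl_W (k : Fin 3) : curl (W k) = V k := by
  funext X a b
  rw [curl_eq_vec (isFlatSolution_W k) (fun a b _ hY => ext_W k a b hY) X a b _ rfl, V_eq, frac]
  refine congrArg (· * (√(radSq X.1))⁻¹ ^ 7) ?_
  fin_cases a <;>
  simp only [Fin.zero_eta, Fin.mk_one, Fin.reduceFinMk, Matrix.cons_val, polyV, metricPoly, polyW,
    evalD_add, evalD_mul, evalD_minkPoly, map_add, map_sub, map_mul, evalD_difPoly,
    evalD_crossPoly, eval_crossPoly, eval_radSqPoly, eval_minkPoly, eval_difPoly,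
    MvPolynomial.eval_C, MvPolynomial.eval_X] <;>
  fin_cases k <;> fin_cases b <;> (simp [sgn, radSq, crossCoeff]; try ring)

/-! ### The curl of a harmonic one-form -/

/-- A smooth one-form `j` on the hyperboloid whose radial extension is divergence-free and harmonic
in flat space. -/
structure IsHarmonicForm (j : Fin 4 → dS3 → ℝ) : Prop where
  smooth : ∀ a, Smooth (j a)
  tangent : ∀ X, ∑ a, X.1 a * j a X = 0
  div_free : ∀ X, ∑ b, sgn b * dif (j b) X b = 0
  wave : ∀ X a, flatBox (j a) X = 0

/-- With its second ambient index fixed, a solution is a harmonic one-form. -/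
lemma IsFlatSolution.column {T : Field2} (hT : IsFlatSolution T) (b : Fin 4) :
    IsHarmonicForm (fun a X => T X a b) := by
  refine ⟨fun a => hT.tensor.smooth a b, fun X => hT.tensor.tangent_left X b, fun X => ?_,
    fun X a => hT.wave X a b⟩
  have h := hT.div_free X b
  rwa [show (fun c => sgn c * dif (fun Y => T Y b c) X c)
    = fun c => sgn c * dif (fun Y => T Y c b) X c from
    funext fun c => by rw [show (fun Y => T Y b c) = fun Y => T Y c b from
      funext fun Y => hT.symm Y b c]] at h

/-- The curl `ε_a^{cd} ∂_c j_d` of a one-form, by ambient components. -/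
def curlForm (j : Fin 4 → dS3 → ℝ) (a : Fin 4) (X : dS3) : ℝ :=
  ∑ c, ∑ d, vol X a c d * sgn c * sgn d * dif (j d) X c

lemma ext_curlForm {j : Fin 4 → dS3 → ℝ} (hj : ∀ a, Smooth (j a)) (a : Fin 4) {Y : Fin 4 → ℝ}
    (hY : Y ∈ cone) : ext (curlForm j a) Y = ∑ c, ∑ d, ∑ e,
      det4 (basisVec a) (basisVec e) (basisVec c) (basisVec d) * sgn c * sgn d *
        (Y e * pd c (ext (j d)) Y) := by
  rw [ext, curlForm]
  refine Finset.sum_congr rfl fun c _ => Finset.sum_congr rfl fun d _ => ?_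
  rw [dif_radialProj (hj d) hY]
  have h : vol (radialProj Y) a c d
      = (nrm Y)⁻¹ * ∑ e, Y e * det4 (basisVec a) (basisVec e) (basisVec c) (basisVec d) := by
    change det4 (basisVec a) (radialProj Y).1 (basisVec c) (basisVec d) = _
    rw [radialProj_val hY, det4_swap12, det4_smul_left, det4_sum_left, ← mul_neg,
      ← Finset.sum_neg_distrib]
    exact congrArg _ (Finset.sum_congr rfl fun e _ => by rw [det4_swap12 (basisVec e)]; ring)
  rw [h]
  have := nrm_pos hY
  simp only [Finset.mul_sum, Finset.sum_mul]
  refine Finset.sum_congr rfl fun e _ => ?_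
  field_simp

lemma smooth_curlForm {j : Fin 4 → dS3 → ℝ} (hj : ∀ a, Smooth (j a)) (a : Fin 4) :
    Smooth (curlForm j a) := by
  have hv : ∀ c d, Smooth fun X => vol X a c d := fun c d => by
    have h : ∀ X : dS3, vol X a c d
        = ∑ e, X.1 e * det4 (basisVec a) (basisVec e) (basisVec c) (basisVec d) := fun X => by
      change det4 (basisVec a) X.1 (basisVec c) (basisVec d) = _
      rw [det4_swap12, det4_sum_left, ← Finset.sum_neg_distrib]
      exact Finset.sum_congr rfl fun e _ => by rw [det4_swap12 (basisVec e)]; ring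
    simp only [h]
    exact Smooth.sum fun e _ => (smooth_coord e).mul (smooth_const _)
  exact Smooth.sum fun c _ => Smooth.sum fun d _ =>
    (((hv c d).mul (smooth_const _)).mul (smooth_const _)).mul (smooth_dif (hj d) c)

lemma dif_curlForm {j : Fin 4 → dS3 → ℝ} (hj : ∀ a, Smooth (j a)) (a e : Fin 4) (X : dS3) :
    dif (curlForm j a) X e = ∑ c, ∑ d, sgn c * sgn d *
      (dif (j d) X c * det4 (basisVec a) (basisVec e) (basisVec c) (basisVec d)
        + pd e (pd c (ext (j d))) X.1 * det4 (basisVec a) X.1 (basisVec c) (basisVec d)) := by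
  have hX := mem_cone X
  have hd : ∀ c d e, DifferentiableAt ℝ (fun Y : Fin 4 → ℝ => Y e * pd c (ext (j d)) Y) X.1 :=
    fun c d e => DifferentiableAt.fun_mul (by fun_prop) ((hj d).differentiableAt_pd hX c)
  have hd' : ∀ c d f, DifferentiableAt ℝ (fun Y : Fin 4 → ℝ =>
      det4 (basisVec a) (basisVec f) (basisVec c) (basisVec d) * sgn c * sgn d *
        (Y f * pd c (ext (j d)) Y)) X.1 := fun c d f => (hd c d f).const_mul _
  rw [dif_eq_pd, pd_congr hX fun Z hZ => ext_curlForm hj a hZ,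
    pd_sum _ fun c _ => DifferentiableAt.fun_sum fun d _ => DifferentiableAt.fun_sum fun f _ =>
      hd' c d f]
  refine Finset.sum_congr rfl fun c _ => ?_
  rw [pd_sum _ fun d _ => DifferentiableAt.fun_sum fun f _ => hd' c d f]
  refine Finset.sum_congr rfl fun d _ => ?_
  rw [pd_sum _ fun f _ => hd' c d f]
  have hf : ∀ f, pd e (fun Y : Fin 4 → ℝ =>
      det4 (basisVec a) (basisVec f) (basisVec c) (basisVec d) * sgn c * sgn d *
        (Y f * pd c (ext (j d)) Y)) X.1
      = sgn c * sgn d * ((if e = f then dif (j d) X c *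
          det4 (basisVec a) (basisVec f) (basisVec c) (basisVec d) else 0)
        + pd e (pd c (ext (j d))) X.1 *
          (X.1 f * det4 (basisVec a) (basisVec f) (basisVec c) (basisVec d))) := fun f => by
    rw [pd_const_mul _ (hd c d f), pd_mul (by fun_prop) ((hj d).differentiableAt_pd hX c),
      pd_coord, dif_eq_pd]
    split_ifs <;> ring
  have hs : det4 (basisVec a) X.1 (basisVec c) (basisVec d)
      = ∑ f, X.1 f * det4 (basisVec a) (basisVec f) (basisVec c) (basisVec d) := by
    rw [det4_swap12, det4_sum_left, ← Finset.sum_neg_distrib]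
    exact Finset.sum_congr rfl fun e _ => by rw [det4_swap12 (basisVec e)]; ring
  simp only [hf, ← Finset.mul_sum, Finset.sum_add_distrib, ← hs]
  simp

/-- Differentiating Euler's relation: first derivatives of a radial extension are homogeneous of
degree `-1`. -/
lemma euler_pd {F : dS3 → ℝ} (hF : Smooth F) (X : dS3) (f : Fin 4) :
    ∑ e, X.1 e * pd e (pd f (ext F)) X.1 = - dif F X f := by
  have hX := mem_cone X
  have h0 : pd f (fun Y => ∑ e, Y e * pd e (ext F) Y) X.1 = 0 := by
    rw [pd_congr hX fun Z hZ => euler_ext hF hZ, pd_const]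
  have hc : ∀ e, DifferentiableAt ℝ (fun Y : Fin 4 → ℝ => Y e) X.1 := fun e => by fun_prop
  rw [pd_sum _ fun e _ => (hc e).fun_mul (hF.differentiableAt_pd hX e)] at h0
  simp only [pd_mul (hc _) (hF.differentiableAt_pd hX _), pd_coord, Finset.sum_add_distrib,
    pd_comm (hF.contDiffAt hX) f] at h0
  simp only [ite_mul, one_mul, zero_mul, Finset.sum_ite_eq, Finset.mem_univ, if_true] at h0
  rw [dif_eq_pd]
  linarith

/-- The derivatives of the divergence of a harmonic one-form vanish. -/
lemma IsHarmonicForm.pd_div {j : Fin 4 → dS3 → ℝ} (hj : IsHarmonicForm j) (X : dS3) (f : Fin 4) :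
    ∑ g, sgn g * pd g (pd f (ext (j g))) X.1 = 0 := by
  have hX := mem_cone X
  have h : ∀ Y ∈ cone, ∑ g, sgn g * pd g (ext (j g)) Y = 0 := fun Y hY => by
    have h := hj.div_free (radialProj Y)
    simp only [dif_radialProj (hj.smooth _) hY, mul_left_comm _ (nrm Y), ← Finset.mul_sum] at h
    exact (mul_eq_zero.1 h).resolve_left (nrm_pos hY).ne'
  have h0 : pd f (fun Y => ∑ g, sgn g * pd g (ext (j g)) Y) X.1 = 0 := by
    rw [pd_congr hX h, pd_const]
  rw [pd_sum _ fun g _ => ((hj.smooth g).differentiableAt_pd hX g).const_mul _] at h0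
  simpa only [pd_const_mul _ ((hj.smooth _).differentiableAt_pd hX _),
    pd_comm ((hj.smooth _).contDiffAt hX) f] using h0

lemma sum_antisymm_det4 (u v p q : Fin 4 → ℝ) :
    ∑ e, ∑ a, (u e * v a - v e * u a) * det4 (basisVec a) (basisVec e) p q
      = -2 * det4 u v p q := by
  simp only [Fin.sum_univ_four, det4_eq, basisVec]
  simp
  ring

/-- The exterior derivative of the curl of a harmonic one-form is minus the dual of its exterior
derivative: antisymmetrizing the second derivatives of `j` over five vectors by Cramer's rule leaves
traces, which vanish by the wave equation and the divergence condition. -/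
lemma IsHarmonicForm.exterior_curlForm {j : Fin 4 → dS3 → ℝ} (hj : IsHarmonicForm j) (X : dS3)
    (u v : Fin 4 → ℝ) :
    ∑ e, ∑ a, (u e * v a - v e * u a) * dif (curlForm j a) X e
      = - ∑ f, ∑ g, sgn f * sgn g * dif (j g) X f * det4 u v (basisVec f) (basisVec g) := by
  have hX := mem_cone X
  -- the derivative of `∂_f j_g` as a linear form
  have hl : ∀ f g (w : Fin 4 → ℝ), fderiv ℝ (pd f (ext (j g))) X.1 w
      = ∑ e, w e * pd e (pd f (ext (j g))) X.1 := fun f g w => fderiv_eq_sum_pd _ _ _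
  have cr : ∀ f g, _ := fun f g => det4_cramer (fderiv ℝ (pd f (ext (j g))) X.1) u v X.1
    (basisVec f) (basisVec g)
  have eu : ∀ f g, fderiv ℝ (pd f (ext (j g))) X.1 X.1 = - dif (j g) X f := fun f g => by
    rw [hl, euler_pd (hj.smooth g)]
  have bs : ∀ f g e, fderiv ℝ (pd f (ext (j g))) X.1 (basisVec e)
      = pd e (pd f (ext (j g))) X.1 := fun f g e => rfl
  have s₁ : ∑ f, ∑ g, sgn f * sgn g * (pd f (pd f (ext (j g))) X.1
      * det4 u v X.1 (basisVec g)) = 0 := by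
    rw [Finset.sum_comm]
    refine Finset.sum_eq_zero fun g _ => ?_
    rw [← zero_mul (sgn g * det4 u v X.1 (basisVec g)), ← hj.wave X g, flatBox, Finset.sum_mul]
    exact Finset.sum_congr rfl fun f _ => by ring
  have s₂ : ∑ f, ∑ g, sgn f * sgn g * (pd g (pd f (ext (j g))) X.1
      * det4 u v X.1 (basisVec f)) = 0 := by
    refine Finset.sum_eq_zero fun f _ => ?_
    rw [← zero_mul (sgn f * det4 u v X.1 (basisVec f)), ← hj.pd_div X f, Finset.sum_mul]
    exact Finset.sum_congr rfl fun g _ => by ring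
  have lhs : ∑ e, ∑ a, (u e * v a - v e * u a) * dif (curlForm j a) X e
      = ∑ f, ∑ g, sgn f * sgn g * (fderiv ℝ (pd f (ext (j g))) X.1 u
          * det4 v X.1 (basisVec f) (basisVec g)
        - fderiv ℝ (pd f (ext (j g))) X.1 v * det4 u X.1 (basisVec f) (basisVec g)
        - 2 * (dif (j g) X f * det4 u v (basisVec f) (basisVec g))) := by
    simp only [dif_curlForm hj.smooth, Finset.mul_sum]
    have swap : ∀ m : Fin 4 → Fin 4 → Fin 4 → Fin 4 → ℝ,
        ∑ e, ∑ a, ∑ f, ∑ g, m e a f g = ∑ f, ∑ g, ∑ e, ∑ a, m e a f g := fun m => by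
      simp only [Fin.sum_univ_four]; ring
    rw [swap]
    refine Finset.sum_congr rfl fun f _ => Finset.sum_congr rfl fun g _ => ?_
    rw [hl, hl, det4_sum_left v X.1, det4_sum_left u X.1]
    have h2 := sum_antisymm_det4 u v (basisVec f) (basisVec g)
    generalize det4 u v (basisVec f) (basisVec g) = d at h2 ⊢
    have split : ∀ (D : Fin 4 → Fin 4 → ℝ) (Z P : Fin 4 → ℝ) (s J : ℝ),
        ∑ e, ∑ a, (u e * v a - v e * u a) * D a e = -2 * d →
        ∑ e, ∑ a, (u e * v a - v e * u a) * (s * (J * D a e + P e * Z a))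
          = s * ((∑ e, u e * P e) * (∑ a, v a * Z a) - (∑ e, v e * P e) * (∑ a, u a * Z a)
            - 2 * (J * d)) := fun D Z P s J hD => by
      simp only [Fin.sum_univ_four] at hD ⊢
      linear_combination s * J * hD
    exact split _ _ _ _ _ h2
  rw [lhs, ← Finset.sum_neg_distrib]
  have key : ∀ f g, sgn f * sgn g * (fderiv ℝ (pd f (ext (j g))) X.1 u
          * det4 v X.1 (basisVec f) (basisVec g)
        - fderiv ℝ (pd f (ext (j g))) X.1 v * det4 u X.1 (basisVec f) (basisVec g)
        - 2 * (dif (j g) X f * det4 u v (basisVec f) (basisVec g)))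
      = sgn f * sgn g * (pd f (pd f (ext (j g))) X.1 * det4 u v X.1 (basisVec g))
        - sgn f * sgn g * (pd g (pd f (ext (j g))) X.1 * det4 u v X.1 (basisVec f))
        - sgn f * sgn g * dif (j g) X f * det4 u v (basisVec f) (basisVec g) := fun f g => by
    have := cr f g
    rw [eu, bs, bs] at this
    linear_combination sgn f * sgn g * this
  simp only [key, Finset.sum_sub_distrib, s₁, s₂, Finset.sum_neg_distrib]
  ring

/-- The dual of the exterior derivative of `j`, corrected by normal terms, is the flux form of
`j`. -/
lemma sum_sgn_det4_tangent {j : Fin 4 → dS3 → ℝ} (hj : IsHarmonicForm j) (X : dS3)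
    (u v : Fin 4 → ℝ) :
    ∑ f, ∑ g, sgn f * sgn g * dif (j g) X f * (mink X.1 u * det4 v X.1 (basisVec f) (basisVec g)
        - mink X.1 v * det4 u X.1 (basisVec f) (basisVec g)
        + det4 u v (basisVec f) (basisVec g))
      = det4 u v X.1 (fun f => sgn f * j f X) := by
  have cr : ∀ f g, _ := fun f g => det4_cramer (minkL X.1) u v X.1 (basisVec f) (basisVec g)
  simp only [minkL_apply, mink_basisVec, mink_self] at cr
  have key : ∀ f g, sgn f * sgn g * dif (j g) X f *
        (mink X.1 u * det4 v X.1 (basisVec f) (basisVec g)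
        - mink X.1 v * det4 u X.1 (basisVec f) (basisVec g)
        + det4 u v (basisVec f) (basisVec g))
      = sgn g * det4 u v X.1 (basisVec g) * (X.1 f * dif (j g) X f)
        - sgn f * det4 u v X.1 (basisVec f) * (X.1 g * dif (j g) X f) := fun f g => by
    linear_combination sgn f * sgn g * dif (j g) X f * cr f g
      + sgn g * dif (j g) X f * X.1 f * det4 u v X.1 (basisVec g) * sgn_mul_sgn f
      - sgn f * dif (j g) X f * X.1 g * det4 u v X.1 (basisVec f) * sgn_mul_sgn g
  have s₁ : ∑ f, ∑ g, sgn g * det4 u v X.1 (basisVec g) * (X.1 f * dif (j g) X f) = 0 := by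
    rw [Finset.sum_comm]
    refine Finset.sum_eq_zero fun g _ => ?_
    rw [← Finset.mul_sum, euler_dif (hj.smooth g), mul_zero]
  simp only [key, Finset.sum_sub_distrib, s₁]
  simp only [← Finset.mul_sum, sum_coord_mul_dif hj.smooth hj.tangent]
  rw [det4_swap34, det4_swap23, det4_swap12, det4_sum_left, zero_sub, neg_neg]
  congr 1
  refine Finset.sum_congr rfl fun f _ => ?_
  rw [det4_swap34, det4_swap23, det4_swap12]
  ring

/-- On tangent vectors the exterior derivative of the curl of a harmonic one-form `j` is the flux
form of `j`; hence the flux of `j` is exact. -/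
lemma IsHarmonicForm.exterior_curlForm_tangent {j : Fin 4 → dS3 → ℝ} (hj : IsHarmonicForm j)
    (X : dS3) {u v : Fin 4 → ℝ} (hu : mink X.1 u = 0) (hv : mink X.1 v = 0) :
    ∑ e, ∑ a, (u e * v a - v e * u a) * dif (curlForm j a) X e
      = - det4 u v X.1 (fun f => sgn f * j f X) := by
  rw [hj.exterior_curlForm, ← sum_sgn_det4_tangent hj]
  simp only [hu, hv, zero_mul, sub_self, zero_add]

/-- The contraction of two volume forms over two indices. -/
lemma det4_contract (p q w z : Fin 4 → ℝ) :
    ∑ c, ∑ d, sgn c * sgn d * (det4 p q (basisVec c) (basisVec d)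
        * det4 (basisVec c) (basisVec d) w z)
      = -2 * (mink p w * mink q z - mink p z * mink q w) := by
  simp only [Fin.sum_univ_four, det4_eq, basisVec, mink_eq, sgn]
  simp
  ring

/-- The curl of the curl of a harmonic one-form `j` is `-j`. -/
lemma IsHarmonicForm.curlForm_curlForm {j : Fin 4 → dS3 → ℝ} (hj : IsHarmonicForm j) (a : Fin 4)
    (X : dS3) : curlForm (curlForm j) a X = - j a X := by
  have hv : ∀ c d, vol X a c d = det4 (basisVec a) X.1 (basisVec c) (basisVec d) :=
    fun _ _ => rfl
  -- only the antisymmetric part of the derivative contributes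
  have h1 : 2 * curlForm (curlForm j) a X
      = ∑ c, ∑ d, sgn c * sgn d * det4 (basisVec a) X.1 (basisVec c) (basisVec d) *
        (dif (curlForm j d) X c - dif (curlForm j c) X d) := by
    have h2 : curlForm (curlForm j) a X
        = - ∑ c, ∑ d, sgn c * sgn d * det4 (basisVec a) X.1 (basisVec c) (basisVec d) *
        dif (curlForm j c) X d := by
      rw [Finset.sum_comm, ← Finset.sum_neg_distrib]
      refine Finset.sum_congr rfl fun c _ => ?_
      rw [← Finset.sum_neg_distrib]
      refine Finset.sum_congr rfl fun d _ => ?_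
      rw [hv, det4_swap34]; ring
    simp only [mul_sub, Finset.sum_sub_distrib]
    rw [two_mul]
    nth_rewrite 2 [h2]
    rw [sub_eq_add_neg]
    congr 1
    exact Finset.sum_congr rfl fun c _ => Finset.sum_congr rfl fun d _ => by rw [hv]; ring
  have h2 : ∀ c d, dif (curlForm j d) X c - dif (curlForm j c) X d
      = - ∑ f, ∑ g, sgn f * sgn g * dif (j g) X f
          * det4 (basisVec c) (basisVec d) (basisVec f) (basisVec g) := fun c d => by
    rw [← hj.exterior_curlForm]
    simp [Pi.single_apply, sub_mul, Finset.sum_sub_distrib]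
  have swap : ∀ m : Fin 4 → Fin 4 → Fin 4 → Fin 4 → ℝ,
      ∑ e, ∑ a, ∑ f, ∑ g, m e a f g = ∑ f, ∑ g, ∑ e, ∑ a, m e a f g := fun m => by
    simp only [Fin.sum_univ_four]; ring
  have h3 : 2 * curlForm (curlForm j) a X = ∑ f, ∑ g, sgn f * sgn g * dif (j g) X f *
      (2 * (mink (basisVec a) (basisVec f) * mink X.1 (basisVec g)
        - mink (basisVec a) (basisVec g) * mink X.1 (basisVec f))) := by
    rw [h1]
    simp only [h2, mul_neg, Finset.mul_sum, ← Finset.sum_neg_distrib]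
    rw [swap]
    refine Finset.sum_congr rfl fun f _ => Finset.sum_congr rfl fun g _ => ?_
    have := det4_contract (basisVec a) X.1 (basisVec f) (basisVec g)
    rw [show ∀ x : ℝ, 2 * x = -(-2 * x) from fun x => by ring, ← this]
    simp only [mul_neg, Finset.mul_sum, ← Finset.sum_neg_distrib]
    exact Finset.sum_congr rfl fun c _ => Finset.sum_congr rfl fun d _ => by ring
  have h4 : ∀ f g, sgn f * sgn g * dif (j g) X f *
      (2 * (mink (basisVec a) (basisVec f) * mink X.1 (basisVec g)
        - mink (basisVec a) (basisVec g) * mink X.1 (basisVec f)))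
      = 2 * ((if f = a then 1 else 0) * (X.1 g * dif (j g) X f))
        - 2 * ((if g = a then 1 else 0) * (X.1 f * dif (j g) X f)) := fun f g => by
    simp only [mink_basisVec, Pi.single_apply]
    have h : sgn f * sgn g * (sgn f * sgn g) = 1 := by
      rw [mul_mul_mul_comm, sgn_mul_sgn, sgn_mul_sgn, one_mul]
    linear_combination (dif (j g) X f * 2 * ((if f = a then 1 else 0) * X.1 g
      - (if g = a then 1 else 0) * X.1 f)) * h
  have h5 : ∀ g, ∑ f, 2 * ((if g = a then (1 : ℝ) else 0) * (X.1 f * dif (j g) X f)) = 0 :=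
    fun g => by simp only [← Finset.mul_sum, euler_dif (hj.smooth g), mul_zero]
  have h6 : ∑ f, ∑ g, 2 * ((if g = a then (1 : ℝ) else 0) * (X.1 f * dif (j g) X f)) = 0 := by
    rw [Finset.sum_comm]
    exact Finset.sum_eq_zero fun g _ => h5 g
  simp only [h4, Finset.sum_sub_distrib, h6] at h3
  simp only [← Finset.mul_sum, sum_coord_mul_dif hj.smooth hj.tangent] at h3
  simp at h3
  linarith

/-- On solutions, applying the curl twice gives minus the tensor. -/
lemma IsFlatSolution.curl_curl {T : Field2} (hT : IsFlatSolution T)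
    (hcurl : IsFlatSolution (curl T)) : curl (curl T) = - T := by
  funext X a b
  rw [hcurl.tensor.curl_eq hcurl.symm]
  have h : ∀ d, (fun Y => curl T Y d b) = curlForm (fun a X => T X a b) d := fun d =>
    funext fun Y => hT.tensor.curl_eq hT.symm Y d b
  simp only [h]
  exact (hT.column b).curlForm_curlForm a X

/-- A consequence of `curl_W`, the curl of the curl being `-1` on solutions. -/
lemma curl_V (k : Fin 3) : curl (V k) = - W k := by
  rw [← curl_W k]
  exact (isFlatSolution_W k).curl_curl (by rw [curl_W]; exact isFlatSolution_V k)

/-! ### Stokes' theorem for the angular rectangle -/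

lemma swap_of_continuous {F : ℝ → ℝ → ℝ} (hF : Continuous F.uncurry) (a b c d : ℝ) :
    ∫ x in a..b, ∫ y in c..d, F x y = ∫ y in c..d, ∫ x in a..b, F x y := by
  refine MeasureTheory.intervalIntegral_intervalIntegral_swap ?_
  have : MeasureTheory.IntegrableOn F.uncurry (Set.uIcc a b ×ˢ Set.uIcc c d) :=
    hF.continuousOn.integrableOn_compact (isCompact_uIcc.prod isCompact_uIcc)
  exact this.mono_set (Set.prod_mono Set.uIoc_subset_uIcc Set.uIoc_subset_uIcc)

lemma hasDerivAt_fst {f : ℝ × ℝ × ℝ → ℝ} (hf : Differentiable ℝ f) (t θ φ : ℝ) :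
    HasDerivAt (fun s => f (s, θ, φ)) (fderiv ℝ f (t, θ, φ) (1, 0, 0)) t := by
  have h : HasDerivAt (fun s : ℝ => (s, θ, φ)) ((1 : ℝ), (0 : ℝ), (0 : ℝ)) t :=
    (hasDerivAt_id t).prodMk ((hasDerivAt_const t θ).prodMk (hasDerivAt_const t φ))
  exact (hf (t, θ, φ)).hasFDerivAt.comp_hasDerivAt t h

lemma hasDerivAt_snd {E : Type*} [NormedAddCommGroup E] [NormedSpace ℝ E] {f : ℝ × ℝ × ℝ → E}
    (hf : Differentiable ℝ f) (t θ φ : ℝ) :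
    HasDerivAt (fun s => f (t, s, φ)) (fderiv ℝ f (t, θ, φ) (0, 1, 0)) θ := by
  have h : HasDerivAt (fun s : ℝ => (t, s, φ)) ((0 : ℝ), (1 : ℝ), (0 : ℝ)) θ :=
    (hasDerivAt_const θ t).prodMk ((hasDerivAt_id θ).prodMk (hasDerivAt_const θ φ))
  exact (hf (t, θ, φ)).hasFDerivAt.comp_hasDerivAt θ h

lemma hasDerivAt_trd {E : Type*} [NormedAddCommGroup E] [NormedSpace ℝ E] {f : ℝ × ℝ × ℝ → E}
    (hf : Differentiable ℝ f) (t θ φ : ℝ) :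
    HasDerivAt (fun s => f (t, θ, s)) (fderiv ℝ f (t, θ, φ) (0, 0, 1)) φ := by
  have h : HasDerivAt (fun s : ℝ => (t, θ, s)) ((0 : ℝ), (0 : ℝ), (1 : ℝ)) φ :=
    (hasDerivAt_const φ t).prodMk ((hasDerivAt_const φ θ).prodMk (hasDerivAt_id φ))
  exact (hf (t, θ, φ)).hasFDerivAt.comp_hasDerivAt φ h

lemma continuous_fderiv_apply {f : ℝ × ℝ × ℝ → ℝ} (hf : ContDiff ℝ ∞ f) (e : ℝ × ℝ × ℝ) :
    Continuous fun p => fderiv ℝ f p e :=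
  (hf.continuous_fderiv (by simp)).clm_apply continuous_const

/-- The iterated integral `∫₀^π ∫₀^{2π} F(θ, φ) dφ dθ`. -/
def sphereInt (F : ℝ → ℝ → ℝ) : ℝ :=
  ∫ θ in (0 : ℝ)..Real.pi, ∫ φ in (0 : ℝ)..(2 * Real.pi), F θ φ

lemma sphereInt_congr {F G : ℝ → ℝ → ℝ}
    (h : ∀ θ ∈ Set.Icc 0 Real.pi, ∀ φ, F θ φ = G θ φ) : sphereInt F = sphereInt G := by
  refine intervalIntegral.integral_congr fun θ hθ => ?_
  rw [Set.uIcc_of_le Real.pi_pos.le] at hθ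
  exact intervalIntegral.integral_congr fun φ _ => h θ hθ φ

lemma sphereInt_add {F G : ℝ → ℝ → ℝ} (hF : Continuous F.uncurry) (hG : Continuous G.uncurry) :
    sphereInt (fun θ φ => F θ φ + G θ φ) = sphereInt F + sphereInt G := by
  have h1 : ∀ θ, ∫ φ in (0 : ℝ)..(2 * Real.pi), F θ φ + G θ φ
      = (∫ φ in (0 : ℝ)..(2 * Real.pi), F θ φ) + ∫ φ in (0 : ℝ)..(2 * Real.pi), G θ φ := fun θ =>
    intervalIntegral.integral_add
      ((hF.comp (Continuous.prodMk_right θ)).intervalIntegrable _ _)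
      ((hG.comp (Continuous.prodMk_right θ)).intervalIntegrable _ _)
  simp only [sphereInt, h1]
  exact intervalIntegral.integral_add
    ((intervalIntegral.continuous_parametric_intervalIntegral_of_continuous'
      hF _ _).intervalIntegrable _ _)
    ((intervalIntegral.continuous_parametric_intervalIntegral_of_continuous'
      hG _ _).intervalIntegrable _ _)

lemma sphereInt_const_mul (k : ℝ) (F : ℝ → ℝ → ℝ) :
    sphereInt (fun θ φ => k * F θ φ) = k * sphereInt F := by
  simp only [sphereInt, intervalIntegral.integral_const_mul]

/-- The integral over the sphere of the exact two-form `(∂_θ a + ∂_φ b) dθ dφ` vanishes, if `a`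
vanishes at the poles and `b` is periodic. -/
lemma sphereInt_exact {a b : ℝ × ℝ × ℝ → ℝ} (ha : ContDiff ℝ ∞ a) (hb : ContDiff ℝ ∞ b) (t : ℝ)
    (h0 : ∀ φ, a (t, 0, φ) = 0) (hπ : ∀ φ, a (t, Real.pi, φ) = 0)
    (hper : ∀ θ, b (t, θ, 2 * Real.pi) = b (t, θ, 0)) :
    sphereInt (fun θ φ => fderiv ℝ a (t, θ, φ) (0, 1, 0) + fderiv ℝ b (t, θ, φ) (0, 0, 1)) = 0 := by
  have ca : Continuous (fun q : ℝ × ℝ => fderiv ℝ a (t, q.1, q.2) (0, 1, 0)) :=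
    (continuous_fderiv_apply ha _).comp (by fun_prop)
  have cb : Continuous (fun q : ℝ × ℝ => fderiv ℝ b (t, q.1, q.2) (0, 0, 1)) :=
    (continuous_fderiv_apply hb _).comp (by fun_prop)
  rw [sphereInt_add (F := fun θ φ => fderiv ℝ a (t, θ, φ) (0, 1, 0))
    (G := fun θ φ => fderiv ℝ b (t, θ, φ) (0, 0, 1)) ca cb]
  have h1 : sphereInt (fun θ φ => fderiv ℝ a (t, θ, φ) (0, 1, 0)) = 0 := by
    rw [sphereInt, swap_of_continuous (F := fun θ φ => fderiv ℝ a (t, θ, φ) (0, 1, 0)) ca]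
    have : ∀ φ, ∫ θ in (0 : ℝ)..Real.pi, fderiv ℝ a (t, θ, φ) (0, 1, 0) = 0 := fun φ => by
      rw [intervalIntegral.integral_eq_sub_of_hasDerivAt
        (fun θ _ => hasDerivAt_snd (ha.differentiable (by simp)) t θ φ)
        ((ca.comp (Continuous.prodMk_left φ)).intervalIntegrable _ _), h0, hπ, sub_zero]
    simp [this]
  have h2 : sphereInt (fun θ φ => fderiv ℝ b (t, θ, φ) (0, 0, 1)) = 0 := by
    rw [sphereInt]
    have : ∀ θ, ∫ φ in (0 : ℝ)..(2 * Real.pi), fderiv ℝ b (t, θ, φ) (0, 0, 1) = 0 := fun θ => by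
      rw [intervalIntegral.integral_eq_sub_of_hasDerivAt
        (fun φ _ => hasDerivAt_trd (hb.differentiable (by simp)) t θ φ)
        ((cb.comp (Continuous.prodMk_right θ)).intervalIntegrable _ _), hper, sub_self]
    simp [this]
  rw [h1, h2, add_zero]

/-- The integrals over the sphere of a closed two-form on `[0,1] × S²` at the two ends agree;
`g`, `a` and `b` are its components along `dθ dφ`, `dφ dt` and `dt dθ`. -/
lemma sphereInt_homotopy {g a b : ℝ × ℝ × ℝ → ℝ} (hg : ContDiff ℝ ∞ g) (ha : ContDiff ℝ ∞ a)
    (hb : ContDiff ℝ ∞ b) (h0 : ∀ t φ, a (t, 0, φ) = 0) (hπ : ∀ t φ, a (t, Real.pi, φ) = 0)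
    (hper : ∀ t θ, b (t, θ, 2 * Real.pi) = b (t, θ, 0))
    (hclosed : ∀ p, fderiv ℝ g p (1, 0, 0) + fderiv ℝ a p (0, 1, 0) + fderiv ℝ b p (0, 0, 1) = 0) :
    sphereInt (fun θ φ => g (1, θ, φ)) = sphereInt (fun θ φ => g (0, θ, φ)) := by
  have cg : Continuous fun p : ℝ × ℝ × ℝ => fderiv ℝ g p (1, 0, 0) :=
    continuous_fderiv_apply hg _
  have h1 : ∀ θ φ, g (1, θ, φ) = g (0, θ, φ)
      + ∫ t in (0 : ℝ)..1, fderiv ℝ g (t, θ, φ) (1, 0, 0) := fun θ φ => by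
    rw [intervalIntegral.integral_eq_sub_of_hasDerivAt
      (fun t _ => hasDerivAt_fst (hg.differentiable (by simp)) t θ φ)
      ((cg.comp (by fun_prop : Continuous fun t : ℝ => (t, θ, φ))).intervalIntegrable _ _)]
    ring
  have c3 : Continuous fun q : (ℝ × ℝ) × ℝ => fderiv ℝ g (q.2, q.1.1, q.1.2) (1, 0, 0) :=
    cg.comp (by fun_prop)
  have c1 : Continuous fun q : ℝ × ℝ => ∫ t in (0 : ℝ)..1, fderiv ℝ g (t, q.1, q.2) (1, 0, 0) :=
    intervalIntegral.continuous_parametric_intervalIntegral_of_continuous'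
      (f := fun (q : ℝ × ℝ) (t : ℝ) => fderiv ℝ g (t, q.1, q.2) (1, 0, 0)) c3 0 1
  simp only [h1]
  rw [sphereInt_add (F := fun θ φ => g (0, θ, φ))
    (G := fun θ φ => ∫ t in (0 : ℝ)..1, fderiv ℝ g (t, θ, φ) (1, 0, 0))
    (hg.continuous.comp (by fun_prop : Continuous fun q : ℝ × ℝ => ((0 : ℝ), q.1, q.2))) c1]
  have h2 : sphereInt (fun θ φ => ∫ t in (0 : ℝ)..1, fderiv ℝ g (t, θ, φ) (1, 0, 0))
      = ∫ t in (0 : ℝ)..1, sphereInt fun θ φ => fderiv ℝ g (t, θ, φ) (1, 0, 0) := by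
    have i1 : ∀ θ, ∫ φ in (0 : ℝ)..(2 * Real.pi), ∫ t in (0 : ℝ)..1,
        fderiv ℝ g (t, θ, φ) (1, 0, 0)
        = ∫ t in (0 : ℝ)..1, ∫ φ in (0 : ℝ)..(2 * Real.pi),
          fderiv ℝ g (t, θ, φ) (1, 0, 0) := fun θ =>
      swap_of_continuous (F := fun φ t => fderiv ℝ g (t, θ, φ) (1, 0, 0))
        (cg.comp (by fun_prop : Continuous fun q : ℝ × ℝ => (q.2, θ, q.1))) _ _ _ _
    simp only [sphereInt, i1]
    refine swap_of_continuous (F := fun θ t => ∫ φ in (0 : ℝ)..(2 * Real.pi),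
      fderiv ℝ g (t, θ, φ) (1, 0, 0)) ?_ _ _ _ _
    exact intervalIntegral.continuous_parametric_intervalIntegral_of_continuous'
      (f := fun (q : ℝ × ℝ) (φ : ℝ) => fderiv ℝ g (q.2, q.1, φ) (1, 0, 0))
      (cg.comp (by fun_prop : Continuous fun q : (ℝ × ℝ) × ℝ => (q.1.2, q.1.1, q.2))) _ _
  have h3 : ∀ t, sphereInt (fun θ φ => fderiv ℝ g (t, θ, φ) (1, 0, 0)) = 0 := fun t => by
    have e : (fun θ φ => fderiv ℝ g (t, θ, φ) (1, 0, 0)) = fun θ φ => (-1 : ℝ) *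
        (fderiv ℝ a (t, θ, φ) (0, 1, 0) + fderiv ℝ b (t, θ, φ) (0, 0, 1)) := by
      funext θ φ
      linarith [hclosed (t, θ, φ)]
    rw [e, sphereInt_const_mul, sphereInt_exact ha hb t (h0 t) (hπ t) (hper t), mul_zero]
  rw [h2]
  simp [h3]

/-! ### The flux two-form of a vector field and its pull-back to a family of graphs -/

lemma hasDerivAt_det4 {A B C D : ℝ → Fin 4 → ℝ} {A' B' C' D' : Fin 4 → ℝ} {s : ℝ}
    (hA : HasDerivAt A A' s) (hB : HasDerivAt B B' s) (hC : HasDerivAt C C' s)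
    (hD : HasDerivAt D D' s) :
    HasDerivAt (fun r => det4 (A r) (B r) (C r) (D r))
      (det4 A' (B s) (C s) (D s) + det4 (A s) B' (C s) (D s) + det4 (A s) (B s) C' (D s)
        + det4 (A s) (B s) (C s) D') s := by
  have hA := hasDerivAt_pi.1 hA
  have hB := hasDerivAt_pi.1 hB
  have hC := hasDerivAt_pi.1 hC
  have hD := hasDerivAt_pi.1 hD
  have m : ∀ i j, HasDerivAt (fun r => C r i * D r j - C r j * D r i) _ s := fun i j =>
    ((hC i).fun_mul (hD j)).fun_sub ((hC j).fun_mul (hD i))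
  have n : ∀ i j k, HasDerivAt (fun r => B r i * (C r j * D r k - C r k * D r j)
      - B r j * (C r i * D r k - C r k * D r i) + B r k * (C r i * D r j - C r j * D r i)) _ s :=
    fun i j k => (((hB i).fun_mul (m j k)).fun_sub ((hB j).fun_mul (m i k))).fun_add
      ((hB k).fun_mul (m i j))
  simp only [det4_eq]
  refine (((((hA 0).fun_mul (n 1 2 3)).fun_sub ((hA 1).fun_mul (n 0 2 3))).fun_add
    ((hA 2).fun_mul (n 0 1 3))).fun_sub ((hA 3).fun_mul (n 0 1 2))).congr_deriv ?_
  ring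

lemma fderiv_det4 {E : Type*} [NormedAddCommGroup E] [NormedSpace ℝ E]
    {A B C D : E → Fin 4 → ℝ} (hA : Differentiable ℝ A) (hB : Differentiable ℝ B)
    (hC : Differentiable ℝ C) (hD : Differentiable ℝ D)
    (hd : Differentiable ℝ fun q => det4 (A q) (B q) (C q) (D q)) (p e : E) :
    fderiv ℝ (fun q => det4 (A q) (B q) (C q) (D q)) p e
      = det4 (fderiv ℝ A p e) (B p) (C p) (D p) + det4 (A p) (fderiv ℝ B p e) (C p) (D p)
        + det4 (A p) (B p) (fderiv ℝ C p e) (D p) + det4 (A p) (B p) (C p) (fderiv ℝ D p e) := by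
  have hl : HasDerivAt (fun s : ℝ => p + s • e) e 0 := by
    simpa using ((hasDerivAt_id (0 : ℝ)).smul_const e).const_add p
  have line : ∀ {F : Type} [NormedAddCommGroup F] [NormedSpace ℝ F] {f : E → F},
      Differentiable ℝ f → HasDerivAt (fun s : ℝ => f (p + s • e)) (fderiv ℝ f p e) 0 := by
    intro F _ _ f hf
    have h : HasFDerivAt f (fderiv ℝ f p) (p + (0 : ℝ) • e) := by
      simpa using (hf p).hasFDerivAt
    exact h.comp_hasDerivAt (0 : ℝ) hl
  have h := hasDerivAt_det4 (line hA) (line hB) (line hC) (line hD)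
  simp only [zero_smul, add_zero] at h
  exact (line hd).unique h

lemma contDiff_det4 {E : Type*} [NormedAddCommGroup E] [NormedSpace ℝ E]
    {A B C D : E → Fin 4 → ℝ} (hA : ContDiff ℝ ∞ A) (hB : ContDiff ℝ ∞ B)
    (hC : ContDiff ℝ ∞ C) (hD : ContDiff ℝ ∞ D) :
    ContDiff ℝ ∞ fun q => det4 (A q) (B q) (C q) (D q) := by
  have hA := contDiff_pi.1 hA
  have hB := contDiff_pi.1 hB
  have hC := contDiff_pi.1 hC
  have hD := contDiff_pi.1 hD
  simp only [det4_eq]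
  fun_prop

section Graph

/-- The point of the unit sphere with angles `θ`, `φ`. -/
def sphereDir (θ φ : ℝ) : Fin 3 → ℝ :=
  ![Real.cos θ, Real.sin θ * Real.cos φ, Real.sin θ * Real.sin φ]

/-- The homotopy `t ↦ {τ = t s(ω)}` from the graph of `0` to that of `s`, in the parameters
`(t, θ, φ)`.  The graphs need not be spacelike. -/
def graph (s : (Fin 3 → ℝ) → ℝ) (p : ℝ × ℝ × ℝ) : dS3 :=
  point (p.1 * s (sphereDir p.2.1 p.2.2)) p.2.1 p.2.2

/-- The homotopy of graphs as a map to `ℝ⁴`. -/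
def graphVec (s : (Fin 3 → ℝ) → ℝ) (p : ℝ × ℝ × ℝ) : Fin 4 → ℝ := (graph s p).1

/-- The derivative of the homotopy of graphs in a direction of the parameter space. -/
def graphTan (s : (Fin 3 → ℝ) → ℝ) (e p : ℝ × ℝ × ℝ) : Fin 4 → ℝ := fderiv ℝ (graphVec s) p e

variable {s : (Fin 3 → ℝ) → ℝ}

lemma contDiff_graphVec (hs : ContDiff ℝ ∞ s) : ContDiff ℝ ∞ (graphVec s) := by
  have hd : ContDiff ℝ ∞ fun p : ℝ × ℝ × ℝ => sphereDir p.2.1 p.2.2 := by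
    refine contDiff_pi.2 fun i => ?_
    fin_cases i <;> simp [sphereDir] <;> fun_prop
  have ht : ContDiff ℝ ∞ fun p : ℝ × ℝ × ℝ => p.1 * s (sphereDir p.2.1 p.2.2) :=
    contDiff_fst.mul (hs.comp hd)
  refine contDiff_pi.2 fun i => ?_
  fin_cases i <;> simp [graphVec, graph, point] <;> fun_prop

lemma differentiable_graphVec (hs : ContDiff ℝ ∞ s) : Differentiable ℝ (graphVec s) :=
  (contDiff_graphVec hs).differentiable (by simp)

lemma contDiff_graphTan (hs : ContDiff ℝ ∞ s) (e : ℝ × ℝ × ℝ) : ContDiff ℝ ∞ (graphTan s e) :=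
  ((contDiff_graphVec hs).fderiv_right (m := ∞) (by simp)).clm_apply contDiff_const

lemma differentiable_graphTan (hs : ContDiff ℝ ∞ s) (e : ℝ × ℝ × ℝ) :
    Differentiable ℝ (graphTan s e) :=
  (contDiff_graphTan hs e).differentiable (by simp)

lemma fderiv_graphTan_comm (hs : ContDiff ℝ ∞ s) (p e e' : ℝ × ℝ × ℝ) :
    fderiv ℝ (graphTan s e) p e' = fderiv ℝ (graphTan s e') p e := by
  have hsymm := (contDiff_graphVec hs).contDiffAt.isSymmSndFDerivAt (x := p)
    (by simpa using WithTop.coe_le_coe.2 (le_top : (2 : ℕ∞) ≤ ⊤))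
  have hd : DifferentiableAt ℝ (fderiv ℝ (graphVec s)) p :=
    ((contDiff_graphVec hs).fderiv_right (m := ∞) (by simp)).differentiable (by simp) p
  have key : ∀ u v, fderiv ℝ (fun q => fderiv ℝ (graphVec s) q u) p v
      = fderiv ℝ (fderiv ℝ (graphVec s)) p v u := fun u v => by
    rw [fderiv_clm_apply hd (differentiableAt_const u)]
    simp
  change fderiv ℝ (fun q => fderiv ℝ (graphVec s) q e) p e'
    = fderiv ℝ (fun q => fderiv ℝ (graphVec s) q e') p e
  rw [key, key]
  exact hsymm _ _

lemma mink_graphTan (hs : ContDiff ℝ ∞ s) (e p : ℝ × ℝ × ℝ) :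
    mink (graphVec s p) (graphTan s e p) = 0 := by
  have hl : HasDerivAt (fun r : ℝ => p + r • e) e 0 := by
    simpa using ((hasDerivAt_id (0 : ℝ)).smul_const e).const_add p
  have h : HasFDerivAt (graphVec s) (fderiv ℝ (graphVec s) p) (p + (0 : ℝ) • e) := by
    simpa using (differentiable_graphVec hs p).hasFDerivAt
  have h1 := hasDerivAt_pi.1 (h.comp_hasDerivAt (0 : ℝ) hl)
  have h2 : HasDerivAt (fun r : ℝ => mink (graphVec s (p + r • e)) (graphVec s (p + r • e)))
      (2 * mink (graphVec s p) (graphTan s e p)) 0 := by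
    simp only [mink_eq]
    refine ((((((h1 0).fun_mul (h1 0)).fun_neg).fun_add ((h1 1).fun_mul (h1 1))).fun_add
      ((h1 2).fun_mul (h1 2))).fun_add ((h1 3).fun_mul (h1 3))).congr_deriv ?_
    simp [graphTan]
    ring
  have h3 : (fun r : ℝ => mink (graphVec s (p + r • e)) (graphVec s (p + r • e)))
      = fun _ => 1 := funext fun r => mink_self _
  rw [h3] at h2
  linarith [h2.unique (hasDerivAt_const (0 : ℝ) (1 : ℝ))]

/-- The coordinate vector `∂_φ` vanishes at the poles of the sphere. -/
lemma graphTan_pole (hs : ContDiff ℝ ∞ s) {θ : ℝ} (hθ : Real.sin θ = 0) (t φ : ℝ) :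
    graphTan s (0, 0, 1) (t, θ, φ) = 0 := by
  have h := hasDerivAt_trd (differentiable_graphVec hs) t θ φ
  have h2 : (fun r => graphVec s (t, θ, r)) = fun _ => graphVec s (t, θ, 0) := by
    funext r
    simp [graphVec, graph, point, sphereDir, hθ]
  rw [h2] at h
  exact h.unique (hasDerivAt_const _ _)

lemma graph_add_two_pi (t θ φ : ℝ) :
    graph s (t, θ, φ + 2 * Real.pi) = graph s (t, θ, φ) := by
  simp [graph, sphereDir, point]

lemma graphTan_two_pi (e : ℝ × ℝ × ℝ) (t θ : ℝ) :
    graphTan s e (t, θ, 2 * Real.pi) = graphTan s e (t, θ, 0) := by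
  have h : (fun p => graphVec s (p + (0, 0, 2 * Real.pi))) = graphVec s := by
    funext ⟨t, θ, φ⟩
    simp only [graphVec, Prod.mk_add_mk, add_zero, graph_add_two_pi]
  have h2 := fderiv_comp_add_right (𝕜 := ℝ) (f := graphVec s) (x := (t, θ, 0))
    ((0, 0, 2 * Real.pi) : ℝ × ℝ × ℝ)
  rw [h] at h2
  simp only [Prod.mk_add_mk, add_zero, zero_add] at h2
  rw [graphTan, graphTan, h2]

/-- A smooth, tangential and divergence-free vector field `v^a` on the hyperboloid. -/
structure IsConserved (v : Fin 4 → dS3 → ℝ) : Prop where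
  smooth : ∀ a, Smooth (v a)
  tangent : ∀ X : dS3, mink X.1 (fun a => v a X) = 0
  div_free : ∀ X, ∑ a, dif (v a) X a = 0

/-- A vector field along the homotopy of graphs. -/
def along (s : (Fin 3 → ℝ) → ℝ) (v : Fin 4 → dS3 → ℝ) (p : ℝ × ℝ × ℝ) : Fin 4 → ℝ :=
  fun a => v a (graph s p)

/-- The pull-back of the flux form `det(v, X, ·, ·)` of a vector field, evaluated on two directions
of the parameter space. -/
def fluxForm (s : (Fin 3 → ℝ) → ℝ) (v : Fin 4 → dS3 → ℝ) (e e' p : ℝ × ℝ × ℝ) : ℝ :=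
  det4 (along s v p) (graphVec s p) (graphTan s e p) (graphTan s e' p)

/-- The flux of a vector field through the graph of `s`, with the orientation for which the flux of
`∂_τ` is positive. -/
def flux (v : Fin 4 → dS3 → ℝ) (s : (Fin 3 → ℝ) → ℝ) : ℝ :=
  sphereInt fun θ φ => fluxForm s v (0, 1, 0) (0, 0, 1) (1, θ, φ)

lemma graphVec_mem (p : ℝ × ℝ × ℝ) : graphVec s p ∈ cone := mem_cone _

lemma along_eq (v : Fin 4 → dS3 → ℝ) :
    along s v = fun p a => ext (v a) (graphVec s p) := by
  funext p a; rw [graphVec, ext_coe]; rfl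

lemma contDiff_along (hs : ContDiff ℝ ∞ s) {v : Fin 4 → dS3 → ℝ} (hv : ∀ a, Smooth (v a)) :
    ContDiff ℝ ∞ (along s v) := by
  rw [along_eq]
  exact contDiff_pi.2 fun a => (hv a).comp_contDiff (contDiff_graphVec hs) graphVec_mem

lemma fderiv_along (hs : ContDiff ℝ ∞ s) {v : Fin 4 → dS3 → ℝ} (hv : ∀ a, Smooth (v a))
    (p e : ℝ × ℝ × ℝ) : fderiv ℝ (along s v) p e
      = fderiv ℝ (fun Y a => ext (v a) Y) (graphVec s p) (graphTan s e p) := by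
  have h : DifferentiableAt ℝ (fun Y a => ext (v a) Y) (graphVec s p) :=
    differentiableAt_pi.2 fun a => (hv a).differentiableAt (graphVec_mem p)
  rw [along_eq]
  exact congrArg (fun L => L e)
    (h.hasFDerivAt.comp p (differentiable_graphVec hs p).hasFDerivAt).fderiv

lemma contDiff_fluxForm (hs : ContDiff ℝ ∞ s) {v : Fin 4 → dS3 → ℝ} (hv : ∀ a, Smooth (v a))
    (e e' : ℝ × ℝ × ℝ) : ContDiff ℝ ∞ (fluxForm s v e e') :=
  contDiff_det4 (contDiff_along hs hv) (contDiff_graphVec hs) (contDiff_graphTan hs e)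
    (contDiff_graphTan hs e')

/-- The flux form of a divergence-free vector field is closed. -/
lemma IsConserved.closed (hs : ContDiff ℝ ∞ s) {v : Fin 4 → dS3 → ℝ} (hv : IsConserved v)
    (e₁ e₂ e₃ p : ℝ × ℝ × ℝ) :
    fderiv ℝ (fluxForm s v e₂ e₃) p e₁ + fderiv ℝ (fluxForm s v e₃ e₁) p e₂
      + fderiv ℝ (fluxForm s v e₁ e₂) p e₃ = 0 := by
  have hw := (contDiff_along hs hv.smooth).differentiable (by simp)
  have hd : ∀ e e' e'', fderiv ℝ (fluxForm s v e e') p e'' = _ := fun e e' e'' =>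
    fderiv_det4 hw (differentiable_graphVec hs) (differentiable_graphTan hs e)
      (differentiable_graphTan hs e')
      ((contDiff_fluxForm hs hv.smooth e e').differentiable (by simp)) p e''
  rw [hd, hd, hd, fderiv_along hs hv.smooth, fderiv_along hs hv.smooth, fderiv_along hs hv.smooth,
    fderiv_graphTan_comm hs p e₂ e₁, fderiv_graphTan_comm hs p e₃ e₂,
    fderiv_graphTan_comm hs p e₃ e₁]
  change det4 _ _ _ _ + det4 (along s v p) (graphTan s e₁ p) _ _ + _ + _
    + (det4 _ _ _ _ + det4 (along s v p) (graphTan s e₂ p) _ _ + _ + _)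
    + (det4 _ _ _ _ + det4 (along s v p) (graphTan s e₃ p) _ _ + _ + _) = 0
  -- four tangent vectors are linearly dependent
  have h0 : det4 (along s v p) (graphTan s e₁ p) (graphTan s e₂ p) (graphTan s e₃ p) = 0 :=
    det4_eq_zero_of_orthogonal (mink_self (graph s p)) (hv.tangent _) (mink_graphTan hs _ _)
      (mink_graphTan hs _ _) (mink_graphTan hs _ _)
  -- the remaining terms sum to the trace of the derivative of `v`, its divergence
  have hL : ∀ (w : Fin 4 → ℝ) (a : Fin 4), fderiv ℝ (fun Y a => ext (v a) Y) (graphVec s p) w a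
      = fderiv ℝ (ext (v a)) (graphVec s p) w := fun w a => by
    rw [fderiv_pi fun a => (hv.smooth a).differentiableAt (graphVec_mem p)]
    rfl
  have hX : fderiv ℝ (fun Y a => ext (v a) Y) (graphVec s p) (graphVec s p) = 0 := by
    funext a
    rw [hL, fderiv_ext_self (hv.smooth a) (graphVec_mem p)]; rfl
  have tr := det4_trace (fderiv ℝ (fun Y a => ext (v a) Y) (graphVec s p)) (graphVec s p)
    (graphTan s e₁ p) (graphTan s e₂ p) (graphTan s e₃ p)
  have htr : ∑ i, fderiv ℝ (fun Y a => ext (v a) Y) (graphVec s p) (basisVec i) i = 0 := by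
    simp only [hL]
    exact hv.div_free (graph s p)
  rw [htr, hX, zero_mul] at tr
  generalize fderiv ℝ (fun Y a => ext (v a) Y) (graphVec s p) = L at *
  simp only [det4_eq, Pi.zero_apply] at *
  linear_combination 3 * h0 - tr

/-- The flux of a conserved vector field through a graph does not depend on the graph. -/
lemma IsConserved.flux_eq {v : Fin 4 → dS3 → ℝ} (hv : IsConserved v) (hs : ContDiff ℝ ∞ s) :
    flux v s = sphereInt fun θ φ => v 0 (point 0 θ φ) * Real.sin θ := by
  rw [flux, sphereInt_homotopy (contDiff_fluxForm hs hv.smooth _ _)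
    (contDiff_fluxForm hs hv.smooth (0, 0, 1) (1, 0, 0))
    (contDiff_fluxForm hs hv.smooth (1, 0, 0) (0, 1, 0)) ?_ ?_ ?_
    (hv.closed hs (1, 0, 0) (0, 1, 0) (0, 0, 1))]
  · congr 1
    funext θ φ
    have hp : ∀ θ φ, graph s (0, θ, φ) = point 0 θ φ := fun θ φ => by simp [graph]
    have hv' : ∀ θ φ, graphVec s (0, θ, φ)
        = ![0, Real.cos θ, Real.sin θ * Real.cos φ, Real.sin θ * Real.sin φ] := fun θ φ => by
      rw [graphVec, hp]; simp [point]
    have h2 : graphTan s (0, 1, 0) (0, θ, φ)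
        = ![0, -Real.sin θ, Real.cos θ * Real.cos φ, Real.cos θ * Real.sin φ] := by
      refine (hasDerivAt_snd (differentiable_graphVec hs) 0 θ φ).unique ?_
      simp only [hv']
      refine hasDerivAt_pi.2 fun i => ?_
      fin_cases i
      · exact hasDerivAt_const _ _
      · exact Real.hasDerivAt_cos θ
      · exact (Real.hasDerivAt_sin θ).mul_const _
      · exact (Real.hasDerivAt_sin θ).mul_const _
    have h3 : graphTan s (0, 0, 1) (0, θ, φ)
        = ![0, 0, Real.sin θ * -Real.sin φ, Real.sin θ * Real.cos φ] := by
      refine (hasDerivAt_trd (differentiable_graphVec hs) 0 θ φ).unique ?_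
      simp only [hv']
      refine hasDerivAt_pi.2 fun i => ?_
      fin_cases i
      · exact hasDerivAt_const _ _
      · exact hasDerivAt_const _ _
      · exact (Real.hasDerivAt_cos φ).const_mul _
      · exact (Real.hasDerivAt_sin φ).const_mul _
    rw [fluxForm, h2, h3, hv', det4_eq, along, hp]
    simp
    have e1 := Real.sin_sq_add_cos_sq θ
    have e2 := Real.sin_sq_add_cos_sq φ
    left
    linear_combination Real.sin θ * e1
      + (Real.cos θ ^ 2 * Real.sin θ + Real.sin θ ^ 3) * e2
  · intro t φ
    rw [fluxForm, graphTan_pole hs Real.sin_zero, det4_eq]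
    simp
  · intro t φ
    rw [fluxForm, graphTan_pole hs Real.sin_pi, det4_eq]
    simp
  · intro t θ
    have h := graph_add_two_pi (s := s) t θ 0
    rw [zero_add] at h
    have ha : along s v (t, θ, 2 * Real.pi) = along s v (t, θ, 0) := by
      funext a
      simp only [along, h]
    simp only [fluxForm, graphTan_two_pi, graphVec, h, ha]

/-- The flux of a harmonic one-form vanishes: its flux form is up to sign the exterior derivative of
`curlForm`. -/
lemma IsHarmonicForm.flux_eq_zero {j : Fin 4 → dS3 → ℝ} (hj : IsHarmonicForm j)
    (hs : ContDiff ℝ ∞ s) : flux (fun a X => sgn a * j a X) s = 0 := by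
  have hc : ∀ a, ContDiff ℝ ∞ fun p => along s (curlForm j) p a :=
    contDiff_pi.1 (contDiff_along hs (smooth_curlForm hj.smooth))
  have ht : ∀ e a, ContDiff ℝ ∞ fun p => graphTan s e p a := fun e =>
    contDiff_pi.1 (contDiff_graphTan hs e)
  have hA : ∀ e, ContDiff ℝ ∞ fun p => ∑ a, along s (curlForm j) p a * graphTan s e p a :=
    fun e => ContDiff.sum fun a _ => (hc a).mul (ht e a)
  have hB : ContDiff ℝ ∞ fun p => -∑ a, along s (curlForm j) p a * graphTan s (0, 1, 0) p a :=
    (hA _).neg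
  refine Eq.trans ?_ (sphereInt_exact (hA (0, 0, 1)) hB 1 ?_ ?_ ?_)
  · refine sphereInt_congr fun θ _ φ => ?_
    set p : ℝ × ℝ × ℝ := (1, θ, φ)
    have hd : ∀ e e', fderiv ℝ (fun p => ∑ a, along s (curlForm j) p a * graphTan s e p a) p e'
        = ∑ a, (fderiv ℝ (along s (curlForm j)) p e' a * graphTan s e p a
          + along s (curlForm j) p a * fderiv ℝ (graphTan s e) p e' a) := fun e e' => by
      have d1 := hasFDerivAt_pi'.1 ((contDiff_along hs (smooth_curlForm hj.smooth)).differentiable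
        (by simp) p).hasFDerivAt
      have d2 := hasFDerivAt_pi'.1 (differentiable_graphTan hs e p).hasFDerivAt
      rw [(HasFDerivAt.fun_sum fun a _ => (d1 a).fun_mul (d2 a)).fderiv]
      simp only [sum_apply, add_apply,
        smul_apply, ContinuousLinearMap.comp_apply,
        ContinuousLinearMap.proj_apply, smul_eq_mul]
      exact Finset.sum_congr rfl fun a _ => by ring
    have hα : ∀ e a, fderiv ℝ (along s (curlForm j)) p e a
        = ∑ c, graphTan s e p c * dif (curlForm j a) (graph s p) c := fun e a => by
      rw [fderiv_along hs (smooth_curlForm hj.smooth),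
        fderiv_pi fun a => (smooth_curlForm hj.smooth a).differentiableAt (graphVec_mem p)]
      exact fderiv_eq_sum_pd _ _ _
    have ex := hj.exterior_curlForm_tangent (graph s p) (mink_graphTan hs (0, 1, 0) p)
      (mink_graphTan hs (0, 0, 1) p)
    rw [fderiv_fun_neg, neg_apply, hd, hd, fderiv_graphTan_comm hs p (0, 0, 1)]
    have e1 : fluxForm s (fun a X => sgn a * j a X) (0, 1, 0) (0, 0, 1) p
        = - det4 (graphTan s (0, 1, 0) p) (graphTan s (0, 0, 1) p) (graph s p).1
          (fun f => sgn f * j f (graph s p)) := by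
      change det4 (fun f => sgn f * j f (graph s p)) (graph s p).1 _ _ = _
      simp only [det4_eq]; ring
    rw [e1, ← ex]
    simp only [hα, Fin.sum_univ_four]
    ring
  · intro φ
    simp [graphTan_pole hs Real.sin_zero]
  · intro φ
    simp [graphTan_pole hs Real.sin_pi]
  · intro θ
    have h := graph_add_two_pi (s := s) 1 θ 0
    rw [zero_add] at h
    simp only [graphTan_two_pi, along, h]

end Graph

/-! ### Charges as fluxes -/

lemma tau_point (τ θ φ : ℝ) : tau (point τ θ φ) = τ := by
  simp [tau, point]

lemma harm_point (τ θ φ : ℝ) : harm (point τ θ φ) = sphereDir θ φ := by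
  have h := (Real.cosh_pos τ).ne'
  funext k
  rw [harm, tau_point]
  fin_cases k <;> simp [point, sphereDir, h]

lemma smooth_harm (k : Fin 3) : Smooth fun X => harm X k := by
  have h := fun Y (hY : Y ∈ cone) => ((smooth_coord k.succ).contDiffAt hY).div
    (Real.contDiff_cosh.contDiffAt.comp Y (smooth_tau.contDiffAt hY))
    (Real.cosh_pos _).ne'
  exact smooth_iff.2 h

lemma Cut.smooth_conormal (S : Cut) : Smooth fun Y => tau Y - S.height (harm Y) := by
  refine smooth_iff.2 fun Y hY => (smooth_tau.contDiffAt hY).sub ?_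
  have h : ContDiffAt ℝ ∞ (fun Y => harm (radialProj Y)) Y :=
    contDiffAt_pi.2 fun k => (smooth_harm k).contDiffAt hY
  exact S.smooth.contDiffAt.comp Y h

lemma Cut.param_eq (S : Cut) (θ φ : ℝ) : S.param θ φ = graph S.height (1, θ, φ) := by
  simp [Cut.param, graph, sphereDir]

lemma Cut.tangentTheta_eq (S : Cut) (θ φ : ℝ) :
    S.tangentTheta θ φ = graphTan S.height (0, 1, 0) (1, θ, φ) := by
  simp only [Cut.tangentTheta, S.param_eq]
  exact (hasDerivAt_snd (differentiable_graphVec S.smooth) 1 θ φ).deriv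

lemma Cut.tangentPhi_eq (S : Cut) (θ φ : ℝ) :
    S.tangentPhi θ φ = graphTan S.height (0, 0, 1) (1, θ, φ) := by
  simp only [Cut.tangentPhi, S.param_eq]
  exact (hasDerivAt_trd (differentiable_graphVec S.smooth) 1 θ φ).deriv

/-- The coordinate vector `∂_τ` at the point with coordinates `(τ, θ, φ)`. -/
def pointTau (τ θ φ : ℝ) : Fin 4 → ℝ :=
  ![Real.cosh τ, Real.sinh τ * Real.cos θ, Real.sinh τ * (Real.sin θ * Real.cos φ),
    Real.sinh τ * (Real.sin θ * Real.sin φ)]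

lemma hasDerivAt_point (τ θ φ : ℝ) :
    HasDerivAt (fun r => (point r θ φ).1) (pointTau τ θ φ) τ := by
  refine hasDerivAt_pi.2 fun i => ?_
  fin_cases i
  · exact Real.hasDerivAt_sinh τ
  · exact (Real.hasDerivAt_cosh τ).mul_const _
  · exact (Real.hasDerivAt_cosh τ).mul_const _
  · exact (Real.hasDerivAt_cosh τ).mul_const _

/-- The volume form on `∂_τ`, the normal and the coordinate vectors of a graph is
`cosh² τ sin θ`. -/
lemma det4_pointTau {s : (Fin 3 → ℝ) → ℝ} (hs : ContDiff ℝ ∞ s) (θ φ : ℝ) :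
    det4 (pointTau (s (sphereDir θ φ)) θ φ) (graphVec s (1, θ, φ))
      (graphTan s (0, 1, 0) (1, θ, φ)) (graphTan s (0, 0, 1) (1, θ, φ))
      = Real.cosh (s (sphereDir θ φ)) ^ 2 * Real.sin θ := by
  have hv : ∀ θ φ, graphVec s (1, θ, φ)
      = ![Real.sinh (s (sphereDir θ φ)), Real.cosh (s (sphereDir θ φ)) * Real.cos θ,
        Real.cosh (s (sphereDir θ φ)) * (Real.sin θ * Real.cos φ),
        Real.cosh (s (sphereDir θ φ)) * (Real.sin θ * Real.sin φ)] := fun θ φ => by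
    simp [graphVec, graph, point]
  have hsd : Differentiable ℝ s := hs.differentiable (by simp)
  obtain ⟨a, ha⟩ : ∃ a, HasDerivAt (fun r => s (sphereDir r φ)) a θ := by
    refine ⟨_, ((hsd _).comp θ ?_).hasDerivAt⟩
    refine differentiableAt_pi.2 fun i => ?_
    fin_cases i <;> simp [sphereDir]
  obtain ⟨b, hb⟩ : ∃ b, HasDerivAt (fun r => s (sphereDir θ r)) b φ := by
    refine ⟨_, ((hsd _).comp φ ?_).hasDerivAt⟩
    refine differentiableAt_pi.2 fun i => ?_
    fin_cases i <;> simp [sphereDir]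
  have h2 : graphTan s (0, 1, 0) (1, θ, φ) =
      ![Real.cosh (s (sphereDir θ φ)) * a,
        Real.sinh (s (sphereDir θ φ)) * a * Real.cos θ
          + Real.cosh (s (sphereDir θ φ)) * -Real.sin θ,
        Real.sinh (s (sphereDir θ φ)) * a * (Real.sin θ * Real.cos φ)
          + Real.cosh (s (sphereDir θ φ)) * (Real.cos θ * Real.cos φ),
        Real.sinh (s (sphereDir θ φ)) * a * (Real.sin θ * Real.sin φ)
          + Real.cosh (s (sphereDir θ φ)) * (Real.cos θ * Real.sin φ)] := by
    refine (hasDerivAt_snd (differentiable_graphVec hs) 1 θ φ).unique ?_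
    simp only [hv]
    refine hasDerivAt_pi.2 fun i => ?_
    fin_cases i
    · exact ha.sinh
    · exact ha.cosh.fun_mul (Real.hasDerivAt_cos θ)
    · exact ha.cosh.fun_mul ((Real.hasDerivAt_sin θ).mul_const _)
    · exact ha.cosh.fun_mul ((Real.hasDerivAt_sin θ).mul_const _)
  have h3 : graphTan s (0, 0, 1) (1, θ, φ) =
      ![Real.cosh (s (sphereDir θ φ)) * b,
        Real.sinh (s (sphereDir θ φ)) * b * Real.cos θ,
        Real.sinh (s (sphereDir θ φ)) * b * (Real.sin θ * Real.cos φ)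
          + Real.cosh (s (sphereDir θ φ)) * (Real.sin θ * -Real.sin φ),
        Real.sinh (s (sphereDir θ φ)) * b * (Real.sin θ * Real.sin φ)
          + Real.cosh (s (sphereDir θ φ)) * (Real.sin θ * Real.cos φ)] := by
    refine (hasDerivAt_trd (differentiable_graphVec hs) 1 θ φ).unique ?_
    simp only [hv]
    refine hasDerivAt_pi.2 fun i => ?_
    fin_cases i
    · exact hb.sinh
    · exact hb.cosh.mul_const _
    · exact hb.cosh.fun_mul ((Real.hasDerivAt_cos φ).const_mul _)
    · exact hb.cosh.fun_mul ((Real.hasDerivAt_sin φ).const_mul _)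
  rw [h2, h3, hv, det4_eq]
  simp only [pointTau, Matrix.cons_val]
  have e1 := Real.sin_sq_add_cos_sq θ
  have e2 := Real.sin_sq_add_cos_sq φ
  have e3 := Real.cosh_sq (s (sphereDir θ φ))
  generalize Real.cosh (s (sphereDir θ φ)) = C at *
  generalize Real.sinh (s (sphereDir θ φ)) = H at *
  generalize Real.sin θ = x at *
  generalize Real.cos θ = y at *
  generalize Real.sin φ = z at *
  generalize Real.cos φ = w at *
  linear_combination C ^ 2 * x * ((x ^ 2 + y ^ 2) * (z ^ 2 + w ^ 2) * e3
    + (x ^ 2 + y ^ 2) * e2 + e1)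

/-- The conormal of a cut, as a linear form, vanishes on the tangent vectors of the cut. -/
lemma Cut.conormal_tangent (S : Cut) (θ φ : ℝ) {e : ℝ × ℝ × ℝ} (he : e.1 = 0) :
    fderiv ℝ (ext fun Y => tau Y - S.height (harm Y)) (S.param θ φ).1
      (graphTan S.height e (1, θ, φ)) = 0 := by
  have hl : HasDerivAt (fun r : ℝ => ((1, θ, φ) : ℝ × ℝ × ℝ) + r • e) e 0 := by
    simpa using ((hasDerivAt_id (0 : ℝ)).smul_const e).const_add ((1, θ, φ) : ℝ × ℝ × ℝ)
  have h1 : HasFDerivAt (graphVec S.height) (fderiv ℝ (graphVec S.height) (1, θ, φ))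
      ((1, θ, φ) + (0 : ℝ) • e) := by
    simpa using (differentiable_graphVec S.smooth (1, θ, φ)).hasFDerivAt
  have h2 : HasFDerivAt (ext fun Y => tau Y - S.height (harm Y))
      (fderiv ℝ (ext fun Y => tau Y - S.height (harm Y)) (S.param θ φ).1)
      (graphVec S.height ((1, θ, φ) + (0 : ℝ) • e)) := by
    have := (S.smooth_conormal.differentiableAt (mem_cone (S.param θ φ))).hasFDerivAt
    simpa [S.param_eq, graphVec] using this
  have h3 := h2.comp_hasDerivAt (0 : ℝ) (h1.comp_hasDerivAt (0 : ℝ) hl)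
  have h4 : ((ext fun Y => tau Y - S.height (harm Y)) ∘
      graphVec S.height ∘ fun r : ℝ => ((1, θ, φ) : ℝ × ℝ × ℝ) + r • e) = fun _ => 0 := by
    funext r
    simp [graphVec, graph, tau_point, harm_point, he]
  rw [h4] at h3
  exact h3.unique (hasDerivAt_const _ _)

lemma Cut.conormal_pointTau (S : Cut) (θ φ : ℝ) :
    fderiv ℝ (ext fun Y => tau Y - S.height (harm Y)) (S.param θ φ).1
      (pointTau (S.height (sphereDir θ φ)) θ φ) = 1 := by
  have h2 : HasFDerivAt (ext fun Y => tau Y - S.height (harm Y))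
      (fderiv ℝ (ext fun Y => tau Y - S.height (harm Y)) (S.param θ φ).1)
      (point (S.height (sphereDir θ φ)) θ φ).1 :=
    (S.smooth_conormal.differentiableAt (mem_cone (S.param θ φ))).hasFDerivAt
  have h3 := h2.comp_hasDerivAt _ (hasDerivAt_point (S.height (sphereDir θ φ)) θ φ)
  have h4 : ((ext fun Y => tau Y - S.height (harm Y)) ∘ fun r => (point r θ φ).1)
      = fun r => r - S.height (sphereDir θ φ) := by
    funext r
    simp [tau_point, harm_point]
  rw [h4] at h3
  exact h3.unique ((hasDerivAt_id _).sub_const _)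

/-- The current `T_a^b ξ^a`, a vector field. -/
def current (T : Field2) (ξ : dS3 → Fin 4 → ℝ) (b : Fin 4) (X : dS3) : ℝ :=
  sgn b * ∑ a, T X a b * ξ X a

/-- A charge is minus the flux of its current.  The vector area `n^b d²S` is up to sign the dual of
`det(·, X, ∂_θ, ∂_φ)`; the sign arises because the future normal is timelike: `n_b` is minus
the normalized conormal `dτ - ds`. -/
lemma Cut.charge_eq (S : Cut) (T : Field2) (ξ : dS3 → Fin 4 → ℝ) :
    S.charge T ξ = - flux (current T ξ) S.height := by
  rw [flux, neg_eq_neg_one_mul, ← sphereInt_const_mul]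
  refine sphereInt_congr fun θ hθ φ => ?_
  have hsp := S.spacelike (S.param θ φ) (by
    rw [Cut.param, tau_point, harm_point]; rfl)
  have hc := S.conormal_pointTau θ φ
  have hu := S.conormal_tangent θ φ (e := (0, 1, 0)) rfl
  have hw := S.conormal_tangent θ φ (e := (0, 0, 1)) rfl
  have hX := fderiv_ext_self S.smooth_conormal (mem_cone (S.param θ φ))
  have hD := det4_pointTau S.smooth θ φ
  have hD0 : 0 ≤ Real.cosh (S.height (sphereDir θ φ)) ^ 2 * Real.sin θ :=
    mul_nonneg (sq_nonneg _) (Real.sin_nonneg_of_mem_Icc hθ)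
  have mu := mink_graphTan S.smooth (0, 1, 0) (1, θ, φ)
  have mw := mink_graphTan S.smooth (0, 0, 1) (1, θ, φ)
  have hN : ∀ a, fderiv ℝ (ext fun Y => tau Y - S.height (harm Y)) (S.param θ φ).1 (basisVec a)
      = S.conormal (S.param θ φ) a := fun a => rfl
  have hsp' : 0 < -∑ c, sgn c * S.conormal (S.param θ φ) c ^ 2 := neg_pos.2 hsp
  simp only [fluxForm, Cut.area, Cut.normal, S.tangentTheta_eq, S.tangentPhi_eq]
  have hG : graphVec S.height (1, θ, φ) = (S.param θ φ).1 := by rw [S.param_eq]; rfl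
  have hA : along S.height (current T ξ) (1, θ, φ) = fun b => current T ξ b (S.param θ φ) := by
    rw [S.param_eq]; rfl
  rw [hG] at hD mu mw ⊢
  rw [hA]
  generalize graphTan S.height (0, 1, 0) (1, θ, φ) = u at *
  generalize graphTan S.height (0, 0, 1) (1, θ, φ) = w at *
  generalize Real.cosh (S.height (sphereDir θ φ)) ^ 2 * Real.sin θ = D at *
  generalize S.param θ φ = X at *
  -- by Cramer's rule the vector product of the coordinate vectors is parallel to the conormal
  have key : ∀ a, det4 (basisVec a) X.1 u w = S.conormal X a * D := fun a => by
    have cr := det4_cramer (fderiv ℝ (ext fun Y => tau Y - S.height (harm Y)) X.1)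
      (basisVec a) X.1 u w (pointTau (S.height (sphereDir θ φ)) θ φ)
    rw [hc, hu, hw, hX, hN, det4_swap34 X.1, det4_swap23 X.1, det4_swap12 X.1, hD] at cr
    linarith
  have hgram := sum_sgn_det4_sq (mink_self X) mu mw
  simp only [key, mul_pow, ← mul_assoc, ← Finset.sum_mul] at hgram
  have harea : √(mink u u * mink w w - mink u w ^ 2)
      = √(-∑ c, sgn c * S.conormal X c ^ 2) * D := by
    rw [show mink u u * mink w w - mink u w ^ 2
      = (-∑ c, sgn c * S.conormal X c ^ 2) * D ^ 2 by linarith,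
      Real.sqrt_mul hsp'.le, Real.sqrt_sq hD0]
  rw [harea, det4_sum_left]
  simp only [key]
  have hq := (Real.sqrt_pos.2 hsp').ne'
  generalize √(-∑ c, sgn c * S.conormal X c ^ 2) = q at *
  simp only [current, Finset.sum_mul, Finset.mul_sum]
  rw [Finset.sum_comm]
  refine Finset.sum_congr rfl fun b _ => Finset.sum_congr rfl fun a _ => ?_
  field_simp

/-! ### Conserved currents -/

/-- A Killing vector field of the hyperboloid: the restriction of a linear vector field
`ξ^a = M^a_c X^c` with `M_{ac}` antisymmetric. -/
def IsKilling (ξ : dS3 → Fin 4 → ℝ) : Prop :=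
  ∃ M : Fin 4 → Fin 4 → ℝ, (∀ a c, sgn a * M a c = - (sgn c * M c a)) ∧
    ∀ X a, ξ X a = ∑ c, M a c * X.1 c

lemma isKilling_rot (k : Fin 3) : IsKilling (rot k) := by
  refine ⟨fun a c => (if a = (k + 2).succ ∧ c = (k + 1).succ then 1 else 0)
    - (if a = (k + 1).succ ∧ c = (k + 2).succ then 1 else 0), fun a c => ?_, fun X a => ?_⟩
  · fin_cases k <;> fin_cases a <;> fin_cases c <;> simp [sgn]
  · fin_cases k <;> fin_cases a <;> simp [rot]

lemma isKilling_boost (k : Fin 3) : IsKilling (boost k) := by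
  refine ⟨fun a c => (if a = 0 ∧ c = k.succ then 1 else 0)
    + (if a = k.succ ∧ c = 0 then 1 else 0), fun a c => ?_, fun X a => ?_⟩
  · fin_cases k <;> fin_cases a <;> fin_cases c <;> simp [sgn]
  · fin_cases k <;> fin_cases a <;> simp [boost]

/-- The current of a Killing field is conserved, as `T_{ab}` is divergence-free and symmetric while
`∂_a ξ_b` is antisymmetric. -/
lemma IsFlatSolution.isConserved_current {T : Field2} (hT : IsFlatSolution T)
    {ξ : dS3 → Fin 4 → ℝ} (hξ : IsKilling ξ) : IsConserved (current T ξ) := by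
  obtain ⟨M, hM, hξ⟩ := hξ
  have hsξ : ∀ a, Smooth fun X => ξ X a := fun a => by
    simp only [hξ]
    exact Smooth.sum fun c _ => (smooth_const _).mul (smooth_coord c)
  have hsp : ∀ a b, Smooth fun X => T X a b * ξ X a := fun a b => (hT.tensor.smooth a b).mul (hsξ a)
  refine ⟨fun b => (smooth_const _).mul (Smooth.sum fun a _ => hsp a b), fun X => ?_, fun X => ?_⟩
  · have h : ∀ b, sgn b * X.1 b * current T ξ b X = ∑ a, ξ X a * (X.1 b * T X a b) := fun b => by
      rw [current, ← mul_assoc, Finset.mul_sum]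
      refine Finset.sum_congr rfl fun a _ => ?_
      linear_combination X.1 b * T X a b * ξ X a * sgn_mul_sgn b
    simp only [mink, h]
    rw [Finset.sum_comm]
    simp only [← Finset.mul_sum, hT.tensor.tangent_right, mul_zero, Finset.sum_const_zero]
  · have hdξ : ∀ a b, dif (fun X => ξ X a) X b = M a b - sgn b * X.1 b * ξ X a := fun a b => by
      simp only [hξ]
      rw [dif_sum _ fun c _ => (smooth_const _).mul (smooth_coord c)]
      simp only [dif_mul (smooth_const _) (smooth_coord _), dif_const, dif_coord, zero_mul,
        zero_add, mul_sub, Finset.sum_sub_distrib, Finset.mul_sum]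
      simp only [mul_ite, mul_one, mul_zero, Finset.sum_ite_eq, Finset.mem_univ, if_true]
      congr 1
      exact Finset.sum_congr rfl fun c _ => by ring
    have h : ∀ b, dif (current T ξ b) X b = ∑ a, (ξ X a * (sgn b * dif (fun Y => T Y a b) X b)
        + sgn b * M a b * T X a b - ξ X a * (X.1 b * T X a b)) := fun b => by
      have : current T ξ b = fun X => sgn b * ∑ a, T X a b * ξ X a := rfl
      rw [this, dif_mul (smooth_const _) (Smooth.sum fun a _ => hsp a b), dif_const, zero_mul,
        zero_add, dif_sum _ fun a _ => hsp a b, Finset.mul_sum]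
      refine Finset.sum_congr rfl fun a _ => ?_
      rw [dif_mul (hT.tensor.smooth a b) (hsξ a), hdξ]
      linear_combination (-X.1 b * T X a b * ξ X a) * sgn_mul_sgn b
    have hanti : ∑ b, ∑ a, sgn b * M a b * T X a b = 0 := by
      have h' : ∑ b, ∑ a, sgn b * M a b * T X a b = - ∑ b, ∑ a, sgn b * M a b * T X a b := by
        conv_lhs => rw [Finset.sum_comm]
        simp only [← Finset.sum_neg_distrib]
        refine Finset.sum_congr rfl fun b _ => Finset.sum_congr rfl fun a _ => ?_
        rw [hT.symm X b a]
        linear_combination sgn a * sgn b * T X a b * hM a b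
          - M a b * T X a b * sgn b * sgn_mul_sgn a
          - M b a * T X a b * sgn a * sgn_mul_sgn b
      linarith
    simp only [h, Finset.sum_add_distrib, Finset.sum_sub_distrib, hanti]
    rw [Finset.sum_comm, Finset.sum_comm (f := fun b a => ξ X a * (X.1 b * T X a b))]
    simp only [← Finset.mul_sum, hT.tensor.tangent_right, hT.div_free, mul_zero,
      Finset.sum_const_zero]
    ring

/-- The charge `∫ T_{ab} ξ^a n^b d²S` on the cut `τ = 0`, where `n = ∂_0` and
`d²S = sin θ dθ dφ`. -/
def restCharge (T : Field2) (ξ : dS3 → Fin 4 → ℝ) : ℝ :=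
  sphereInt fun θ φ => (∑ a, T (point 0 θ φ) a 0 * ξ (point 0 θ φ) a) * Real.sin θ

/-- The charge of a Killing field does not depend on the cut. -/
lemma IsFlatSolution.charge_killing {T : Field2} (hT : IsFlatSolution T) {ξ : dS3 → Fin 4 → ℝ}
    (hξ : IsKilling ξ) (S : Cut) :
    S.charge T ξ = restCharge T ξ := by
  rw [restCharge, S.charge_eq, (hT.isConserved_current hξ).flux_eq S.smooth, neg_eq_neg_one_mul,
    ← sphereInt_const_mul]
  refine sphereInt_congr fun θ _ φ => ?_
  simp [current, sgn]

/-- The translation charges of every solution vanish: tangency of `T` makes the current of `ζ_(l)`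
the column `T_{al}`, which is a harmonic one-form. -/
lemma IsFlatSolution.charge_transl {T : Field2} (hT : IsFlatSolution T) (l : Fin 4) (S : Cut) :
    S.charge T (transl l) = 0 := by
  have h : current T (transl l) = fun a X => sgn a * (sgn l * T X a l) := by
    funext b X
    have h1 : ∀ a, T X a b * transl l X a
        = (if a = l then sgn l * T X l b else 0) - X.1 l * (X.1 a * T X a b) := fun a => by
      rw [transl, show zeta l = fun Y : dS3 => Y.1 l from rfl, dif_coord]
      split_ifs with h
      · subst h
        linear_combination (-T X a b * X.1 a * X.1 a) * sgn_mul_sgn a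
      · linear_combination (-T X a b * X.1 a * X.1 l) * sgn_mul_sgn a
    simp only [current, h1, Finset.sum_sub_distrib, ← Finset.mul_sum, hT.tensor.tangent_left]
    simp [hT.symm X l b]
  rw [S.charge_eq, h, ((hT.const_mul (sgn l)).column l).flux_eq_zero S.smooth, neg_zero]

/-! ### The charges of `V` and `W` -/

lemma sphereInt_mul (f g : ℝ → ℝ) : sphereInt (fun θ φ => f θ * g φ)
    = (∫ θ in (0 : ℝ)..Real.pi, f θ) * ∫ φ in (0 : ℝ)..(2 * Real.pi), g φ := by
  simp only [sphereInt, intervalIntegral.integral_const_mul, intervalIntegral.integral_mul_const]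

lemma sphereInt_sin : sphereInt (fun θ _ => Real.sin θ) = 4 * Real.pi := by
  have h := sphereInt_mul Real.sin fun _ => 1
  simp only [mul_one, integral_sin, intervalIntegral.integral_const, smul_eq_mul, Real.cos_zero,
    Real.cos_pi] at h
  rw [h]; ring

/-- The second moments of the unit sphere. -/
lemma sphereInt_sphereDir_mul (k l : Fin 3) :
    sphereInt (fun θ φ => sphereDir θ φ k * sphereDir θ φ l * Real.sin θ)
      = 4 * Real.pi / 3 * if k = l then 1 else 0 := by
  -- separation of the variables
  have split : (fun θ φ => sphereDir θ φ k * sphereDir θ φ l * Real.sin θ)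
      = fun θ φ => (![Real.cos θ, Real.sin θ, Real.sin θ] k
          * ![Real.cos θ, Real.sin θ, Real.sin θ] l * Real.sin θ)
          * (![1, Real.cos φ, Real.sin φ] k * ![1, Real.cos φ, Real.sin φ] l) := by
    funext θ φ
    fin_cases k <;> fin_cases l <;> simp [sphereDir] <;> try ring
  have h1 : ∫ θ in (0 : ℝ)..Real.pi, Real.cos θ * Real.cos θ * Real.sin θ = 2 / 3 := by
    have h := integral_sin_mul_cos_sq (a := 0) (b := Real.pi)
    simp only [Real.cos_zero, Real.cos_pi] at h
    simp only [show ∀ θ : ℝ, Real.cos θ * Real.cos θ * Real.sin θ = Real.sin θ * Real.cos θ ^ 2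
      from fun θ => by ring, h]
    norm_num
  have h2 : ∫ θ in (0 : ℝ)..Real.pi, Real.sin θ * Real.sin θ * Real.sin θ = 4 / 3 := by
    have h := integral_sin_pow_odd 1
    simp only [Finset.prod_range_one, mul_one, Nat.reduceAdd] at h
    simp only [show ∀ θ : ℝ, Real.sin θ * Real.sin θ * Real.sin θ = Real.sin θ ^ 3
      from fun θ => by ring, h]
    norm_num
  have h3 : ∫ φ in (0 : ℝ)..(2 * Real.pi), Real.cos φ * Real.cos φ = Real.pi := by
    have h := integral_cos_sq (a := 0) (b := 2 * Real.pi)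
    simp only [Real.sin_zero, Real.sin_two_pi, mul_zero, sub_zero, zero_add] at h
    simp only [← pow_two, h]
    ring
  have h4 : ∫ φ in (0 : ℝ)..(2 * Real.pi), Real.sin φ * Real.sin φ = Real.pi := by
    have h := integral_sin_sq (a := 0) (b := 2 * Real.pi)
    simp only [Real.sin_zero, Real.sin_two_pi, zero_mul, sub_zero, zero_add] at h
    simp only [← pow_two, h]
    ring
  have h5 : ∫ φ in (0 : ℝ)..(2 * Real.pi), Real.sin φ * Real.cos φ = 0 := by
    simp [integral_sin_mul_cos₁]
  have h6 : ∫ φ in (0 : ℝ)..(2 * Real.pi), Real.cos φ * Real.sin φ = 0 := by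
    simp only [mul_comm (Real.cos _), h5]
  rw [split, sphereInt_mul (fun θ => ![Real.cos θ, Real.sin θ, Real.sin θ] k
      * ![Real.cos θ, Real.sin θ, Real.sin θ] l * Real.sin θ)
    (fun φ => ![1, Real.cos φ, Real.sin φ] k * ![1, Real.cos φ, Real.sin φ] l)]
  fin_cases k <;> fin_cases l <;> simp [h1, h2, h3, h4, h5, h6] <;> ring

lemma point_zero_val (θ φ : ℝ) : (point 0 θ φ).1
    = ![0, sphereDir θ φ 0, sphereDir θ φ 1, sphereDir θ φ 2] := by
  simp [point, sphereDir]

lemma sphereDir_sq (θ φ : ℝ) :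
    sphereDir θ φ 0 ^ 2 + sphereDir θ φ 1 ^ 2 + sphereDir θ φ 2 ^ 2 = 1 := by
  have e1 := Real.sin_sq_add_cos_sq θ
  have e2 := Real.sin_sq_add_cos_sq φ
  simp only [sphereDir, Matrix.cons_val]
  linear_combination e1 + Real.sin θ ^ 2 * e2

lemma frac_point_zero (P : MvPolynomial (Fin 4) ℝ) (n : ℕ) (θ φ : ℝ) :
    frac P n (point 0 θ φ).1 = P.eval (point 0 θ φ).1 := by
  simp [frac, sqrt_radSq_coe, tau_point]

lemma radSq_point_zero (θ φ : ℝ) : radSq (point 0 θ φ).1 = 1 := by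
  simp [radSq_coe, tau_point]

/-- At `τ = 0` the components of `V_(k)` along the normal `∂_0` are those of `2 f_(k) dτ dτ`. -/
lemma V_point_zero (k : Fin 3) (θ φ : ℝ) (a : Fin 4) :
    V k (point 0 θ φ) a 0 = if a = 0 then 2 * sphereDir θ φ k else 0 := by
  rw [V_eq, frac_point_zero]
  have h0 := radSq_point_zero θ φ
  have h1 : (point 0 θ φ).1 k.succ = sphereDir θ φ k := by
    fin_cases k <;> simp [point_zero_val]
  have h2 : (point 0 θ φ).1 0 = 0 := by simp [point_zero_val]
  simp only [polyV, map_add, map_sub, map_mul, MvPolynomial.eval_X, MvPolynomial.eval_C,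
    eval_minkPoly_coe, eval_radSqPoly, h0, eval_difPoly, h1, h2, metricPoly]
  fin_cases a <;> simp [sgn, h2]
  ring

/-- At `τ = 0` the components of `W_(k)` along the normal `∂_0` are the rotation `e_k × X`. -/
lemma W_point_zero (k : Fin 3) (θ φ : ℝ) (a : Fin 4) :
    W k (point 0 θ φ) a 0 = (crossPoly k a).eval (point 0 θ φ).1 := by
  rw [W_eq, frac_point_zero]
  have h2 : (point 0 θ φ).1 0 = 0 := by simp [point_zero_val]
  have h3 : (crossPoly k 0).eval (point 0 θ φ).1 = 0 := by
    fin_cases k <;> simp [eval_crossPoly, crossCoeff]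
  simp [polyW, eval_minkPoly_coe, eval_difPoly, h2, h3]

lemma restCharge_V_boost (k l : Fin 3) :
    restCharge (V k) (boost l) = 8 * Real.pi / 3 * if k = l then 1 else 0 := by
  have h := sphereInt_const_mul 2 fun θ φ => sphereDir θ φ k * sphereDir θ φ l * Real.sin θ
  rw [sphereInt_sphereDir_mul] at h
  rw [restCharge, show 8 * Real.pi / 3 * (if k = l then (1 : ℝ) else 0)
    = 2 * (4 * Real.pi / 3 * if k = l then 1 else 0) by ring, ← h]
  congr 1
  funext θ φ
  simp only [V_point_zero, Fin.sum_univ_four, boost]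
  fin_cases l <;> simp [point_zero_val] <;> ring

lemma restCharge_V_rot (k l : Fin 3) : restCharge (V k) (rot l) = 0 := by
  have h : ∀ X, rot l X 0 = 0 := fun X => by fin_cases l <;> simp [rot]
  simp [restCharge, V_point_zero, h, sphereInt]

lemma restCharge_W_boost (k l : Fin 3) : restCharge (W k) (boost l) = 0 := by
  have h : ∀ θ φ, ∑ a, W k (point 0 θ φ) a 0 * boost l (point 0 θ φ) a = 0 := fun θ φ => by
    simp only [W_point_zero, eval_crossPoly, Fin.sum_univ_four, boost]
    fin_cases k <;> fin_cases l <;> simp [point_zero_val, crossCoeff]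
  simp [restCharge, h, sphereInt]

lemma continuous_point : Continuous fun q : ℝ × ℝ => (point 0 q.1 q.2).1 := by
  refine continuous_pi fun i => ?_
  fin_cases i <;> simp [point] <;> fun_prop

lemma continuous_sphereDir (k : Fin 3) : Continuous fun q : ℝ × ℝ => sphereDir q.1 q.2 k := by
  fin_cases k <;> simp [sphereDir] <;> fun_prop

lemma restCharge_W_rot (k l : Fin 3) :
    restCharge (W k) (rot l) = 8 * Real.pi / 3 * if k = l then 1 else 0 := by
  -- `(e_k × f) · (e_l × f) = δ_kl - f_k f_l` on the unit sphere
  have h0 : ∀ θ φ, ∑ a, W k (point 0 θ φ) a 0 * rot l (point 0 θ φ) a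
      = (if k = l then 1 else 0) - sphereDir θ φ k * sphereDir θ φ l := fun θ φ => by
    have hf := sphereDir_sq θ φ
    simp only [W_point_zero, eval_crossPoly, Fin.sum_univ_four, rot]
    fin_cases k <;> fin_cases l <;> simp [point_zero_val, crossCoeff] <;>
      first | linear_combination hf | ring1
  have h : ∀ θ φ, (∑ a, W k (point 0 θ φ) a 0 * rot l (point 0 θ φ) a) * Real.sin θ
      = (if k = l then 1 else 0) * Real.sin θ
        + -1 * (sphereDir θ φ k * sphereDir θ φ l * Real.sin θ) := fun θ φ => by
    rw [h0]; ring
  have h1 := sphereInt_const_mul (if k = l then 1 else 0) fun θ _ => Real.sin θ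
  have h2 := sphereInt_const_mul (-1) fun θ φ => sphereDir θ φ k * sphereDir θ φ l * Real.sin θ
  rw [sphereInt_sin] at h1
  rw [sphereInt_sphereDir_mul] at h2
  simp only [restCharge, h]
  rw [sphereInt_add (F := fun θ _ => (if k = l then 1 else 0) * Real.sin θ)
    (G := fun θ φ => -1 * (sphereDir θ φ k * sphereDir θ φ l * Real.sin θ))
    (by simp only [Function.uncurry_def]; fun_prop) ?_, h1, h2]
  · ring
  · have := (continuous_sphereDir k).mul (continuous_sphereDir l)
    exact continuous_const.mul (this.mul (Real.continuous_sin.comp continuous_fst))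

/-! ### Linearity of the charges and the decomposition -/

lemma IsFlatSolution.continuous_rest {T : Field2} (hT : IsFlatSolution T)
    {ξ : dS3 → Fin 4 → ℝ} (hξ : IsKilling ξ) : Continuous (Function.uncurry fun θ φ =>
      (∑ a, T (point 0 θ φ) a 0 * ξ (point 0 θ φ) a) * Real.sin θ) := by
  obtain ⟨M, -, hξ⟩ := hξ
  have hp : ∀ c, Continuous fun q : ℝ × ℝ => (point 0 q.1 q.2).1 c :=
    continuous_pi_iff.1 continuous_point
  have hT' : ∀ a, Continuous fun q : ℝ × ℝ => T (point 0 q.1 q.2) a 0 := fun a => by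
    have h : (fun q : ℝ × ℝ => T (point 0 q.1 q.2) a 0)
        = fun q : ℝ × ℝ => ext (fun X => T X a 0) (point 0 q.1 q.2).1 := by
      funext q; rw [ext_coe]
    rw [h]
    refine continuous_iff_continuousAt.2 fun q => ?_
    exact ContinuousAt.comp (g := ext fun X => T X a 0)
      ((hT.tensor.smooth a 0).differentiableAt (mem_cone _)).continuousAt
      continuous_point.continuousAt
  simp only [Function.uncurry_def, hξ]
  exact (continuous_finsetSum _ fun a _ => (hT' a).mul (continuous_finsetSum _ fun c _ =>
    continuous_const.mul (hp c))).mul (Real.continuous_sin.comp continuous_fst)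

lemma restCharge_const_mul (T : Field2) (ξ : dS3 → Fin 4 → ℝ) (k : ℝ) :
    restCharge (fun X a b => k * T X a b) ξ = k * restCharge T ξ := by
  rw [restCharge, restCharge, ← sphereInt_const_mul]
  refine sphereInt_congr fun θ _ φ => ?_
  simp only [mul_assoc, ← Finset.mul_sum]

lemma restCharge_add {T U : Field2} (hT : IsFlatSolution T) (hU : IsFlatSolution U)
    {ξ : dS3 → Fin 4 → ℝ} (hξ : IsKilling ξ) :
    restCharge (fun X a b => T X a b + U X a b) ξ = restCharge T ξ + restCharge U ξ := by
  rw [restCharge, restCharge, restCharge,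
    ← sphereInt_add (hT.continuous_rest hξ) (hU.continuous_rest hξ)]
  refine sphereInt_congr fun θ _ φ => ?_
  simp only [add_mul, Finset.sum_add_distrib]

lemma restCharge_sum {ι : Type*} (s : Finset ι) {T : ι → Field2} (hT : ∀ i, IsFlatSolution (T i))
    {ξ : dS3 → Fin 4 → ℝ} (hξ : IsKilling ξ) :
    restCharge (fun X a b => ∑ i ∈ s, T i X a b) ξ = ∑ i ∈ s, restCharge (T i) ξ := by
  classical
  induction s using Finset.induction_on with
  | empty => simp [restCharge, sphereInt]
  | insert i s hi ih =>
    simp only [Finset.sum_insert hi]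
    rw [restCharge_add (hT i) (IsFlatSolution.sum s hT) hξ, ih]

/-- The linear combination `∑ᵢ (vᵢ V_(i) + wᵢ W_(i))`. -/
def combo (v w : Fin 3 → ℝ) : Field2 := fun X a b => ∑ i, (v i * V i X a b + w i * W i X a b)

lemma isFlatSolution_combo (v w : Fin 3 → ℝ) : IsFlatSolution (combo v w) :=
  IsFlatSolution.sum _ fun i =>
    ((isFlatSolution_V i).const_mul (v i)).add ((isFlatSolution_W i).const_mul (w i))

lemma restCharge_combo (v w : Fin 3 → ℝ) {ξ : dS3 → Fin 4 → ℝ} (hξ : IsKilling ξ) :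
    restCharge (combo v w) ξ = ∑ i, (v i * restCharge (V i) ξ + w i * restCharge (W i) ξ) := by
  have h : ∀ i, restCharge (fun X a b => v i * V i X a b + w i * W i X a b) ξ
      = v i * restCharge (V i) ξ + w i * restCharge (W i) ξ := fun i => by
    rw [restCharge_add ((isFlatSolution_V i).const_mul (v i))
      ((isFlatSolution_W i).const_mul (w i)) hξ, restCharge_const_mul, restCharge_const_mul]
  simp only [← h]
  exact restCharge_sum _ (fun i =>
    ((isFlatSolution_V i).const_mul (v i)).add ((isFlatSolution_W i).const_mul (w i))) hξ

lemma restCharge_combo_boost (v w : Fin 3 → ℝ) (l : Fin 3) :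
    restCharge (combo v w) (boost l) = 8 * Real.pi / 3 * v l := by
  rw [restCharge_combo v w (isKilling_boost l)]
  simp [restCharge_V_boost, restCharge_W_boost, mul_comm]

lemma restCharge_combo_rot (v w : Fin 3 → ℝ) (l : Fin 3) :
    restCharge (combo v w) (rot l) = 8 * Real.pi / 3 * w l := by
  rw [restCharge_combo v w (isKilling_rot l)]
  simp [restCharge_V_rot, restCharge_W_rot, mul_comm]

/-- The boost and rotation charges of a tensor and of its remainder determine the coefficients of
the decomposition. -/
lemma restCharge_of_decomposes {T J : Field2} {v w : Fin 3 → ℝ} (h : Decomposes T v w J)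
    (hJ : IsFlatSolution J) (l : Fin 3) :
    restCharge T (boost l) = 8 * Real.pi / 3 * v l + restCharge J (boost l) ∧
      restCharge T (rot l) = 8 * Real.pi / 3 * w l + restCharge J (rot l) := by
  have hT : T = fun X a b => combo v w X a b + J X a b := by
    funext X a b; exact h X a b
  constructor
  · rw [hT, restCharge_add (isFlatSolution_combo v w) hJ (isKilling_boost l),
      restCharge_combo_boost]
  · rw [hT, restCharge_add (isFlatSolution_combo v w) hJ (isKilling_rot l),
      restCharge_combo_rot]

end

end DeSitter

theorem lemma3 :
    -- the explicit tensors are regular solutions, and dual to each other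
    (∀ k, IsSolution (V k)) ∧ (∀ k, IsSolution (W k)) ∧
    (∀ k, curl (V k) = - W k) ∧ (∀ k, curl (W k) = V k) ∧
    -- their charges on an arbitrary cut
    (∀ (S : Cut) (k : Fin 3) (l : Fin 4),
      S.charge (V k) (transl l) = 0 ∧ S.charge (W k) (transl l) = 0) ∧
    (∀ (S : Cut) (k l : Fin 3),
      S.charge (V k) (rot l) = 0 ∧ S.charge (W k) (boost l) = 0) ∧
    (∀ (S : Cut) (k l : Fin 3),
      S.charge (V k) (boost l) = 8 * Real.pi / 3 * (if k = l then 1 else 0) ∧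
      S.charge (W k) (rot l) = 8 * Real.pi / 3 * (if k = l then 1 else 0)) ∧
    -- the decomposition; uniqueness only needs the charges of the remainder on a single cut
    (∀ T : Field2, IsSolution T →
      ∃ (v w : Fin 3 → ℝ) (J : Field2),
        Decomposes T v w J ∧ IsSolution J ∧ (∀ S : Cut, S.NoCharges J) ∧
        ∀ (v' w' : Fin 3 → ℝ) (J' : Field2),
          Decomposes T v' w' J' → IsSolution J' → (∃ S : Cut, S.NoCharges J') →
            v' = v ∧ w' = w ∧ J' = J) := by
  have hV := isFlatSolution_V
  have hW := isFlatSolution_W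
  refine ⟨fun k => isSolution_iff.2 (hV k), fun k => isSolution_iff.2 (hW k), curl_V, curl_W,
    fun S k l => ⟨(hV k).charge_transl l S, (hW k).charge_transl l S⟩,
    fun S k l => ⟨((hV k).charge_killing (isKilling_rot l) S).trans (restCharge_V_rot k l),
      ((hW k).charge_killing (isKilling_boost l) S).trans (restCharge_W_boost k l)⟩,
    fun S k l => ⟨((hV k).charge_killing (isKilling_boost l) S).trans (restCharge_V_boost k l),
      ((hW k).charge_killing (isKilling_rot l) S).trans (restCharge_W_rot k l)⟩,
    fun T hT => ?_⟩
  rw [isSolution_iff] at hT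
  have hc : 8 * Real.pi / 3 ≠ 0 := by positivity
  set v : Fin 3 → ℝ := fun i => restCharge T (boost i) / (8 * Real.pi / 3) with hv
  set w : Fin 3 → ℝ := fun i => restCharge T (rot i) / (8 * Real.pi / 3) with hw
  set J : Field2 := fun X a b => T X a b + -1 * combo v w X a b with hJ'
  have hJ : IsFlatSolution J := hT.add ((isFlatSolution_combo v w).const_mul (-1))
  have hd : Decomposes T v w J := fun X a b => by simp only [hJ', combo]; ring
  -- the coefficients are read off from the charges of `T`, by the charges of `V` and `W`
  refine ⟨v, w, J, hd, isSolution_iff.2 hJ, fun S => ⟨fun l => ?_, fun l => ?_,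
    fun l => hJ.charge_transl l S⟩, fun v' w' J' hd' hJ' ⟨S, hr, hb, _⟩ => ?_⟩
  · refine (hJ.charge_killing (isKilling_rot l) S).trans ?_
    have h := (restCharge_of_decomposes hd hJ l).2
    simp only [hw, mul_div_cancel₀ _ hc] at h
    exact left_eq_add.1 h
  · refine (hJ.charge_killing (isKilling_boost l) S).trans ?_
    have h := (restCharge_of_decomposes hd hJ l).1
    simp only [hv, mul_div_cancel₀ _ hc] at h
    exact left_eq_add.1 h
  · rw [isSolution_iff] at hJ'
    have ev : v' = v := funext fun l => by
      have h := (restCharge_of_decomposes hd' hJ' l).1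
      have h0 : restCharge J' (boost l) = 0 :=
        (hJ'.charge_killing (isKilling_boost l) S).symm.trans (hb l)
      rw [h0, add_zero] at h
      simp only [hv, h, mul_div_cancel_left₀ _ hc]
    have ew : w' = w := funext fun l => by
      have h := (restCharge_of_decomposes hd' hJ' l).2
      have h0 : restCharge J' (rot l) = 0 :=
        (hJ'.charge_killing (isKilling_rot l) S).symm.trans (hr l)
      rw [h0, add_zero] at h
      simp only [hw, h, mul_div_cancel_left₀ _ hc]
    refine ⟨ev, ew, ?_⟩
    funext X a b
    have h1 := hd X a b
    have h2 := hd' X a b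
    rw [ev, ew] at h2
    linarith
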